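/- Let $\Omega\subset\mathbb R^2$ be a bounded open set whose boundary $\Gamma$ is of class $C^{1,1}$ (in particular, any bounded smooth domain), with unit outer normal ${\bf n}$. For a finite conforming triangulation ${\mathcal T}_h$ by closed non-degenerate triangles let $\Omega_h$ be the interior of $\bigcup_{T\in{\mathcal T}_h}T$, $\Gamma_h=\partial\Omega_h$, and $h=\max_T \mathrm{diam}\,T$. Assume that the mesh is fitted to $\Omega$: every mesh vertex on $\Gamma_h$ lies on $\Gamma$, and every triangle has at most one edge contained in $\Gamma_h$. Assume that it is shape regular with parameter $\sigma$: $\mathrm{diam}\,T\le\sigma\rho_T$ for all $T$, where $\rho_T$ is the largest diameter of a disk contained in $T$. Split each $T\in{\mathcal T}_h$ into the three triangles spanned by its centroid and its edges, and let $X_h$ be the space of functions of class $C^1$ on $\overline{\Omega}_h$ whose restriction to each of these sub-triangles is a polynomial of degree at most $3$, and which vanish together with their gradient at all mesh vertices on $\Gamma_h$ (this is the Clough–Tocher space with vanishing degrees of freedom at the vertices on $\Gamma_h$). * The test space $\Phi_h$ consists of the $\phi\in X_h$ whose normal derivative vanishes at the mid-point $M$ of every mesh edge contained in $\Gamma_h$.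 * The trial space $\Psi_h$ consists of the $\psi\in X_h$ such that, for every mesh edge $e\subset\Gamma_h$ with mid-point $M$, $\partial\psi/\partial{\bf n}(P)=0$, where $P$ is the closest intersection with $\Gamma$ of the perpendicular to $e$ passing through $M$, ${\bf n}$ is the normal to $\Gamma$ at $P$, and the polynomial expression of $\psi$ in the sub-triangle adjacent to $e$ is used at $P$. Put $$c_h(\psi,\phi)=\int_{\Omega_h}\Delta\psi\,\Delta\phi,\qquad F_h(\phi)=\int_{\Omega_h}f\phi,\qquad |v|_{2,h}=\Big(\int_{\Omega_h}|H(v)|^2\Big)^{1/2},$$ where $f\in L^2(\Omega)$ is extended by zero outside $\Omega$, $H(v)$ is the Hessian with its Frobenius norm, and second derivatives are taken sub-triangle by sub-triangle. Then for every such $\Omega$ and every $\sigma$ there is $h_0>0$ such that for every mesh as above with parameter $\sigma$ and $h\le h_0$: 1. for every $f\in L^2(\Omega)$ there is a unique $\psi_h\in\Psi_h$ with $c_h(\psi_h,\phi)=F_h(\phi)$ for all $\phi\in\Phi_h$; 2. for every $\psi\in\Psi_h$ with $\psi\ne0$, $$\sup_{\phi\in\Phi_h\setminus\{0\}}\frac{c_h(\psi,\phi)}{|\psi|_{2,h}\,|\phi|_{2,h}}\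 \ge\ \gamma:=\frac13 .$$ -/

import Mathlib

noncomputable section

namespace CloughTocher

open MeasureTheory

/-- The Euclidean plane. -/
abbrev Plane := EuclideanSpace ℝ (Fin 2)

/-- Real polynomials in two variables. -/
abbrev Poly := MvPolynomial (Fin 2) ℝ

/-! ### Plane domains of class `C^{1,1}` and their outer normals -/

/-- Rotation of a vector by a right angle. -/
def rot (n : Plane) : Plane := !₂[-(n 1), n 0]

/-- `n` is the unit outer normal at the point `p` of the boundary of `Ω`, and near `p` the set `Ω`
is the region below the graph of a `C^{1,1}` function `g`, in the orthonormal coordinates centred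
at `p` whose axes are directed by `rot n` (tangent to the boundary at `p`, as `g' 0 = 0`)
and by `n`. -/
def IsOuterUnitNormal (Ω : Set Plane) (p n : Plane) : Prop :=
  ‖n‖ = 1 ∧ ∃ r > 0, ∃ g : ℝ → ℝ,
    Differentiable ℝ g ∧ (∃ L, LipschitzWith L (deriv g)) ∧ g 0 = 0 ∧ deriv g 0 = 0 ∧
    ∀ x ∈ Metric.ball p r, x ∈ Ω ↔ inner ℝ n (x - p) < g (inner ℝ (rot n) (x - p))

/-- Bounded open plane sets with boundary of class `C^{1,1}` (for instance of class `C²`, or of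
class `C¹` and piecewise `C²`). -/
structure IsC11Domain (Ω : Set Plane) : Prop where
  isOpen : IsOpen Ω
  isBounded : Bornology.IsBounded Ω
  exists_normal : ∀ p ∈ frontier Ω, ∃ n, IsOuterUnitNormal Ω p n

/-! ### Triangulations -/

/-- A finite conforming triangulation, each triangle being given by its set of vertices: two
triangles are disjoint or meet along a common vertex, a common edge, or coincide. -/
structure Triangulation where
  tri : Finset (Finset Plane)
  card_eq : ∀ T ∈ tri, T.card = 3
  affineIndependent : ∀ T ∈ tri, AffineIndependent ℝ (Subtype.val : T → Plane)
  conforming : ∀ T ∈ tri, ∀ T' ∈ tri,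
    convexHull ℝ (T : Set Plane) ∩ convexHull ℝ (T' : Set Plane)
      = convexHull ℝ ((T : Set Plane) ∩ (T' : Set Plane))

namespace Triangulation

variable (M : Triangulation)

/-- The mesh size `h`: the largest diameter of a triangle. -/
def meshSize : ℝ := ⨆ T : M.tri, Metric.diam (convexHull ℝ (T.1 : Set Plane))

/-- Shape regularity: `diam T ≤ σ ρ_T` for all triangles `T`, where `ρ_T` is the supremum of the
diameters `2 ρ` of the disks contained in `T` (it is attained). -/
def ShapeRegular (σ : ℝ) : Prop :=
  ∀ T ∈ M.tri, ∃ c : Plane, ∃ ρ > 0, Metric.closedBall c ρ ⊆ convexHull ℝ (T : Set Plane) ∧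
    Metric.diam (convexHull ℝ (T : Set Plane)) ≤ σ * (2 * ρ)

/-- The edge of `T` opposite to its vertex `a` lies on the boundary `Γ_h` of the meshed polygon,
i.e. it is an edge of no other triangle. -/
def IsBoundaryEdge (T : Finset Plane) (a : Plane) : Prop :=
  T ∈ M.tri ∧ a ∈ T ∧ ∀ T' ∈ M.tri, (T : Set Plane) \ {a} ⊆ T' → T' = T

/-- The mesh vertices lying on `Γ_h`. -/
def boundaryVertices : Set Plane :=
  {x | ∃ T a, M.IsBoundaryEdge T a ∧ x ∈ T ∧ x ≠ a}

/-- The mesh is fitted to `Ω`: the vertices on `Γ_h` belong to the boundary `Γ` of `Ω`, and no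
triangle has more than one edge on `Γ_h`. -/
structure IsFitted (Ω : Set Plane) : Prop where
  vertex_mem : M.boundaryVertices ⊆ frontier Ω
  edge_unique : ∀ T a a', M.IsBoundaryEdge T a → M.IsBoundaryEdge T a' → a = a'

/-! ### The Clough-Tocher split and piecewise polynomials -/

/-- Indices of the sub-triangles: the pair `⟨T, a⟩` stands for the sub-triangle of `T` spanned by
the centroid of `T` and the edge of `T` opposite to `a`. -/
def pieces : Finset ((_ : Finset Plane) × Plane) := M.tri.sigma fun T => T

/-- A piecewise polynomial function: one polynomial for each (closed) sub-triangle. -/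
abbrev PiecewisePoly := M.pieces → Poly

variable {M}

/-- The closed sub-triangle with index `K`. -/
def region (K : M.pieces) : Set Plane :=
  convexHull ℝ (insert ((3 : ℝ)⁻¹ • ∑ x ∈ K.1.1, x) ((K.1.1 : Set Plane) \ {K.1.2}))

end Triangulation

/-- Value of a polynomial at a point of the plane. -/
def val (p : Poly) (x : Plane) : ℝ := MvPolynomial.eval (fun i => x i) p

/-- Gradient of a polynomial at a point of the plane. -/
def grad (p : Poly) (x : Plane) : Plane :=
  WithLp.toLp 2 fun i => val (MvPolynomial.pderiv i p) x

/-- Laplacian of a polynomial at a point of the plane. -/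
def lap (p : Poly) (x : Plane) : ℝ :=
  ∑ i, val (MvPolynomial.pderiv i (MvPolynomial.pderiv i p)) x

/-- Squared Frobenius norm of the Hessian of a polynomial at a point of the plane. -/
def hessSq (p : Poly) (x : Plane) : ℝ :=
  ∑ i, ∑ j, (val (MvPolynomial.pderiv i (MvPolynomial.pderiv j p)) x) ^ 2

lemma val_zero (x : Plane) : val 0 x = 0 := by simp [val]
lemma val_add (p q : Poly) (x : Plane) : val (p + q) x = val p x + val q x := by simp [val]
lemma val_smul (c : ℝ) (p : Poly) (x : Plane) : val (c • p) x = c * val p x := by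
  simp [val, MvPolynomial.smul_eval]
lemma grad_zero (x : Plane) : grad 0 x = 0 := by
  ext i; simp [grad, val]
lemma grad_add (p q : Poly) (x : Plane) : grad (p + q) x = grad p x + grad q x := by
  ext i; simp [grad, val]
lemma grad_smul (c : ℝ) (p : Poly) (x : Plane) : grad (c • p) x = c • grad p x := by
  ext i; simp [grad, val, MvPolynomial.smul_eval]

namespace Triangulation

variable (M : Triangulation)

/-- Piecewise cubic functions of class `C¹` on the closed meshed polygon (values and gradients
agree wherever two sub-triangles meet) which vanish together with their gradient at all mesh
vertices of `Γ_h`. -/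
def clampedC1Cubics : Submodule ℝ M.PiecewisePoly where
  carrier := {v | (∀ K, (v K).totalDegree ≤ 3) ∧
    (∀ K K', ∀ x ∈ region K ∩ region K',
      val (v K) x = val (v K') x ∧ grad (v K) x = grad (v K') x) ∧
    (∀ K, ∀ x ∈ region K ∩ M.boundaryVertices, val (v K) x = 0 ∧ grad (v K) x = 0)}
  zero_mem' := by
    refine ⟨fun K => by simp, fun K K' x _ => by simp, fun K x _ => ?_⟩
    simp [val_zero, grad_zero]
  add_mem' := by
    rintro u v ⟨hu, hu', hu''⟩ ⟨hv, hv', hv''⟩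
    refine ⟨fun K => ?_, fun K K' x hx => ?_, fun K x hx => ?_⟩
    · exact (MvPolynomial.totalDegree_add _ _).trans (max_le (hu K) (hv K))
    · simp only [Pi.add_apply, val_add, grad_add, (hu' K K' x hx).1, (hu' K K' x hx).2,
        (hv' K K' x hx).1, (hv' K K' x hx).2, and_self]
    · simp only [Pi.add_apply, val_add, grad_add, (hu'' K x hx).1, (hu'' K x hx).2,
        (hv'' K x hx).1, (hv'' K x hx).2, add_zero, and_self]
  smul_mem' := by
    rintro c v ⟨hv, hv', hv''⟩
    refine ⟨fun K => ?_, fun K K' x hx => ?_, fun K x hx => ?_⟩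
    · exact (MvPolynomial.totalDegree_smul_le _ _).trans (hv K)
    · simp only [Pi.smul_apply, val_smul, grad_smul, (hv' K K' x hx).1, (hv' K K' x hx).2,
        and_self]
    · simp only [Pi.smul_apply, val_smul, grad_smul, (hv'' K x hx).1, (hv'' K x hx).2,
        mul_zero, smul_zero, and_self]

/-- The test space `Φ_h`: the normal derivative moreover vanishes at the mid-point of each edge
`[b, c]` of `Γ_h`. -/
def testSpace : Submodule ℝ M.PiecewisePoly where
  carrier := {v | v ∈ M.clampedC1Cubics ∧ ∀ K : M.pieces, M.IsBoundaryEdge K.1.1 K.1.2 →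
    ∀ b c : Plane, (K.1.1 : Set Plane) \ {K.1.2} = {b, c} →
    ∀ ν : Plane, inner ℝ ν (c - b) = 0 → inner ℝ (grad (v K) (midpoint ℝ b c)) ν = 0}
  zero_mem' := ⟨zero_mem _, fun K _ b c _ ν _ => by simp [grad_zero]⟩
  add_mem' := by
    rintro u v ⟨hu, hu'⟩ ⟨hv, hv'⟩
    refine ⟨add_mem hu hv, fun K hK b c hbc ν hν => ?_⟩
    rw [Pi.add_apply, grad_add, inner_add_left, hu' K hK b c hbc ν hν, hv' K hK b c hbc ν hν,
      add_zero]
  smul_mem' := by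
    rintro t v ⟨hv, hv'⟩
    refine ⟨Submodule.smul_mem _ t hv, fun K hK b c hbc ν hν => ?_⟩
    rw [Pi.smul_apply, grad_smul, real_inner_smul_left, hv' K hK b c hbc ν hν, mul_zero]

end Triangulation

/-- `P` is the closest intersection with `Γ` of the perpendicular to the edge `[b, c]` passing
through its mid-point. -/
def IsClosestIntersection (Γ : Set Plane) (b c P : Plane) : Prop :=
  P ∈ Γ ∧ inner ℝ (P - midpoint ℝ b c) (c - b) = 0 ∧
    ∀ Q ∈ Γ, inner ℝ (Q - midpoint ℝ b c) (c - b) = 0 →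
      dist (midpoint ℝ b c) P ≤ dist (midpoint ℝ b c) Q

namespace Triangulation

variable (M : Triangulation)

/-- The trial space `Ψ_h`: for each edge `[b, c]` of `Γ_h`, the derivative in the direction of the
normal `n` to the true boundary `Γ` vanishes at the point `P` of `Γ` associated with the mid-point
of the edge. The polynomial expression in the sub-triangle adjacent to the edge is used at `P`. -/
def trialSpace (Ω : Set Plane) : Submodule ℝ M.PiecewisePoly where
  carrier := {v | v ∈ M.clampedC1Cubics ∧ ∀ K : M.pieces, M.IsBoundaryEdge K.1.1 K.1.2 →
    ∀ b c : Plane, (K.1.1 : Set Plane) \ {K.1.2} = {b, c} →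
    ∀ P n : Plane, IsClosestIntersection (frontier Ω) b c P → IsOuterUnitNormal Ω P n →
      inner ℝ (grad (v K) P) n = 0}
  zero_mem' := ⟨zero_mem _, fun K _ b c _ P n _ _ => by simp [grad_zero]⟩
  add_mem' := by
    rintro u v ⟨hu, hu'⟩ ⟨hv, hv'⟩
    refine ⟨add_mem hu hv, fun K hK b c hbc P n hP hn => ?_⟩
    rw [Pi.add_apply, grad_add, inner_add_left, hu' K hK b c hbc P n hP hn,
      hv' K hK b c hbc P n hP hn, add_zero]
  smul_mem' := by
    rintro t v ⟨hv, hv'⟩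
    refine ⟨Submodule.smul_mem _ t hv, fun K hK b c hbc P n hP hn => ?_⟩
    rw [Pi.smul_apply, grad_smul, real_inner_smul_left, hv' K hK b c hbc P n hP hn, mul_zero]

variable {M}

/-- The bilinear form `c_h(ψ, φ) = ∫_{Ω_h} Δψ Δφ`. -/
def bilin (ψ φ : M.PiecewisePoly) : ℝ :=
  ∑ K, ∫ x in region K, lap (ψ K) x * lap (φ K) x

/-- The linear form `F_h(φ) = ∫_{Ω_h} f φ`, with `f` extended by zero outside `Ω`. -/
def load (Ω : Set Plane) (f : Plane → ℝ) (φ : M.PiecewisePoly) : ℝ :=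
  ∑ K, ∫ x in region K, Ω.indicator f x * val (φ K) x

/-- The broken `H²` seminorm `|v|_{2,h}`, the norm of the Hessian in `L²(Ω_h)`. -/
def seminormH2 (v : M.PiecewisePoly) : ℝ :=
  √(∑ K, ∫ x in region K, hessSq (v K) x)

end Triangulation

end CloughTocher

end

noncomputable section
namespace CloughTocher
open MeasureTheory

/-! ### Triangles -/

/-! The argument compares a trial function with a nearby test function and exploits an exact
identity on the clamped space `X_h` (`clampedC1Cubics`).

Identity. Pointwise, (Δv)² = |H(v)|² + 2 det H(v), and det H(v) dx is the exterior derivative of ∂₀v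
d(∂₁v). Integrated over the sub-triangles, this leaves line integrals depending only on the gradient
along the sides. They cancel across interior sides because v is C¹. On an edge of Γ_h the gradient
is a quadratic vanishing at both ends, hence a scalar function times a fixed vector, and the
integral vanishes. So c_h(v, v) = |v|²_{2,h} on `X_h` (`bilin_self`), and |·|_{2,h} is a norm there
(`eq_zero_of_integral_hessSq`).

Perturbation. For short boundary edges the foot P is within a small multiple ε of the edge length
from the mid-point M, and the normal at P is almost orthogonal to the edge
(`exists_closestIntersection`); uniformly small slopes of Γ in local charts are enough for this. If
ψ is a trial function, its normal derivative at M is therefore small (`normalDeriv_sq_le`).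
Subtracting for each boundary edge a multiple of the C¹ bubble attached to it yields a test function
φ with ψ = φ + β and |β|² ≤ |ψ|²/96 (`exists_test_near`). Then |ψ|² ≤ 4|φ|² and c_h(ψ, φ) ≥ 3/4 |φ|²
− 2|β|² ≥ 2/3 |φ|², whose quotient by |ψ||φ| is at least (2/3)/2 = 1/3 (`exists_test_bilin_ge`).

Solvability. The bound makes ψ ↦ c_h(ψ, ·) injective from the trial space into the dual of the test
space. Correcting test functions by bubbles at the feet embeds the test space into the trial space
(`finrank_testSpace_le`), so the dimensions agree and the map is bijective. -/

/-- Twice the signed area of the triangle `a b c`. -/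
def tdet (a b c : Plane) : ℝ := (b 0 - a 0) * (c 1 - a 1) - (b 1 - a 1) * (c 0 - a 0)

lemma plane_ext {x y : Plane} (h0 : x 0 = y 0) (h1 : x 1 = y 1) : x = y := by
  ext i; fin_cases i <;> assumption

lemma inner_plane (x y : Plane) : inner ℝ x y = x 0 * y 0 + x 1 * y 1 := by
  simp [PiLp.inner_apply, Fin.sum_univ_two, mul_comm]

lemma norm_sq_plane (x : Plane) : ‖x‖ ^ 2 = x 0 ^ 2 + x 1 ^ 2 := by
  simp [EuclideanSpace.norm_sq_eq, Fin.sum_univ_two]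

lemma mem_convexHull_triple {a b c x : Plane} :
    x ∈ convexHull ℝ ({a, b, c} : Set Plane) ↔
      ∃ s t : ℝ, 0 ≤ s ∧ 0 ≤ t ∧ s + t ≤ 1 ∧ x = a + s • (b - a) + t • (c - a) := by
  constructor
  · rw [convexHull_insert (by simp), convexHull_pair]
    intro h
    simp only [convexJoin_singleton_left, Set.mem_iUnion] at h
    obtain ⟨y, ⟨α, β, hα, hβ, hαβ, rfl⟩, ⟨γ, δ, hγ, hδ, hγδ, rfl⟩⟩ := h
    refine ⟨δ * α, δ * β, by positivity, by positivity, by nlinarith, ?_⟩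
    obtain rfl : γ = 1 - δ := by linarith
    obtain rfl : α = 1 - β := by linarith
    module
  · rintro ⟨s, t, hs, ht, hst, rfl⟩
    have hc := convex_convexHull ℝ ({a, b, c} : Set Plane)
    have h := hc.sum_mem (t := Finset.univ) (w := ![1 - s - t, s, t]) (z := ![a, b, c])
      (by intro i _; fin_cases i <;> simp <;> linarith)
      (by simp [Fin.sum_univ_three]; ring)
      (by intro i _; fin_cases i <;> exact subset_convexHull _ _ (by simp))
    simp only [Fin.sum_univ_three, Matrix.cons_val_zero, Matrix.cons_val_one,
      Matrix.cons_val] at h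
    convert h using 1
    module

lemma affineIndependent_iff_tdet {a b c : Plane} :
    AffineIndependent ℝ ![a, b, c] ↔ tdet a b c ≠ 0 := by
  rw [affineIndependent_iff_linearIndependent_vsub ℝ _ (0 : Fin 3),
    ← linearIndependent_equiv (finSuccAboveEquiv (0 : Fin 3))]
  have : ((fun i : { x // x ≠ (0 : Fin 3) } => (![a, b, c] i -ᵥ ![a, b, c] 0 : Plane)) ∘
      (finSuccAboveEquiv (0 : Fin 3))) = ![b - a, c - a] := by
    ext i j; fin_cases i <;> simp [finSuccAboveEquiv]
  rw [this, LinearIndependent.pair_iff]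
  constructor
  · intro h h0
    by_cases hc : c = a
    · simpa using (h 0 1 (by simp [hc])).2
    have e : ∀ i : Fin 2, (c i - a i) = 0 := by
      intro i
      fin_cases i
      -- When the determinant vanishes, (cᵢ − aᵢ)(b − a) − (bᵢ − aᵢ)(c − a) = 0 is a linear
      -- relation; independence kills its coefficients.
      · have := (h (c 0 - a 0) (-(b 0 - a 0)) (plane_ext (by simp; ring)
          (by simp [tdet] at *; linarith))).1
        simpa using this
      · have := (h (c 1 - a 1) (-(b 1 - a 1)) (plane_ext (by simp [tdet] at *; linarith)
          (by simp; ring))).1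
        simpa using this
    exact hc (plane_ext (by linarith [e 0]) (by linarith [e 1]))
  · intro h s t hst
    have e0 := congrArg (fun z : Plane => z 0) hst
    have e1 := congrArg (fun z : Plane => z 1) hst
    simp at e0 e1
    constructor
    · have : s * tdet a b c = 0 := by
        simp only [tdet]; linear_combination (c 1 - a 1) * e0 - (c 0 - a 0) * e1
      simpa [h] using this
    · have : t * tdet a b c = 0 := by
        simp only [tdet]; linear_combination (b 0 - a 0) * e1 - (b 1 - a 1) * e0
      simpa [h] using this

/-- The linear map of matrix with columns `e` and `d`. -/
def colMap (e d : Plane) : Plane →ₗ[ℝ] Plane :=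
  Matrix.toLin (EuclideanSpace.basisFun (Fin 2) ℝ).toBasis
    (EuclideanSpace.basisFun (Fin 2) ℝ).toBasis !![e 0, d 0; e 1, d 1]

lemma colMap_apply (e d y : Plane) : colMap e d y = y 0 • e + y 1 • d := by
  apply plane_ext <;>
  simp [colMap, Matrix.toLin_apply, Fin.sum_univ_two, Matrix.mulVec, dotProduct] <;> ring

lemma det_colMap (e d : Plane) : LinearMap.det (colMap e d) = e 0 * d 1 - e 1 * d 0 := by
  rw [colMap, LinearMap.det_toLin, Matrix.det_fin_two_of]; ring

/-- The reference triangle. -/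
def refTriangle : Set (ℝ × ℝ) := {z | 0 ≤ z.1 ∧ 0 ≤ z.2 ∧ z.1 + z.2 ≤ 1}

lemma isClosed_refTriangle : IsClosed refTriangle := by
  apply IsClosed.and (isClosed_le (by fun_prop) (by fun_prop))
  exact IsClosed.and (isClosed_le (by fun_prop) (by fun_prop))
    (isClosed_le (by fun_prop) (by fun_prop))

lemma isCompact_refTriangle : IsCompact refTriangle := by
  refine (isCompact_Icc (a := ((0 : ℝ), (0 : ℝ))) (b := (1, 1))).of_isClosed_subset
    isClosed_refTriangle ?_
  rintro ⟨s, t⟩ ⟨h1, h2, h3⟩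
  simp only at h1 h2 h3
  exact ⟨⟨h1, h2⟩, ⟨by simp only; linarith, by simp only; linarith⟩⟩

lemma setIntegral_refTriangle {F : ℝ × ℝ → ℝ} (hF : Continuous F) :
    ∫ z in refTriangle, F z = ∫ s in (0 : ℝ)..1, ∫ t in (0 : ℝ)..(1 - s), F (s, t) := by
  have hint : Integrable (refTriangle.indicator F) (volume : Measure (ℝ × ℝ)) :=
    (hF.continuousOn.integrableOn_compact isCompact_refTriangle).integrable_indicator
      isClosed_refTriangle.measurableSet
  rw [← integral_indicator isClosed_refTriangle.measurableSet, Measure.volume_eq_prod,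
    integral_prod _ (by simpa [Measure.volume_eq_prod] using hint),
    intervalIntegral.integral_of_le zero_le_one, ← integral_Icc_eq_integral_Ioc,
    ← integral_indicator measurableSet_Icc]
  congr 1
  ext s
  by_cases hs : s ∈ Set.Icc (0 : ℝ) 1
  · rw [Set.indicator_of_mem hs, intervalIntegral.integral_of_le (by linarith [hs.2]),
      ← integral_Icc_eq_integral_Ioc, ← integral_indicator measurableSet_Icc]
    congr 1
    ext t
    by_cases ht : t ∈ Set.Icc (0 : ℝ) (1 - s)
    · rw [Set.indicator_of_mem ht, Set.indicator_of_mem]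
      exact ⟨hs.1, ht.1, by simp only; linarith [ht.2]⟩
    · rw [Set.indicator_of_notMem ht, Set.indicator_of_notMem]
      rintro ⟨h1, h2, h3⟩
      exact ht ⟨h2, by simp only at h3; linarith⟩
  · rw [Set.indicator_of_notMem hs]
    convert integral_zero ℝ ℝ using 2
    ext t
    rw [Set.indicator_of_notMem]
    rintro ⟨h1, h2, h3⟩
    simp only at h1 h2 h3
    exact hs ⟨h1, by linarith⟩

lemma setIntegral_triangle {a b c : Plane} (h : tdet a b c ≠ 0) (F : Plane → ℝ) :
    ∫ x in convexHull ℝ ({a, b, c} : Set Plane), F x =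
      |tdet a b c| * ∫ z in refTriangle, F (a + z.1 • (b - a) + z.2 • (c - a)) := by
  set e := b - a with he
  set d := c - a with hd
  have hdet : LinearMap.det (colMap e d) = tdet a b c := by
    rw [det_colMap]; simp [he, hd, tdet]
  set R : Set Plane := {y | 0 ≤ y 0 ∧ 0 ≤ y 1 ∧ y 0 + y 1 ≤ 1} with hR
  have hRc : IsClosed R := by
    apply IsClosed.and (isClosed_le (by fun_prop) (by fun_prop))
    exact IsClosed.and (isClosed_le (by fun_prop) (by fun_prop))
      (isClosed_le (by fun_prop) (by fun_prop))
  set f : Plane → Plane := fun y => a + colMap e d y with hf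
  have himg : convexHull ℝ ({a, b, c} : Set Plane) = f '' R := by
    ext x
    rw [mem_convexHull_triple]
    constructor
    · rintro ⟨s, t, hs, ht, hst, rfl⟩
      refine ⟨!₂[s, t], ⟨by simpa, by simpa, by simpa⟩, ?_⟩
      simp [hf, colMap_apply, add_assoc, he, hd]
    · rintro ⟨y, ⟨h0, h1, h2⟩, rfl⟩
      exact ⟨y 0, y 1, h0, h1, h2, by simp [hf, colMap_apply, add_assoc, he, hd]⟩
  have hinj : Function.Injective f := by
    intro x y hxy
    have hk : Function.Injective (colMap e d) :=
      (LinearMap.equivOfDetNeZero (colMap e d) (by rw [hdet]; exact h)).injective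
    exact hk (add_left_cancel hxy)
  have hder : ∀ x ∈ R, HasFDerivWithinAt f (LinearMap.toContinuousLinearMap (colMap e d)) R x :=
    fun x _ => ((LinearMap.toContinuousLinearMap (colMap e d)).hasFDerivAt.const_add a
      ).hasFDerivWithinAt
  rw [himg, integral_image_eq_integral_abs_det_fderiv_smul volume hRc.measurableSet hder
    hinj.injOn]
  have hd' : (LinearMap.toContinuousLinearMap (colMap e d)).det = tdet a b c := by
    rw [← hdet]; rfl
  simp only [hd', smul_eq_mul, integral_const_mul]
  congr 1
  -- The coordinate map from the Euclidean plane to `ℝ × ℝ` preserves volume, which transports the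
  -- integral to the domain where Fubini was applied.
  have mp := (volume_preserving_finTwoArrow ℝ).comp
    (EuclideanSpace.volume_preserving_symm_measurableEquiv_toLp (Fin 2))
  have hpre : R = (fun y : Plane => (y 0, y 1)) ⁻¹' refTriangle := rfl
  have := mp.setIntegral_preimage_emb (MeasurableEquiv.measurableEmbedding
    ((MeasurableEquiv.toLp 2 (Fin 2 → ℝ)).symm.trans MeasurableEquiv.finTwoArrow))
    (fun z : ℝ × ℝ => F (a + z.1 • e + z.2 • d)) refTriangle
  rw [← this]
  have hfe : ∀ y : Plane, f y = a + y 0 • e + y 1 • d := fun y => by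
    simp [hf, colMap_apply, add_assoc]
  simp only [hfe]
  rfl

/-- Second derivatives of cubics are affine, so moments of degree at most two are all that the
energy integrals require. -/
lemma setIntegral_refTriangle_quadratic (k0 k1 k2 k3 k4 k5 : ℝ) :
    ∫ z in refTriangle, (k0 + k1 * z.1 + k2 * z.2 + k3 * z.1 ^ 2 + k4 * (z.1 * z.2)
      + k5 * z.2 ^ 2) = k0 / 2 + k1 / 6 + k2 / 6 + k3 / 12 + k4 / 24 + k5 / 12 := by
  rw [setIntegral_refTriangle (by fun_prop)]
  have inner : ∀ s : ℝ, ∫ t in (0 : ℝ)..(1 - s), (k0 + k1 * s + k2 * t + k3 * s ^ 2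
      + k4 * (s * t) + k5 * t ^ 2) =
      (k0 + k1 * s + k3 * s ^ 2) * (1 - s) + (k2 + k4 * s) * (1 - s) ^ 2 / 2
        + k5 * (1 - s) ^ 3 / 3 := by
    intro s
    rw [intervalIntegral.integral_eq_sub_of_hasDerivAt (f := fun t =>
      (k0 + k1 * s + k3 * s ^ 2) * t + (k2 + k4 * s) * t ^ 2 / 2 + k5 * t ^ 3 / 3)]
    · ring
    · intro t _
      have h1 := (hasDerivAt_id t).const_mul (k0 + k1 * s + k3 * s ^ 2)
      have h2 := ((hasDerivAt_pow 2 t).const_mul (k2 + k4 * s)).div_const 2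
      have h3 := ((hasDerivAt_pow 3 t).const_mul k5).div_const 3
      refine ((h1.add h2).add h3).congr_deriv ?_
      push_cast; ring
    · exact (by fun_prop : Continuous _).intervalIntegrable _ _
  simp only [inner]
  rw [intervalIntegral.integral_eq_sub_of_hasDerivAt (f := fun s =>
      k0 * (s - s ^ 2 / 2) + k1 * (s ^ 2 / 2 - s ^ 3 / 3) + k3 * (s ^ 3 / 3 - s ^ 4 / 4)
      - k2 * (1 - s) ^ 3 / 6 + k4 * (s ^ 2 / 2 - 2 * s ^ 3 / 3 + s ^ 4 / 4) / 2
      - k5 * (1 - s) ^ 4 / 12)]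
  · ring
  · intro s _
    have p2 := hasDerivAt_pow 2 s
    have p3 := hasDerivAt_pow 3 s
    have p4 := hasDerivAt_pow 4 s
    have q := (hasDerivAt_id s).const_sub 1
    have q3 := q.pow 3
    have q4 := q.pow 4
    refine HasDerivAt.congr_deriv ((((((((hasDerivAt_id s).sub (p2.div_const 2)).const_mul k0).add
      (((p2.div_const 2).sub (p3.div_const 3)).const_mul k1)).add
      (((p3.div_const 3).sub (p4.div_const 4)).const_mul k3)).sub
      ((q3.const_mul k2).div_const 6)).add
      (((((p2.div_const 2).sub ((p3.const_mul 2).div_const 3)).add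
        (p4.div_const 4)).const_mul k4).div_const 2)).sub
      ((q4.const_mul k5).div_const 12)) ?_
    simp; ring
  · exact (by fun_prop : Continuous _).intervalIntegrable _ _


/-! ### Cubic polynomials -/

/-- Second derivatives of a polynomial at a point of the plane. -/
def hess (p : Poly) (i j : Fin 2) (x : Plane) : ℝ :=
  val (MvPolynomial.pderiv i (MvPolynomial.pderiv j p)) x

/-- The determinant of the Hessian. -/
def hessDet (p : Poly) (x : Plane) : ℝ :=
  hess p 0 0 x * hess p 1 1 x - hess p 0 1 x * hess p 0 1 x

/-- The cubic polynomial with given coefficients. -/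
def cubic (k : Fin 10 → ℝ) : Poly :=
  let X : Poly := MvPolynomial.X 0
  let Y : Poly := MvPolynomial.X 1
  let C := fun i => MvPolynomial.C (σ := Fin 2) (k i)
  C 0 + C 1 * X + C 2 * Y + C 3 * X ^ 2 + C 4 * (X * Y) + C 5 * Y ^ 2 + C 6 * X ^ 3
    + C 7 * (X ^ 2 * Y) + C 8 * (X * Y ^ 2) + C 9 * Y ^ 3

lemma cubic_add (k l : Fin 10 → ℝ) : cubic k + cubic l = cubic (k + l) := by
  simp only [cubic, Pi.add_apply, map_add]; ring

lemma monomial_eq_cubic (m : Fin 2 →₀ ℕ) (r : ℝ) (hm : m 0 + m 1 ≤ 3) :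
    ∃ k, MvPolynomial.monomial m r = cubic k := by
  have e : MvPolynomial.monomial m r =
      MvPolynomial.C r * (MvPolynomial.X 0 ^ m 0 * MvPolynomial.X 1 ^ m 1) := by
    rw [MvPolynomial.monomial_eq, Finsupp.prod_fintype _ _ (by simp), Fin.prod_univ_two]
  rw [e]
  have h0 : m 0 ≤ 3 := by omega
  have h1 : m 1 ≤ 3 - m 0 := by omega
  generalize m 0 = i at *
  generalize m 1 = j at *
  interval_cases i <;> interval_cases j
  · exact ⟨Pi.single 0 r, by simp [cubic, Fin.ext_iff]⟩
  · exact ⟨Pi.single 2 r, by simp [cubic, Fin.ext_iff]⟩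
  · exact ⟨Pi.single 5 r, by simp [cubic, Fin.ext_iff]⟩
  · exact ⟨Pi.single 9 r, by simp [cubic, Fin.ext_iff]⟩
  · exact ⟨Pi.single 1 r, by simp [cubic, Fin.ext_iff]⟩
  · exact ⟨Pi.single 4 r, by simp [cubic, Fin.ext_iff]⟩
  · exact ⟨Pi.single 8 r, by simp [cubic, Fin.ext_iff]⟩
  · exact ⟨Pi.single 3 r, by simp [cubic, Fin.ext_iff]⟩
  · exact ⟨Pi.single 7 r, by simp [cubic, Fin.ext_iff]⟩
  · exact ⟨Pi.single 6 r, by simp [cubic, Fin.ext_iff]⟩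

/-- Turns every identity about cubic polynomials below into a `ring` identity in ten coefficients.
-/
lemma exists_eq_cubic {p : Poly} (h : p.totalDegree ≤ 3) : ∃ k, p = cubic k := by
  rw [p.as_sum]
  refine Finset.sum_induction _ (fun q => ∃ k, q = cubic k) ?_ ?_ ?_
  · rintro _ _ ⟨k, rfl⟩ ⟨l, rfl⟩
    exact ⟨k + l, cubic_add k l⟩
  · exact ⟨0, by simp [cubic]⟩
  · intro m hm
    apply monomial_eq_cubic
    have := (MvPolynomial.le_totalDegree hm).trans h
    rwa [Finsupp.sum_fintype _ _ (by simp), Fin.sum_univ_two] at this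

lemma val_cubic (k : Fin 10 → ℝ) (x : Plane) : val (cubic k) x =
    k 0 + k 1 * x 0 + k 2 * x 1 + k 3 * x 0 ^ 2 + k 4 * (x 0 * x 1) + k 5 * x 1 ^ 2
      + k 6 * x 0 ^ 3 + k 7 * (x 0 ^ 2 * x 1) + k 8 * (x 0 * x 1 ^ 2) + k 9 * x 1 ^ 3 := by
  simp [cubic, val]

lemma pderiv_zero_cubic (k : Fin 10 → ℝ) : MvPolynomial.pderiv 0 (cubic k) =
    cubic ![k 1, 2 * k 3, k 4, 3 * k 6, 2 * k 7, k 8, 0, 0, 0, 0] := by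
  have e2 : (MvPolynomial.C 2 : Poly) = 2 := rfl
  have e3 : (MvPolynomial.C 3 : Poly) = 3 := rfl
  simp [cubic, Derivation.leibniz, MvPolynomial.pderiv_X, Derivation.leibniz_pow, e2, e3]
  ring

lemma pderiv_one_cubic (k : Fin 10 → ℝ) : MvPolynomial.pderiv 1 (cubic k) =
    cubic ![k 2, k 4, 2 * k 5, k 7, 2 * k 8, 3 * k 9, 0, 0, 0, 0] := by
  have e2 : (MvPolynomial.C 2 : Poly) = 2 := rfl
  have e3 : (MvPolynomial.C 3 : Poly) = 3 := rfl
  simp [cubic, Derivation.leibniz, MvPolynomial.pderiv_X, Derivation.leibniz_pow, e2, e3]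
  ring

lemma grad_cubic_zero (k : Fin 10 → ℝ) (x : Plane) : grad (cubic k) x 0 =
    k 1 + 2 * k 3 * x 0 + k 4 * x 1 + 3 * k 6 * x 0 ^ 2 + 2 * k 7 * (x 0 * x 1)
      + k 8 * x 1 ^ 2 := by
  simp [grad, pderiv_zero_cubic, val_cubic]

lemma grad_cubic_one (k : Fin 10 → ℝ) (x : Plane) : grad (cubic k) x 1 =
    k 2 + k 4 * x 0 + 2 * k 5 * x 1 + k 7 * x 0 ^ 2 + 2 * k 8 * (x 0 * x 1)
      + 3 * k 9 * x 1 ^ 2 := by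
  simp [grad, pderiv_one_cubic, val_cubic]

lemma hess_cubic_zero_zero (k : Fin 10 → ℝ) (x : Plane) : hess (cubic k) 0 0 x =
    2 * k 3 + 6 * k 6 * x 0 + 2 * k 7 * x 1 := by
  simp only [hess, pderiv_zero_cubic, val_cubic, Matrix.cons_val]; ring

lemma hess_cubic_zero_one (k : Fin 10 → ℝ) (x : Plane) : hess (cubic k) 0 1 x =
    k 4 + 2 * k 7 * x 0 + 2 * k 8 * x 1 := by
  simp [hess, pderiv_zero_cubic, pderiv_one_cubic, val_cubic]

lemma hess_cubic_one_zero (k : Fin 10 → ℝ) (x : Plane) : hess (cubic k) 1 0 x =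
    k 4 + 2 * k 7 * x 0 + 2 * k 8 * x 1 := by
  simp [hess, pderiv_zero_cubic, pderiv_one_cubic, val_cubic]

lemma hess_cubic_one_one (k : Fin 10 → ℝ) (x : Plane) : hess (cubic k) 1 1 x =
    2 * k 5 + 2 * k 8 * x 0 + 6 * k 9 * x 1 := by
  simp only [hess, pderiv_one_cubic, val_cubic, Matrix.cons_val]; ring

/-- Line integral of `∂₀p d(∂₁p)` from `b` to `c`, in terms of the gradients `u`, `v`, `w` at
`b`, at the mid-point, and at `c`. -/
def edgeForm (u v w : Plane) : ℝ :=
  (u 0 * (-3 * u 1 + 4 * v 1 - w 1) + 4 * v 0 * (w 1 - u 1)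
    + w 0 * (u 1 - 4 * v 1 + 3 * w 1)) / 6

/-- `edgeForm` of the gradients of `p` along `[b, c]`. -/
def edgeInt (p : Poly) (b c : Plane) : ℝ :=
  edgeForm (grad p b) (grad p (midpoint ℝ b c)) (grad p c)

lemma edgeInt_swap (p : Poly) (b c : Plane) : edgeInt p c b = -edgeInt p b c := by
  simp only [edgeInt, edgeForm, midpoint_comm c b]; ring

lemma midpoint_apply (b c : Plane) (i : Fin 2) : midpoint ℝ b c i = (b i + c i) / 2 := by
  simp [midpoint_eq_smul_add]; ring

lemma lap_eq (p : Poly) (x : Plane) : lap p x = hess p 0 0 x + hess p 1 1 x := by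
  simp [lap, hess, Fin.sum_univ_two]

/-- The commutator of two partial derivatives is a derivation that kills the variables, hence zero.
-/
lemma hess_comm (p : Poly) (i j : Fin 2) (x : Plane) : hess p i j x = hess p j i x := by
  have h : ⁅MvPolynomial.pderiv (R := ℝ) i, MvPolynomial.pderiv j⁆ = 0 :=
    MvPolynomial.derivation_ext fun k => by
      classical
      rw [Derivation.commutator_apply]
      simp only [MvPolynomial.pderiv_X, Pi.single_apply]
      split_ifs <;> simp
  have := congrArg (fun D : Derivation ℝ Poly Poly => D p) h
  rw [Derivation.commutator_apply, Derivation.zero_apply, sub_eq_zero] at this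
  simp only [hess, this]

lemma hessSq_eq (p : Poly) (x : Plane) : hessSq p x =
    hess p 0 0 x ^ 2 + 2 * hess p 0 1 x ^ 2 + hess p 1 1 x ^ 2 := by
  simp only [hessSq, Fin.sum_univ_two]
  change hess p 0 0 x ^ 2 + hess p 0 1 x ^ 2 + (hess p 1 0 x ^ 2 + hess p 1 1 x ^ 2) = _
  rw [hess_comm p 1 0]; ring

/-- The defect between the two energies is the Hessian determinant, a null Lagrangian: its integral
depends only on boundary data. -/
lemma lap_sq_eq (p : Poly) (x : Plane) : lap p x * lap p x = hessSq p x + 2 * hessDet p x := by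
  rw [lap_eq, hessSq_eq, hessDet]; ring

/-- Affine functions on the plane. -/
def IsAff (w : Plane → ℝ) : Prop := ∃ α β γ : ℝ, ∀ x : Plane, w x = α + β * x 0 + γ * x 1

lemma isAff_hess {p : Poly} (hp : p.totalDegree ≤ 3) (i j : Fin 2) : IsAff (hess p i j) := by
  obtain ⟨k, rfl⟩ := exists_eq_cubic hp
  fin_cases i <;> fin_cases j
  · exact ⟨_, _, _, hess_cubic_zero_zero k⟩
  · exact ⟨_, _, _, hess_cubic_zero_one k⟩
  · exact ⟨_, _, _, hess_cubic_one_zero k⟩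
  · exact ⟨_, _, _, hess_cubic_one_one k⟩

/-- The mass matrix of affine functions on a triangle, in terms of vertex values. -/
lemma setIntegral_triangle_mul {u w : Plane → ℝ} (hu : IsAff u) (hw : IsAff w) {a b c : Plane}
    (h : tdet a b c ≠ 0) : ∫ x in convexHull ℝ ({a, b, c} : Set Plane), u x * w x =
      |tdet a b c| / 24 * (u a * w a + u b * w b + u c * w c
        + (u a + u b + u c) * (w a + w b + w c)) := by
  obtain ⟨α, β, γ, hu⟩ := hu
  obtain ⟨α', β', γ', hw⟩ := hw
  have e : ∀ z : ℝ × ℝ, u (a + z.1 • (b - a) + z.2 • (c - a)) *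
      w (a + z.1 • (b - a) + z.2 • (c - a)) =
      u a * w a + (u a * (w b - w a) + (u b - u a) * w a) * z.1
      + (u a * (w c - w a) + (u c - u a) * w a) * z.2
      + ((u b - u a) * (w b - w a)) * z.1 ^ 2
      + ((u b - u a) * (w c - w a) + (u c - u a) * (w b - w a)) * (z.1 * z.2)
      + ((u c - u a) * (w c - w a)) * z.2 ^ 2 := by
    intro z
    simp only [hu, hw, PiLp.add_apply, PiLp.smul_apply, PiLp.sub_apply, smul_eq_mul]
    ring
  rw [setIntegral_triangle h]
  simp only [e, setIntegral_refTriangle_quadratic]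
  ring

lemma continuous_val (p : Poly) : Continuous (val p) := by
  unfold val
  exact (MvPolynomial.continuous_eval p).comp (by fun_prop)

lemma continuous_hess (p : Poly) (i j : Fin 2) : Continuous (hess p i j) := continuous_val _

lemma continuous_hessSq (p : Poly) : Continuous (hessSq p) := by
  unfold hessSq
  have := fun i j => continuous_hess p i j
  unfold hess at this
  fun_prop

lemma continuous_lap (p : Poly) : Continuous (lap p) := by
  unfold lap
  have := fun i => continuous_hess p i i
  unfold hess at this
  fun_prop

/-- Green's formula for d(∂₀p d∂₁p). Along a side the gradient is quadratic, so the integrand is a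
cubic in the parameter and Simpson's rule is exact; `edgeForm` is that rule, with the derivatives
−3u + 4v − w, w − u, u − 4v + 3w of the quadratic interpolant. The resulting identity is verified on
coefficients. -/
lemma integral_hessDet {p : Poly} (hp : p.totalDegree ≤ 3) {a b c : Plane}
    (h : tdet a b c ≠ 0) : ∫ x in convexHull ℝ ({a, b, c} : Set Plane), hessDet p x =
      SignType.sign (tdet a b c) * (edgeInt p a b + edgeInt p b c + edgeInt p c a) := by
  have H := fun i j => isAff_hess hp i j
  have hcpt : IsCompact (convexHull ℝ ({a, b, c} : Set Plane)) :=
    (Set.toFinite _).isCompact_convexHull (𝕜 := ℝ)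
  have i1 : IntegrableOn (fun x => hess p 0 0 x * hess p 1 1 x)
      (convexHull ℝ ({a, b, c} : Set Plane)) :=
    ((continuous_hess p 0 0).mul (continuous_hess p 1 1)).continuousOn.integrableOn_compact hcpt
  have i2 : IntegrableOn (fun x => hess p 0 1 x * hess p 0 1 x)
      (convexHull ℝ ({a, b, c} : Set Plane)) :=
    ((continuous_hess p 0 1).mul (continuous_hess p 0 1)).continuousOn.integrableOn_compact hcpt
  unfold hessDet
  rw [integral_sub i1 i2, setIntegral_triangle_mul (H 0 0) (H 1 1) h,
    -- Writing |D| as sign(D)·D isolates the orientation and leaves a polynomial identity.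
    setIntegral_triangle_mul (H 0 1) (H 0 1) h, ← sign_mul_self (tdet a b c)]
  simp only [mul_div_assoc, mul_assoc, ← mul_sub]
  congr 1
  obtain ⟨k, rfl⟩ := exists_eq_cubic hp
  simp only [hess_cubic_zero_zero, hess_cubic_zero_one, hess_cubic_one_one, edgeInt, edgeForm,
    grad_cubic_zero, grad_cubic_one, midpoint_apply, tdet]
  ring


/-! ### Vertices, sub-triangles and sides of a triangulation -/

lemma tdet_swap (a b c : Plane) : tdet a c b = -tdet a b c := by simp only [tdet]; ring

lemma tdet_rotate (a b c : Plane) : tdet b c a = tdet a b c := by simp only [tdet]; ring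

/-- The centroid of a triangle. -/
def centroid3 (a b c : Plane) : Plane := (3 : ℝ)⁻¹ • (a + b + c)

lemma centroid3_apply (a b c : Plane) (i : Fin 2) :
    centroid3 a b c i = (a i + b i + c i) / 3 := by
  simp [centroid3]; ring

lemma centroid3_rotate (a b c : Plane) : centroid3 b c a = centroid3 a b c := by
  simp only [centroid3]; congr 1; abel

lemma tdet_centroid3 (a b c : Plane) : tdet (centroid3 a b c) b c = tdet a b c / 3 := by
  simp only [tdet, centroid3_apply]; ring

namespace Triangulation

variable {M : Triangulation}

/-- The vertices of `T`, listed without repetition, are `a`, `b`, `c`. -/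
structure IsTriple (T : Finset Plane) (a b c : Plane) : Prop where
  eq : T = {a, b, c}
  ab : a ≠ b
  ac : a ≠ c
  bc : b ≠ c

lemma IsTriple.rotate {T : Finset Plane} {a b c : Plane} (h : IsTriple T a b c) :
    IsTriple T b c a :=
  ⟨by rw [h.eq]; ext; simp; tauto, h.bc, h.ab.symm, h.ac.symm⟩

lemma IsTriple.swap {T : Finset Plane} {a b c : Plane} (h : IsTriple T a b c) :
    IsTriple T a c b :=
  ⟨by rw [h.eq]; ext; simp; tauto, h.ac, h.ab, h.bc.symm⟩

lemma IsTriple.diff {T : Finset Plane} {a b c : Plane} (h : IsTriple T a b c) :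
    (T : Set Plane) \ {a} = {b, c} := by
  have := h.ab; have := h.ac
  ext x; simp only [h.eq, Finset.coe_insert, Finset.coe_singleton, Set.mem_sdiff,
    Set.mem_insert_iff, Set.mem_singleton_iff]
  constructor
  · tauto
  · rintro (rfl | rfl) <;> simp_all [eq_comm]

lemma IsTriple.coe {T : Finset Plane} {a b c : Plane} (h : IsTriple T a b c) :
    (T : Set Plane) = {a, b, c} := by simp [h.eq]

lemma IsTriple.mem {T : Finset Plane} {a b c : Plane} (h : IsTriple T a b c) :
    a ∈ T ∧ b ∈ T ∧ c ∈ T := by simp [h.eq]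

lemma IsTriple.eq_of {T : Finset Plane} {a b c b' c' : Plane} (h : IsTriple T a b c)
    (h' : IsTriple T a b' c') : (b' = b ∧ c' = c) ∨ (b' = c ∧ c' = b) := by
  have e : ({b', c'} : Set Plane) = {b, c} := h'.diff.symm.trans h.diff
  rcases (Set.pair_eq_pair_iff).1 e with h | h
  · exact Or.inl h
  · exact Or.inr h

lemma isTriple_of_diff {T : Finset Plane} {a b c : Plane} (hT : T.card = 3) (ha : a ∈ T)
    (h : (T : Set Plane) \ {a} = {b, c}) : IsTriple T a b c := by
  have hb : b ∈ (T : Set Plane) \ {a} := h ▸ by simp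
  have hc : c ∈ (T : Set Plane) \ {a} := h ▸ by simp
  have e : T = {a, b, c} := by
    ext x
    by_cases hx : x = a
    · simp [hx, ha]
    · have : x ∈ (T : Set Plane) \ {a} ↔ x ∈ ({b, c} : Set Plane) := by rw [h]
      simpa [hx] using this
  refine ⟨e, fun h => hb.2 h.symm, fun h => hc.2 h.symm, ?_⟩
  rintro rfl
  have : T.card ≤ 2 := by
    rw [e, Finset.insert_eq_of_mem (s := {b}) (Finset.mem_singleton_self b)]
    exact Finset.card_le_two
  omega

lemma exists_isTriple {T : Finset Plane} (hT : T.card = 3) {a : Plane} (ha : a ∈ T) :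
    ∃ b c, IsTriple T a b c := by
  obtain ⟨x, y, z, h1, h2, h3, rfl⟩ := Finset.card_eq_three.1 hT
  have h : IsTriple {x, y, z} x y z := ⟨rfl, h1, h2, h3⟩
  simp only [Finset.mem_insert, Finset.mem_singleton] at ha
  rcases ha with rfl | rfl | rfl
  · exact ⟨_, _, h⟩
  · exact ⟨_, _, h.rotate⟩
  · exact ⟨_, _, h.rotate.rotate⟩

lemma IsTriple.tdet_ne_zero {T : Finset Plane} {a b c : Plane} (h : IsTriple T a b c)
    (hT : T ∈ M.tri) : tdet a b c ≠ 0 := by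
  rw [← affineIndependent_iff_tdet]
  have hi := M.affineIndependent T hT
  let f : Fin 3 ↪ T := ⟨![⟨a, h.mem.1⟩, ⟨b, h.mem.2.1⟩, ⟨c, h.mem.2.2⟩], by
    intro i j hij
    have := h.ab; have := h.ac; have := h.bc
    fin_cases i <;> fin_cases j <;> simp_all [eq_comm]⟩
  convert hi.comp_embedding f using 1
  ext i; fin_cases i <;> rfl

/-- The sub-triangle of `T` opposite to its vertex `a`. -/
def piece {T : Finset Plane} (hT : T ∈ M.tri) {a : Plane} (ha : a ∈ T) : M.pieces :=
  ⟨⟨T, a⟩, Finset.mem_sigma.2 ⟨hT, ha⟩⟩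

lemma piece_mem (K : M.pieces) : K.1.1 ∈ M.tri ∧ K.1.2 ∈ K.1.1 := Finset.mem_sigma.1 K.2

lemma exists_isTriple_piece (K : M.pieces) : ∃ b c, IsTriple K.1.1 K.1.2 b c :=
  exists_isTriple (M.card_eq _ (piece_mem K).1) (piece_mem K).2

lemma IsTriple.region_eq {K : M.pieces} {b c : Plane} (h : IsTriple K.1.1 K.1.2 b c) :
    region K = convexHull ℝ {centroid3 K.1.2 b c, b, c} := by
  rw [region, h.diff, centroid3]
  congr 3
  have := h.ab; have := h.ac; have := h.bc
  nth_rw 1 [h.eq]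
  rw [Finset.sum_insert (by simp_all), Finset.sum_insert (by simp_all), Finset.sum_singleton,
    add_assoc]

lemma sum_pieces (F : M.pieces → ℝ) :
    ∑ K, F K = ∑ T : M.tri, ∑ a : T.1, F (piece T.2 a.2) := by
  rw [Finset.sum_sigma' Finset.univ (fun _ => Finset.univ)
    (fun (T : M.tri) (a : T.1) => F (piece T.2 a.2))]
  refine Finset.sum_bij' (fun K _ => ⟨⟨K.1.1, (piece_mem K).1⟩, ⟨K.1.2, (piece_mem K).2⟩⟩)
    (fun x _ => piece x.1.2 x.2.2) ?_ ?_ ?_ ?_ ?_ <;> intros <;> first | rfl | simp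

lemma IsTriple.sum_eq {T : Finset Plane} {a b c : Plane} (h : IsTriple T a b c)
    (f : T → ℝ) : ∑ x : T, f x = f ⟨a, h.mem.1⟩ + f ⟨b, h.mem.2.1⟩ + f ⟨c, h.mem.2.2⟩ := by
  have := h.ab; have := h.ac; have := h.bc
  have e : (Finset.univ : Finset T) = {⟨a, h.mem.1⟩, ⟨b, h.mem.2.1⟩, ⟨c, h.mem.2.2⟩} := by
    ext ⟨x, hx⟩
    rw [h.eq] at hx
    simpa using hx
  rw [e, Finset.sum_insert (by simp_all), Finset.sum_insert (by simp_all), Finset.sum_singleton,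
    add_assoc]

lemma sum_pieces_congr {F G : M.pieces → ℝ}
    (h : ∀ (T : Finset Plane) (hT : T ∈ M.tri) (a b c : Plane) (ht : IsTriple T a b c),
      F (piece hT ht.mem.1) + F (piece hT ht.mem.2.1) + F (piece hT ht.mem.2.2)
        = G (piece hT ht.mem.1) + G (piece hT ht.mem.2.1) + G (piece hT ht.mem.2.2)) :
    ∑ K, F K = ∑ K, G K := by
  rw [sum_pieces, sum_pieces]
  refine Finset.sum_congr rfl fun T _ => ?_
  obtain ⟨a, ha⟩ : T.1.Nonempty := Finset.card_pos.1 (by rw [M.card_eq _ T.2]; norm_num)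
  obtain ⟨b, c, ht⟩ := exists_isTriple (M.card_eq _ T.2) ha
  rw [ht.sum_eq, ht.sum_eq]
  exact h T T.2 a b c ht

lemma sum_pieces_le {F G : M.pieces → ℝ}
    (h : ∀ (T : Finset Plane) (hT : T ∈ M.tri) (a b c : Plane) (ht : IsTriple T a b c),
      F (piece hT ht.mem.1) + F (piece hT ht.mem.2.1) + F (piece hT ht.mem.2.2)
        ≤ G (piece hT ht.mem.1) + G (piece hT ht.mem.2.1) + G (piece hT ht.mem.2.2)) :
    ∑ K, F K ≤ ∑ K, G K := by
  rw [sum_pieces, sum_pieces]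
  refine Finset.sum_le_sum fun T _ => ?_
  obtain ⟨a, ha⟩ : T.1.Nonempty := Finset.card_pos.1 (by rw [M.card_eq _ T.2]; norm_num)
  obtain ⟨b, c, ht⟩ := exists_isTriple (M.card_eq _ T.2) ha
  rw [ht.sum_eq, ht.sum_eq]
  exact h T T.2 a b c ht

/-- Two triangles with a common edge lie on opposite sides of it. -/
lemma IsTriple.opposite {T T' : Finset Plane} (hT : T ∈ M.tri) (hT' : T' ∈ M.tri) (hne : T ≠ T')
    {a a' b c : Plane} (h : IsTriple T a b c) (h' : IsTriple T' a' b c) :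
    tdet a b c * tdet a' b c < 0 := by
  have hD := h.tdet_ne_zero hT
  have hD' := h'.tdet_ne_zero hT'
  by_contra hcon
  have hpos : 0 < tdet a b c * tdet a' b c :=
    lt_of_le_of_ne (not_lt.1 hcon) (mul_ne_zero hD hD').symm
  have haa : a ≠ a' := by rintro rfl; exact hne (h.eq.trans h'.eq.symm)
  have hinter : (T : Set Plane) ∩ T' = {b, c} := by
    have := h.ab; have := h.ac; have := h'.ab; have := h'.ac
    ext x
    simp only [h.coe, h'.coe, Set.mem_inter_iff, Set.mem_insert_iff, Set.mem_singleton_iff]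
    constructor
    · rintro ⟨rfl | h1, rfl | h2⟩ <;> tauto
    · tauto
  have hconf := M.conforming T hT T' hT'
  rw [hinter, h.coe, h'.coe] at hconf
  set D := tdet a b c with hDd
  set D' := tdet a' b c with hDd'
  -- barycentric coordinates of `a` with respect to `T'`
  set q := D / D' with hq
  have hqpos : 0 < q := by
    have : q = D * D' / D' ^ 2 := by rw [hq]; field_simp
    rw [this]; positivity
  set r := tdet a' a c / D' with hr
  set s := tdet a' b a / D' with hs
  have hbary : a = a' + r • (b - a') + s • (c - a') := by
    apply plane_ext <;> simp [hr, hs] <;> field_simp <;> simp only [hDd', tdet] <;> ring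
  have hsum : q = 1 - r - s := by
    rw [hq, hr, hs]; field_simp; simp only [hDd, hDd', tdet]; ring
  -- If both apices were on the same side, the mid-point of `[b, c]` pushed slightly towards `a`
  -- would stay in both triangles, as `a` has a positive coordinate `q` relative to `a'`. By
  -- conformity it would lie on `[b, c]`, which gives `ε * D = 0`. The bound 1/4 keeps the
  -- coordinates (1 − ε)/2 + εr and (1 − ε)/2 + εs nonnegative.
  obtain ⟨ε, hε, hε1, hεr, hεs, hεq⟩ : ∃ ε : ℝ, 0 < ε ∧ ε ≤ 1 ∧ ε * |r| ≤ 1 / 4 ∧ ε * |s| ≤ 1 / 4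
      ∧ ε ≤ 1 / 4 := by
    refine ⟨1 / (4 * (1 + |r| + |s|)), by positivity, ?_, ?_, ?_, ?_⟩
    · rw [div_le_one (by positivity)]; nlinarith [abs_nonneg r, abs_nonneg s]
    · rw [div_mul_eq_mul_div, div_le_div_iff₀ (by positivity) (by norm_num)]
      nlinarith [abs_nonneg r, abs_nonneg s]
    · rw [div_mul_eq_mul_div, div_le_div_iff₀ (by positivity) (by norm_num)]
      nlinarith [abs_nonneg r, abs_nonneg s]
    · rw [div_le_div_iff₀ (by positivity) (by norm_num)]
      nlinarith [abs_nonneg r, abs_nonneg s]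
  set x : Plane := a + ((1 - ε) / 2) • (b - a) + ((1 - ε) / 2) • (c - a) with hx
  have hx1 : x ∈ convexHull ℝ ({a, b, c} : Set Plane) :=
    mem_convexHull_triple.2 ⟨_, _, by linarith, by linarith, by linarith, hx⟩
  have hx2 : x ∈ convexHull ℝ ({a', b, c} : Set Plane) := by
    have h1 := neg_abs_le r
    have h2 := neg_abs_le s
    refine mem_convexHull_triple.2 ⟨(1 - ε) / 2 + ε * r, (1 - ε) / 2 + ε * s, ?_, ?_, ?_, ?_⟩
    · nlinarith
    · nlinarith
    · nlinarith
    · have b0 := congrArg (fun z : Plane => z 0) hbary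
      have b1 := congrArg (fun z : Plane => z 1) hbary
      simp at b0 b1
      apply plane_ext <;> simp [hx]
      · linear_combination ε * b0
      · linear_combination ε * b1
  have hx3 : x ∈ convexHull ℝ ({b, c} : Set Plane) := hconf ▸ ⟨hx1, hx2⟩
  rw [convexHull_pair] at hx3
  obtain ⟨α, β, -, -, hαβ, hxe⟩ := hx3
  obtain rfl : α = 1 - β := by linarith
  have e0 := congrArg (fun z : Plane => z 0) hxe
  have e1 := congrArg (fun z : Plane => z 1) hxe
  simp [hx] at e0 e1
  have : ε * D = 0 := by
    simp only [hDd, tdet]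
    linear_combination (c 1 - b 1) * e0 - (c 0 - b 0) * e1
  exact (mul_ne_zero hε.ne' hD) this

/-! ### The integral of the Hessian determinant -/

/-- Contribution of the outer edge of a sub-triangle to the integral of `hessDet`. -/
def outerInt (v : M.PiecewisePoly) (K : M.pieces) : ℝ :=
  SignType.sign (tdet K.1.2 (exists_isTriple_piece K).choose
    (exists_isTriple_piece K).choose_spec.choose) *
  edgeInt (v K) (exists_isTriple_piece K).choose (exists_isTriple_piece K).choose_spec.choose

/-- Exchanging the ends of the edge changes the sign of both factors, so the choice of an order is
immaterial. -/
lemma IsTriple.outerInt_eq {v : M.PiecewisePoly} {K : M.pieces} {b c : Plane}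
    (h : IsTriple K.1.1 K.1.2 b c) :
    outerInt v K = SignType.sign (tdet K.1.2 b c) * edgeInt (v K) b c := by
  have key : ∀ y z, IsTriple K.1.1 K.1.2 y z → SignType.sign (tdet K.1.2 y z) *
      edgeInt (v K) y z = SignType.sign (tdet K.1.2 b c) * edgeInt (v K) b c := by
    intro y z h'
    rcases h.eq_of h' with ⟨rfl, rfl⟩ | ⟨rfl, rfl⟩
    · rfl
    · rw [tdet_swap, edgeInt_swap, Left.sign_neg]
      simp
  exact key _ _ (exists_isTriple_piece K).choose_spec.choose_spec

lemma edgeInt_congr {p q : Poly} {b c : Plane} {s : Set Plane} (hs : Convex ℝ s)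
    (hb : b ∈ s) (hc : c ∈ s) (h : ∀ x ∈ s, grad p x = grad q x) :
    edgeInt p b c = edgeInt q b c := by
  rw [edgeInt, edgeInt, h b hb, h c hc, h _ (hs.midpoint_mem hb hc)]

lemma convex_region (K : M.pieces) : Convex ℝ (region K) := convex_convexHull ℝ _

lemma isCompact_region (K : M.pieces) : IsCompact (region K) :=
  Set.Finite.isCompact_convexHull (𝕜 := ℝ)
    (((Finset.finite_toSet _).subset Set.sdiff_subset).insert _)

lemma IsTriple.mem_region {K : M.pieces} {b c : Plane} (h : IsTriple K.1.1 K.1.2 b c) :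
    centroid3 K.1.2 b c ∈ region K ∧ b ∈ region K ∧ c ∈ region K := by
  rw [h.region_eq]
  refine ⟨?_, ?_, ?_⟩ <;> exact subset_convexHull _ _ (by simp)

lemma IsTriple.integral_hessDet {v : M.PiecewisePoly} {K : M.pieces} {b c : Plane}
    (h : IsTriple K.1.1 K.1.2 b c) (hv : (v K).totalDegree ≤ 3) :
    ∫ x in region K, hessDet (v K) x = outerInt v K + SignType.sign (tdet K.1.2 b c) *
      (edgeInt (v K) c (centroid3 K.1.2 b c) - edgeInt (v K) b (centroid3 K.1.2 b c)) := by
  have hD := h.tdet_ne_zero (piece_mem K).1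
  have e := tdet_centroid3 K.1.2 b c
  have hs : SignType.sign (tdet (centroid3 K.1.2 b c) b c) = SignType.sign (tdet K.1.2 b c) := by
    rw [e, div_eq_mul_inv, sign_mul, sign_pos (by norm_num : (0 : ℝ) < 3⁻¹), mul_one]
  rw [h.region_eq, CloughTocher.integral_hessDet hv (by rw [e]; positivity), hs, h.outerInt_eq,
    edgeInt_swap (v K) b]
  ring

/-- Each segment from the centroid to a vertex is traversed twice, in opposite directions, with the
same gradients by C¹ continuity; only the edges of the triangle remain. -/
lemma sum_integral_hessDet {v : M.PiecewisePoly} (hv : v ∈ M.clampedC1Cubics) :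
    ∑ K, ∫ x in region K, hessDet (v K) x = ∑ K, outerInt v K := by
  refine sum_pieces_congr fun T hT a b c ht => ?_
  obtain ⟨hdeg, hC1, -⟩ := hv
  set A := piece hT ht.mem.1
  set B := piece hT ht.mem.2.1
  set C := piece hT ht.mem.2.2
  have hA : IsTriple A.1.1 A.1.2 b c := ht
  have hB : IsTriple B.1.1 B.1.2 c a := ht.rotate
  have hC : IsTriple C.1.1 C.1.2 a b := ht.rotate.rotate
  rw [hA.integral_hessDet (hdeg A), hB.integral_hessDet (hdeg B), hC.integral_hessDet (hdeg C)]
  have mA := hA.mem_region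
  have mB := hB.mem_region
  have mC := hC.mem_region
  change centroid3 a b c ∈ _ ∧ _ at mA
  change centroid3 b c a ∈ _ ∧ _ at mB
  change centroid3 c a b ∈ _ ∧ _ at mC
  rw [centroid3_rotate] at mB
  rw [centroid3_rotate, centroid3_rotate] at mC
  change outerInt v A + SignType.sign (tdet a b c) * (edgeInt _ _ (centroid3 a b c) -
      edgeInt _ _ (centroid3 a b c)) + (outerInt v B + SignType.sign (tdet b c a) *
      (edgeInt _ _ (centroid3 b c a) - edgeInt _ _ (centroid3 b c a))) +
      (outerInt v C + SignType.sign (tdet c a b) * (edgeInt _ _ (centroid3 c a b)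
      - edgeInt _ _ (centroid3 c a b))) = _
  rw [tdet_rotate b c a, tdet_rotate a b c, centroid3_rotate b c a, centroid3_rotate a b c]
  have e : ∀ K L : M.pieces, ∀ x y, (x ∈ region K ∧ y ∈ region K) → (x ∈ region L ∧ y ∈ region L) →
      edgeInt (v K) x y = edgeInt (v L) x y := fun K L x y hK hL =>
    edgeInt_congr ((convex_region K).inter (convex_region L)) ⟨hK.1, hL.1⟩ ⟨hK.2, hL.2⟩
      fun z hz => (hC1 K L z hz).2
  rw [e A B c _ ⟨mA.2.2, mA.1⟩ ⟨mB.2.1, mB.1⟩, e A C b _ ⟨mA.2.1, mA.1⟩ ⟨mC.2.2, mC.1⟩,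
    e B C a _ ⟨mB.2.2, mB.1⟩ ⟨mC.2.1, mC.1⟩]
  ring

lemma not_isBoundaryEdge_iff {K : M.pieces} : ¬ M.IsBoundaryEdge K.1.1 K.1.2 ↔
    ∃ K' : M.pieces, K'.1.1 ≠ K.1.1 ∧ ∃ b c, IsTriple K.1.1 K.1.2 b c ∧
      IsTriple K'.1.1 K'.1.2 b c := by
  obtain ⟨hT, ha⟩ := piece_mem K
  constructor
  · intro h
    rw [IsBoundaryEdge] at h
    push Not at h
    obtain ⟨T', hT', hsub, hne⟩ := h hT ha
    obtain ⟨b, c, ht⟩ := exists_isTriple_piece K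
    rw [ht.diff, Set.pair_subset_iff] at hsub
    obtain ⟨hb, hc⟩ := hsub
    have : ∃ a', IsTriple T' a' b c := by
      obtain ⟨y, z, h'⟩ := exists_isTriple (M.card_eq _ hT') hb
      have hc' : c = y ∨ c = z := by
        have : c ∈ T' := hc
        rw [h'.eq] at this
        simp only [Finset.mem_insert, Finset.mem_singleton] at this
        rcases this with h | h | h
        · exact absurd h ht.bc.symm
        · exact Or.inl h
        · exact Or.inr h
      rcases hc' with rfl | rfl
      · exact ⟨z, h'.rotate.rotate⟩
      · exact ⟨y, h'.rotate.swap⟩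
    obtain ⟨a', h'⟩ := this
    exact ⟨piece hT' h'.mem.1, hne, b, c, ht, h'⟩
  · rintro ⟨K', hne, b, c, h, h'⟩ ⟨-, -, hB⟩
    refine hne (hB _ (piece_mem K').1 ?_)
    rw [h.diff, Set.pair_subset_iff]
    exact ⟨h'.mem.2.1, h'.mem.2.2⟩

lemma isTriple_of_isTriple {T T' : Finset Plane} {a b c a' b' c' : Plane}
    (h : IsTriple T a b c) (h' : IsTriple T a b' c') (h'' : IsTriple T' a' b' c') :
    IsTriple T' a' b c := by
  rcases h.eq_of h' with ⟨rfl, rfl⟩ | ⟨rfl, rfl⟩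
  · exact h''
  · exact h''.swap

/-- Three triangles on a common edge would have apices pairwise on opposite sides of one line. -/
lemma neighbour_unique {K K₁ K₂ : M.pieces} {b c : Plane} (h : IsTriple K.1.1 K.1.2 b c)
    (h₁ : IsTriple K₁.1.1 K₁.1.2 b c) (h₂ : IsTriple K₂.1.1 K₂.1.2 b c)
    (n₁ : K₁.1.1 ≠ K.1.1) (n₂ : K₂.1.1 ≠ K.1.1) : K₁ = K₂ := by
  have e : K₁.1.1 = K₂.1.1 := by
    by_contra hne
    have o₁ := h₁.opposite (piece_mem K₁).1 (piece_mem K).1 n₁ h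
    have o₂ := h₂.opposite (piece_mem K₂).1 (piece_mem K).1 n₂ h
    have o := h₁.opposite (piece_mem K₁).1 (piece_mem K₂).1 hne h₂
    have h0 := h.tdet_ne_zero (piece_mem K).1
    nlinarith [mul_pos_of_neg_of_neg o₁ o₂, sq_nonneg (tdet K.1.2 b c),
      mul_nonneg (neg_nonneg.2 o.le) (sq_nonneg (tdet K.1.2 b c))]
  have e2 : K₁.1.2 = K₂.1.2 := by
    have hm := h₁.mem.1
    rw [e, h₂.eq] at hm
    simp only [Finset.mem_insert, Finset.mem_singleton] at hm
    rcases hm with h | h | h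
    · exact h
    · exact absurd h h₁.ab
    · exact absurd h h₁.ac
  exact Subtype.ext (Sigma.ext e (heq_of_eq e2))

lemma mem_boundaryVertices {K : M.pieces} (hK : M.IsBoundaryEdge K.1.1 K.1.2) {b c : Plane}
    (h : IsTriple K.1.1 K.1.2 b c) : b ∈ M.boundaryVertices ∧ c ∈ M.boundaryVertices :=
  ⟨⟨_, _, hK, h.mem.2.1, h.ab.symm⟩, ⟨_, _, hK, h.mem.2.2, h.ac.symm⟩⟩

/-- Contributions of the two sides of an interior edge are opposite, since the orientations are
opposite and the gradients agree. On a boundary edge the gradients at both ends vanish, and so does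
`edgeForm`. -/
lemma sum_outerInt {v : M.PiecewisePoly} (hv : v ∈ M.clampedC1Cubics) :
    ∑ K, outerInt v K = 0 := by
  classical
  obtain ⟨-, hC1, hbd⟩ := hv
  -- The involution crosses the outer edge; boundary edges are fixed points, which is harmless as
  -- their contribution is zero.
  let g : M.pieces → M.pieces := fun K =>
    if h : M.IsBoundaryEdge K.1.1 K.1.2 then K else (not_isBoundaryEdge_iff.1 h).choose
  have hg : ∀ K, ¬ M.IsBoundaryEdge K.1.1 K.1.2 → (g K).1.1 ≠ K.1.1 ∧
      ∃ b c, IsTriple K.1.1 K.1.2 b c ∧ IsTriple (g K).1.1 (g K).1.2 b c := by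
    intro K h
    simp only [g, dif_neg h]
    exact (not_isBoundaryEdge_iff.1 h).choose_spec
  have hzero : ∀ K, M.IsBoundaryEdge K.1.1 K.1.2 → outerInt v K = 0 := by
    intro K hK
    obtain ⟨b, c, ht⟩ := exists_isTriple_piece K
    have mv := mem_boundaryVertices hK ht
    have mr := ht.mem_region
    rw [ht.outerInt_eq, edgeInt, (hbd K b ⟨mr.2.1, mv.1⟩).2, (hbd K c ⟨mr.2.2, mv.2⟩).2]
    simp [edgeForm]
  refine Finset.sum_involution (fun K _ => g K) ?_ ?_ (by simp) ?_
  · intro K _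
    by_cases hK : M.IsBoundaryEdge K.1.1 K.1.2
    · simp only [g, dif_pos hK, hzero K hK, add_zero]
    · obtain ⟨hne, b, c, h, h'⟩ := hg K hK
      have o := h.opposite (piece_mem K).1 (piece_mem (g K)).1 hne.symm h'
      have m := h.mem_region
      have m' := h'.mem_region
      rw [h.outerInt_eq, h'.outerInt_eq,
        edgeInt_congr ((convex_region K).inter (convex_region (g K))) ⟨m.2.1, m'.2.1⟩
          ⟨m.2.2, m'.2.2⟩ fun z hz => (hC1 K (g K) z hz).2]
      rcases mul_neg_iff.1 o with ⟨h1, h2⟩ | ⟨h1, h2⟩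
      · rw [sign_pos h1, sign_neg h2]; simp
      · rw [sign_pos h2, sign_neg h1]; simp
  · intro K _ hK0 hKK
    by_cases hK : M.IsBoundaryEdge K.1.1 K.1.2
    · exact hK0 (hzero K hK)
    · exact (hg K hK).1 (by rw [hKK])
  · intro K _
    by_cases hK : M.IsBoundaryEdge K.1.1 K.1.2
    · simp only [g, dif_pos hK]
    · obtain ⟨hne, b, c, h, h'⟩ := hg K hK
      have hK' : ¬ M.IsBoundaryEdge (g K).1.1 (g K).1.2 :=
        not_isBoundaryEdge_iff.2 ⟨K, hne.symm, b, c, h', h⟩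
      obtain ⟨hne', b', c', k, k'⟩ := hg (g K) hK'
      exact neighbour_unique h' (isTriple_of_isTriple h' k k') h hne' hne.symm

/-- On piecewise cubics clamped at the boundary vertices, the Laplacian and the Hessian have the
same `L²` norm. -/
lemma bilin_self {v : M.PiecewisePoly} (hv : v ∈ M.clampedC1Cubics) :
    bilin v v = ∑ K, ∫ x in region K, hessSq (v K) x := by
  have h0 := (sum_integral_hessDet hv).trans (sum_outerInt hv)
  have e : ∀ K, ∫ x in region K, lap (v K) x * lap (v K) x =
      (∫ x in region K, hessSq (v K) x) + 2 * ∫ x in region K, hessDet (v K) x := by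
    intro K
    simp only [lap_sq_eq]
    rw [integral_add, integral_const_mul]
    · exact (continuous_hessSq _).continuousOn.integrableOn_compact (isCompact_region K)
    · refine ContinuousOn.integrableOn_compact (isCompact_region K) (Continuous.continuousOn ?_)
      unfold hessDet
      have := fun i j => continuous_hess (v K) i j
      fun_prop
  rw [bilin]
  simp only [e]
  rw [Finset.sum_add_distrib, ← Finset.mul_sum, h0, mul_zero, add_zero]

end Triangulation

/-! ### Definiteness of the broken seminorm on clamped functions -/

lemma IsAff.eq_zero {w : Plane → ℝ} (hw : IsAff w) {a b c : Plane} (h : tdet a b c ≠ 0)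
    (ha : w a = 0) (hb : w b = 0) (hc : w c = 0) (x : Plane) : w x = 0 := by
  obtain ⟨α, β, γ, hw⟩ := hw
  rw [hw] at ha hb hc ⊢
  have : tdet a b c * (α + β * x 0 + γ * x 1) = 0 := by
    have : tdet a b c * (α + β * x 0 + γ * x 1) =
        tdet x b c * (α + β * a 0 + γ * a 1) + tdet a x c * (α + β * b 0 + γ * b 1)
          + tdet a b x * (α + β * c 0 + γ * c 1) := by
      simp only [tdet]; ring
    rw [this, ha, hb, hc]; ring
  simpa [h] using this

lemma hessSq_nonneg (p : Poly) (x : Plane) : 0 ≤ hessSq p x := by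
  rw [hessSq_eq]; positivity

lemma integral_hessSq {p : Poly} (hp : p.totalDegree ≤ 3) {a b c : Plane} (h : tdet a b c ≠ 0) :
    ∫ x in convexHull ℝ ({a, b, c} : Set Plane), hessSq p x = |tdet a b c| / 24 *
      (hessSq p a + hessSq p b + hessSq p c +
        ((hess p 0 0 a + hess p 0 0 b + hess p 0 0 c) ^ 2
        + 2 * (hess p 0 1 a + hess p 0 1 b + hess p 0 1 c) ^ 2
        + (hess p 1 1 a + hess p 1 1 b + hess p 1 1 c) ^ 2)) := by
  have H := fun i j => isAff_hess hp i j
  have hcpt : IsCompact (convexHull ℝ ({a, b, c} : Set Plane)) :=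
    (Set.toFinite _).isCompact_convexHull (𝕜 := ℝ)
  have hint : ∀ i j, IntegrableOn (fun x => hess p i j x * hess p i j x)
      (convexHull ℝ ({a, b, c} : Set Plane)) := fun i j =>
    ((continuous_hess p i j).mul (continuous_hess p i j)).continuousOn.integrableOn_compact hcpt
  have e : ∀ x, hessSq p x = hess p 0 0 x * hess p 0 0 x + 2 * (hess p 0 1 x * hess p 0 1 x)
      + hess p 1 1 x * hess p 1 1 x := fun x => by rw [hessSq_eq]; ring
  have i2 : IntegrableOn (fun x => hess p 0 0 x * hess p 0 0 x +
      2 * (hess p 0 1 x * hess p 0 1 x)) (convexHull ℝ ({a, b, c} : Set Plane)) :=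
    (hint 0 0).add ((hint 0 1).const_mul 2)
  simp only [e]
  rw [integral_add i2 (hint 1 1),
    integral_add (hint 0 0) ((hint 0 1).const_mul 2), integral_const_mul,
    setIntegral_triangle_mul (H 0 0) (H 0 0) h, setIntegral_triangle_mul (H 0 1) (H 0 1) h,
    setIntegral_triangle_mul (H 1 1) (H 1 1) h]
  ring

/-- The mass matrix is a multiple of the identity plus the all-ones matrix. Dropping the latter
gives this lower bound; Cauchy–Schwarz on it gives the upper bound `integral_hessSq_le`. -/
lemma le_integral_hessSq {p : Poly} (hp : p.totalDegree ≤ 3) {a b c : Plane}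
    (h : tdet a b c ≠ 0) : |tdet a b c| / 24 * (hessSq p a + hessSq p b + hessSq p c) ≤
      ∫ x in convexHull ℝ ({a, b, c} : Set Plane), hessSq p x := by
  rw [integral_hessSq hp h]
  refine mul_le_mul_of_nonneg_left ?_ (by positivity)
  have : 0 ≤ (hess p 0 0 a + hess p 0 0 b + hess p 0 0 c) ^ 2
        + 2 * (hess p 0 1 a + hess p 0 1 b + hess p 0 1 c) ^ 2
        + (hess p 1 1 a + hess p 1 1 b + hess p 1 1 c) ^ 2 := by positivity
  linarith

lemma integral_hessSq_le {p : Poly} (hp : p.totalDegree ≤ 3) {a b c : Plane}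
    (h : tdet a b c ≠ 0) : ∫ x in convexHull ℝ ({a, b, c} : Set Plane), hessSq p x ≤
      |tdet a b c| / 6 * (hessSq p a + hessSq p b + hessSq p c) := by
  rw [integral_hessSq hp h, show |tdet a b c| / 6 * (hessSq p a + hessSq p b + hessSq p c) =
    |tdet a b c| / 24 * (4 * (hessSq p a + hessSq p b + hessSq p c)) by ring]
  refine mul_le_mul_of_nonneg_left ?_ (by positivity)
  have k : ∀ x y z : ℝ, (x + y + z) ^ 2 ≤ 3 * (x ^ 2 + y ^ 2 + z ^ 2) := fun x y z => by
    nlinarith [sq_nonneg (x - y), sq_nonneg (y - z), sq_nonneg (x - z)]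
  have := k (hess p 0 0 a) (hess p 0 0 b) (hess p 0 0 c)
  have := k (hess p 0 1 a) (hess p 0 1 b) (hess p 0 1 c)
  have := k (hess p 1 1 a) (hess p 1 1 b) (hess p 1 1 c)
  simp only [hessSq_eq]
  linarith

/-- A polynomial of degree at most one. -/
def IsAffPoly (p : Poly) : Prop := ∃ α β γ : ℝ, p = cubic ![α, β, γ, 0, 0, 0, 0, 0, 0, 0]

lemma isAffPoly_of_hess {p : Poly} (hp : p.totalDegree ≤ 3)
    (h : ∀ i j x, hess p i j x = 0) : IsAffPoly p := by
  obtain ⟨k, rfl⟩ := exists_eq_cubic hp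
  have h00 := h 0 0; have h01 := h 0 1; have h11 := h 1 1
  simp only [hess_cubic_zero_zero, hess_cubic_zero_one, hess_cubic_one_one] at h00 h01 h11
  refine ⟨k 0, k 1, k 2, ?_⟩
  have a0 := h00 0; have a1 := h00 !₂[1, 0]; have a2 := h00 !₂[0, 1]
  have b0 := h01 0; have b1 := h01 !₂[1, 0]; have b2 := h01 !₂[0, 1]
  have c0 := h11 0; have c1 := h11 !₂[1, 0]; have c2 := h11 !₂[0, 1]
  simp at a0 a1 a2 b0 b1 b2 c0 c1 c2
  congr 1
  ext i
  fin_cases i <;> simp <;> linarith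

lemma IsAffPoly.ext {p q : Poly} (hp : IsAffPoly p) (hq : IsAffPoly q) {x : Plane}
    (hv : val p x = val q x) (hg : grad p x = grad q x) : p = q := by
  obtain ⟨α, β, γ, rfl⟩ := hp
  obtain ⟨α', β', γ', rfl⟩ := hq
  have g0 := congrArg (fun z : Plane => z 0) hg
  have g1 := congrArg (fun z : Plane => z 1) hg
  simp [grad_cubic_zero] at g0
  simp [grad_cubic_one] at g1
  simp [val_cubic, g0, g1] at hv
  rw [g0, g1, hv]

lemma isAffPoly_zero : IsAffPoly 0 := ⟨0, 0, 0, by simp [cubic]⟩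

namespace Triangulation
variable {M : Triangulation}

lemma integral_region_nonneg (v : M.PiecewisePoly) (K : M.pieces) :
    0 ≤ ∫ x in region K, hessSq (v K) x :=
  integral_nonneg fun x => hessSq_nonneg _ x

/-- The lower bound forces the Hessian to vanish at the three vertices of the sub-triangle, and the
Hessian is affine. -/
lemma isAffPoly_of_integral {v : M.PiecewisePoly} (hdeg : ∀ K, (v K).totalDegree ≤ 3)
    (h0 : ∑ K, ∫ x in region K, hessSq (v K) x = 0) (K : M.pieces) : IsAffPoly (v K) := by
  have hK := (Finset.sum_eq_zero_iff_of_nonneg fun K _ => integral_region_nonneg v K).1 h0 K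
    (Finset.mem_univ _)
  obtain ⟨b, c, ht⟩ := exists_isTriple_piece K
  have hD := ht.tdet_ne_zero (piece_mem K).1
  have hD' : tdet (centroid3 K.1.2 b c) b c ≠ 0 := by rw [tdet_centroid3]; positivity
  have hle := le_integral_hessSq (hdeg K) hD'
  rw [← ht.region_eq, hK] at hle
  set G := centroid3 K.1.2 b c
  have hpos : 0 < |tdet G b c| / 24 := by positivity
  have n1 := hessSq_nonneg (v K) G
  have n2 := hessSq_nonneg (v K) b
  have n3 := hessSq_nonneg (v K) c
  have hs : hessSq (v K) G + hessSq (v K) b + hessSq (v K) c ≤ 0 := by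
    by_contra hcon
    nlinarith [mul_pos hpos (not_le.1 hcon)]
  have z : ∀ x, hessSq (v K) x = 0 → ∀ i j, hess (v K) i j x = 0 := by
    intro x hx i j
    rw [hessSq_eq] at hx
    have n1 := sq_nonneg (hess (v K) 0 0 x)
    have n2 := sq_nonneg (hess (v K) 0 1 x)
    have n3 := sq_nonneg (hess (v K) 1 1 x)
    have h00 : hess (v K) 0 0 x = 0 := pow_eq_zero_iff two_ne_zero |>.1 (by linarith)
    have h01 : hess (v K) 0 1 x = 0 := pow_eq_zero_iff two_ne_zero |>.1 (by linarith)
    have h11 : hess (v K) 1 1 x = 0 := pow_eq_zero_iff two_ne_zero |>.1 (by linarith)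
    fin_cases i <;> fin_cases j
    exacts [h00, h01, (hess_comm _ _ _ _).trans h01, h11]
  exact isAffPoly_of_hess (hdeg K) fun i j x => (isAff_hess (hdeg K) i j).eq_zero hD'
    (z G (by linarith) i j) (z b (by linarith) i j) (z c (by linarith) i j) x

lemma exists_piece_mem {T : Finset Plane} (hT : T ∈ M.tri) {x : Plane} (hx : x ∈ T) :
    ∃ K : M.pieces, K.1.1 = T ∧ x ∈ region K := by
  obtain ⟨b, c, ht⟩ := exists_isTriple (M.card_eq _ hT) hx
  exact ⟨piece hT ht.mem.2.1, rfl,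
    (IsTriple.mem_region (K := piece hT ht.mem.2.1) ht.rotate).2.2⟩

lemma centroid_mem_region (K : M.pieces) :
    (3 : ℝ)⁻¹ • ∑ x ∈ K.1.1, x ∈ region K := subset_convexHull _ _ (by simp)

/-- A piecewise cubic of class `C¹`, clamped at the boundary vertices, whose Hessian vanishes, is
zero. -/
lemma eq_zero_of_integral_hessSq {v : M.PiecewisePoly} (hv : v ∈ M.clampedC1Cubics)
    (h0 : ∑ K, ∫ x in region K, hessSq (v K) x = 0) : v = 0 := by
  classical
  obtain ⟨hdeg, hC1, hbd⟩ := hv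
  have haff := isAffPoly_of_integral hdeg h0
  -- Two affine pieces with a common point have the same value and gradient there, hence coincide.
  -- Through centroids and common vertices this propagates to all triangles touching at a vertex.
  have same : ∀ K K' x, x ∈ region K → x ∈ region K' → v K = v K' := fun K K' x h h' =>
    (haff K).ext (haff K') (hC1 K K' x ⟨h, h'⟩).1 (hC1 K K' x ⟨h, h'⟩).2
  have sameT : ∀ K K' : M.pieces, K.1.1 = K'.1.1 → v K = v K' := fun K K' h =>
    same K K' _ (centroid_mem_region K) (h ▸ centroid_mem_region K')
  have sameV : ∀ K K' : M.pieces, ∀ x, x ∈ K.1.1 → x ∈ K'.1.1 → v K = v K' := by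
    intro K K' x h h'
    obtain ⟨L, hL, hx⟩ := exists_piece_mem (piece_mem K).1 h
    obtain ⟨L', hL', hx'⟩ := exists_piece_mem (piece_mem K').1 h'
    rw [sameT K L hL.symm, sameT K' L' hL'.symm, same L L' x hx hx']
  have interior : ∀ K, v K ≠ 0 → ¬ M.IsBoundaryEdge K.1.1 K.1.2 := by
    intro K hK hB
    obtain ⟨b, c, ht⟩ := exists_isTriple_piece K
    have hb := hbd K b ⟨ht.mem_region.2.1, (mem_boundaryVertices hB ht).1⟩
    exact hK ((haff K).ext isAffPoly_zero (by rw [hb.1, val_zero]) (by rw [hb.2, grad_zero]))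
  by_contra hne
  obtain ⟨K₀, hK₀⟩ : ∃ K, v K ≠ 0 := by
    by_contra hcon
    push Not at hcon
    exact hne (funext hcon)
  let W : Finset Plane := (Finset.univ.filter fun K => v K ≠ 0).biUnion fun K => K.1.1
  have memW : ∀ x, x ∈ W ↔ ∃ K, v K ≠ 0 ∧ x ∈ K.1.1 := by
    intro x; simp [W]
  -- Among the vertices of triangles where `v` is nonzero, `w` is farthest from the origin, so that
  -- all the other vertices of such triangles at `w` lie in the open half-plane ⟨w, x − w⟩ < 0.
  obtain ⟨w, hw, hmax⟩ := Finset.exists_max_image W (fun x => ‖x‖)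
    ⟨K₀.1.2, (memW _).2 ⟨K₀, hK₀, (piece_mem K₀).2⟩⟩
  let B : Finset Plane :=
    ((Finset.univ.filter fun K : M.pieces => v K ≠ 0 ∧ w ∈ K.1.1).biUnion fun K => K.1.1).erase w
  have memB : ∀ x, x ∈ B ↔ x ≠ w ∧ ∃ K, (v K ≠ 0 ∧ w ∈ K.1.1) ∧ x ∈ K.1.1 := by
    intro x; simp [B]
  have hneg : ∀ b ∈ B, w 0 * (b 0 - w 0) + w 1 * (b 1 - w 1) < 0 := by
    intro b hb
    obtain ⟨hbw, K, ⟨hK, -⟩, hbK⟩ := (memB b).1 hb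
    have h1 := hmax b ((memW b).2 ⟨K, hK, hbK⟩)
    have h2 : ‖b‖ ^ 2 ≤ ‖w‖ ^ 2 := by gcongr
    have h3 : 0 < ‖b - w‖ ^ 2 := by
      have := norm_pos_iff.2 (sub_ne_zero.2 hbw)
      positivity
    rw [norm_sq_plane, norm_sq_plane] at h2
    rw [norm_sq_plane] at h3
    simp only [PiLp.sub_apply] at h3
    nlinarith
  obtain ⟨K₁, hK₁, hwK₁⟩ := (memW w).1 hw
  obtain ⟨b₁, c₁, ht₁⟩ := exists_isTriple (M.card_eq _ (piece_mem K₁).1) hwK₁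
  -- Directions from `w` into that half-plane are ordered by the tangent of their angle with −w; `b`
  -- is on an extreme one.
  obtain ⟨b, hbB, hbmax⟩ := Finset.exists_max_image B
    (fun x => (w 0 * (x 1 - w 1) - w 1 * (x 0 - w 0)) /
      (-(w 0 * (x 0 - w 0) + w 1 * (x 1 - w 1))))
    ⟨b₁, (memB _).2 ⟨ht₁.ab.symm, K₁, ⟨hK₁, hwK₁⟩, ht₁.mem.2.1⟩⟩
  obtain ⟨hbw, K₂, ⟨hK₂, hwK₂⟩, hbK₂⟩ := (memB b).1 hbB
  obtain ⟨a, ht⟩ : ∃ a, IsTriple K₂.1.1 a w b := by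
    obtain ⟨y, z, h'⟩ := exists_isTriple (M.card_eq _ (piece_mem K₂).1) hwK₂
    rw [h'.eq] at hbK₂
    simp only [Finset.mem_insert, Finset.mem_singleton] at hbK₂
    rcases hbK₂ with h | rfl | rfl
    · exact absurd h hbw
    · exact ⟨z, h'.rotate.rotate⟩
    · exact ⟨y, h'.rotate.swap⟩
  have hA : v (piece (piece_mem K₂).1 ht.mem.1) ≠ 0 := by
    rwa [sameT (piece (piece_mem K₂).1 ht.mem.1) K₂ rfl]
  -- The edge `[w, b]` cannot be on Γ_h, as `v` is nonzero next to it, so there is a neighbour, on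
  -- which `v` is nonzero too. Its apex is on the other side of the line through `w` and `b`,
  -- against the extremality of `b`.
  obtain ⟨K', hne', b', c', k, k'⟩ := not_isBoundaryEdge_iff.1 (interior _ hA)
  have ht' : IsTriple K'.1.1 K'.1.2 w b := isTriple_of_isTriple (T := K₂.1.1) ht k k'
  have hK' : v K' ≠ 0 := by rwa [sameV K' K₂ w ht'.mem.2.1 hwK₂]
  have haB : a ∈ B := (memB a).2 ⟨ht.ab, K₂, ⟨hK₂, hwK₂⟩, ht.mem.1⟩
  have haB' : K'.1.2 ∈ B := (memB _).2 ⟨ht'.ab, K', ⟨hK', ht'.mem.2.1⟩, ht'.mem.1⟩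
  have hopp := ht.opposite (piece_mem K₂).1 (piece_mem K').1 (fun h => hne' h.symm) ht'
  have hb0 := hneg b hbB
  have hsign : ∀ x ∈ B, 0 ≤ (w 0 ^ 2 + w 1 ^ 2) * tdet x w b := by
    intro x hx
    have hx0 := hneg x hx
    have := hbmax x hx
    rw [div_le_div_iff₀ (by linarith) (by linarith)] at this
    simp only [tdet]
    nlinarith
  have hw2 : 0 < w 0 ^ 2 + w 1 ^ 2 := by
    by_contra hcon
    have e0 : w 0 = 0 := by nlinarith [sq_nonneg (w 0), sq_nonneg (w 1)]
    have e1 : w 1 = 0 := by nlinarith [sq_nonneg (w 0), sq_nonneg (w 1)]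
    rw [e0, e1] at hb0
    linarith
  have s1 := nonneg_of_mul_nonneg_right (hsign a haB) hw2
  have s2 := nonneg_of_mul_nonneg_right (hsign _ haB') hw2
  nlinarith

end Triangulation

/-! ### Boundaries of class `C^{1,1}` -/

lemma rot_zero (n : Plane) : rot n 0 = -(n 1) := rfl
lemma rot_one (n : Plane) : rot n 1 = n 0 := rfl

section Frame
variable {n : Plane}

lemma norm_eq_one_iff_plane : ‖n‖ = 1 ↔ n 0 ^ 2 + n 1 ^ 2 = 1 := by
  rw [← norm_sq_plane]
  constructor
  · intro h; rw [h]; norm_num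
  · intro h; exact (pow_eq_one_iff_of_nonneg (norm_nonneg _) two_ne_zero).1 h

lemma frame_decomp (hn : ‖n‖ = 1) (x : Plane) :
    x = inner ℝ (rot n) x • rot n + inner ℝ n x • n := by
  rw [norm_eq_one_iff_plane] at hn
  apply plane_ext <;>
  simp only [inner_plane, PiLp.add_apply, PiLp.smul_apply, smul_eq_mul, rot_zero, rot_one]
  · linear_combination -x 0 * hn
  · linear_combination -x 1 * hn

lemma frame_inner (hn : ‖n‖ = 1) (x y : Plane) :
    inner ℝ x y = inner ℝ (rot n) x * inner ℝ (rot n) y + inner ℝ n x * inner ℝ n y := by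
  rw [norm_eq_one_iff_plane] at hn
  simp only [inner_plane, rot_zero, rot_one]
  linear_combination -(x 0 * y 0 + x 1 * y 1) * hn

lemma norm_rot (hn : ‖n‖ = 1) : ‖rot n‖ = 1 := by
  rw [norm_eq_one_iff_plane] at hn ⊢
  simp only [rot_zero, rot_one]; linarith

lemma inner_rot_self (n : Plane) : inner ℝ n (rot n) = 0 := by
  simp only [inner_plane, rot_zero, rot_one]; ring

lemma inner_rot_self' (n : Plane) : inner ℝ (rot n) n = 0 := by
  simp only [inner_plane, rot_zero, rot_one]; ring

lemma inner_rot_rot (n m : Plane) : inner ℝ (rot n) (rot m) = inner ℝ n m := by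
  simp only [inner_plane, rot_zero, rot_one]; ring

lemma inner_rot (n m : Plane) : inner ℝ n (rot m) = -inner ℝ (rot n) m := by
  simp only [inner_plane, rot_zero, rot_one]; ring

lemma frame_norm_le (hn : ‖n‖ = 1) (x : Plane) :
    ‖x‖ ≤ |inner ℝ (rot n) x| + |inner ℝ n x| := by
  nth_rw 1 [frame_decomp hn x]
  refine (norm_add_le _ _).trans_eq ?_
  rw [norm_smul, norm_smul, hn, norm_rot hn, mul_one, mul_one, Real.norm_eq_abs, Real.norm_eq_abs]

lemma abs_inner_le (hn : ‖n‖ = 1) (x : Plane) : |inner ℝ n x| ≤ ‖x‖ := by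
  simpa [hn] using abs_real_inner_le_norm n x

/-- The point with coordinates `(s, y)` in the frame `(rot n, n)` at `p`. -/
def framePt (p n : Plane) (s y : ℝ) : Plane := p + (s • rot n + y • n)

lemma inner_framePt (hn : ‖n‖ = 1) (p : Plane) (s y : ℝ) :
    inner ℝ n (framePt p n s y - p) = y := by
  simp [framePt, inner_add_right, inner_smul_right, inner_rot_self, hn]

lemma inner_rot_framePt (hn : ‖n‖ = 1) (p : Plane) (s y : ℝ) :
    inner ℝ (rot n) (framePt p n s y - p) = s := by
  simp [framePt, inner_add_right, inner_smul_right, inner_rot_self', norm_rot hn]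

lemma framePt_inner (hn : ‖n‖ = 1) (p x : Plane) :
    framePt p n (inner ℝ (rot n) (x - p)) (inner ℝ n (x - p)) = x := by
  rw [framePt, ← frame_decomp hn]; abel

end Frame

/-- The frontier of a set lying locally below a graph is locally the graph. -/
lemma mem_frontier_iff_graph {Ω : Set Plane} (hΩ : IsOpen Ω) {p n : Plane} (hn : ‖n‖ = 1)
    {r : ℝ} {g : ℝ → ℝ} (hg : Continuous g)
    (h : ∀ x ∈ Metric.ball p r, x ∈ Ω ↔ inner ℝ n (x - p) < g (inner ℝ (rot n) (x - p)))
    {x : Plane} (hx : x ∈ Metric.ball p r) :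
    x ∈ frontier Ω ↔ inner ℝ n (x - p) = g (inner ℝ (rot n) (x - p)) := by
  rw [hΩ.frontier_eq]
  constructor
  · rintro ⟨hcl, hnot⟩
    rw [h x hx, not_lt] at hnot
    refine le_antisymm ?_ hnot
    by_contra hlt
    have hopen : IsOpen (Metric.ball p r ∩ {z | g (inner ℝ (rot n) (z - p)) < inner ℝ n (z - p)}) :=
      Metric.isOpen_ball.inter (isOpen_lt (by fun_prop) (by fun_prop))
    obtain ⟨z, ⟨hz1, hz2⟩, hz3⟩ := mem_closure_iff.1 hcl _ hopen ⟨hx, not_le.1 hlt⟩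
    exact lt_asymm hz2 ((h z hz1).1 hz3)
  · intro heq
    refine ⟨?_, fun hxΩ => ((h x hx).1 hxΩ).ne heq⟩
    have hlim : Filter.Tendsto (fun t : ℝ => x - t • n) (nhdsWithin 0 (Set.Ioi 0)) (nhds x) := by
      have : Continuous (fun t : ℝ => x - t • n) := by fun_prop
      simpa using (this.tendsto 0).mono_left nhdsWithin_le_nhds
    refine mem_closure_of_tendsto hlim ?_
    filter_upwards [hlim.eventually (Metric.isOpen_ball.mem_nhds hx), self_mem_nhdsWithin]
      with t ht ht0
    rw [h _ ht]
    have e1 : inner ℝ n (x - t • n - p) = inner ℝ n (x - p) - t := by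
      rw [sub_right_comm, inner_sub_right, inner_smul_right, real_inner_self_eq_norm_sq, hn]; ring
    have e2 : inner ℝ (rot n) (x - t • n - p) = inner ℝ (rot n) (x - p) := by
      rw [sub_right_comm, inner_sub_right, inner_smul_right, inner_rot_self']; ring
    rw [e1, e2, ← heq]
    have : 0 < t := ht0
    linarith

/-- Uniform local description of the boundary as a graph of small slope. -/
lemma exists_uniform_chart {Ω : Set Plane} (hΩ : IsC11Domain Ω) {ε : ℝ} (hε : 0 < ε) :
    ∃ δ > 0, ∀ b ∈ frontier Ω, ∃ p n : Plane, ∃ g : ℝ → ℝ, ∃ ρ : ℝ, ‖n‖ = 1 ∧ Differentiable ℝ g ∧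
      (∀ s, |s| < ρ → |deriv g s| ≤ ε) ∧
      ∀ x ∈ Metric.ball b δ, |inner ℝ (rot n) (x - p)| < ρ ∧
        (x ∈ frontier Ω ↔ inner ℝ n (x - p) = g (inner ℝ (rot n) (x - p))) := by
  have hcpt : IsCompact (frontier Ω) := Metric.isCompact_of_isClosed_isBounded isClosed_frontier
    (hΩ.isBounded.closure.subset frontier_subset_closure)
  have chart : ∀ q : frontier Ω, ∃ n : Plane, ∃ g : ℝ → ℝ, ∃ ρ > 0, ‖n‖ = 1 ∧ Differentiable ℝ g ∧
      (∀ s, |s| < ρ → |deriv g s| ≤ ε) ∧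
      ∀ x ∈ Metric.ball (q : Plane) ρ, |inner ℝ (rot n) (x - q)| < ρ ∧
        (x ∈ frontier Ω ↔ inner ℝ n (x - q) = g (inner ℝ (rot n) (x - q))) := by
    rintro ⟨q, hq⟩
    obtain ⟨n, hn, r, hr, g, hg, ⟨L, hL⟩, -, hg0, h⟩ := hΩ.exists_normal q hq
    -- Of the Lipschitz bound on `deriv g` only continuity at 0 is needed: with `deriv g 0 = 0` it
    -- makes the slope small near the base point.
    have hcont : ContinuousAt (deriv g) 0 := hL.continuous.continuousAt
    obtain ⟨η, hη, hη'⟩ := Metric.continuousAt_iff.1 hcont ε hε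
    refine ⟨n, g, min r η, lt_min hr hη, hn, hg, fun s hs => ?_, fun x hx => ⟨?_, ?_⟩⟩
    · have := hη' (x := s) (by simpa using hs.trans_le (min_le_right _ _))
      rw [hg0, Real.dist_eq, sub_zero] at this
      exact this.le
    · refine (abs_inner_le (norm_rot hn) _).trans_lt ?_
      rwa [Metric.mem_ball, dist_eq_norm] at hx
    · exact mem_frontier_iff_graph hΩ.isOpen hn hg.continuous h
        (Metric.ball_subset_ball (min_le_left _ _) hx)
  choose n g ρ hρ hn hg hd hx using chart
  -- A Lebesgue number of the cover of the compact boundary by chart balls gives a radius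
  -- independent of the point.
  obtain ⟨δ, hδ, hleb⟩ := lebesgue_number_lemma_of_metric hcpt
    (c := fun q : frontier Ω => Metric.ball (q : Plane) (ρ q)) (fun q => Metric.isOpen_ball)
    (fun q hq => Set.mem_iUnion.2 ⟨⟨q, hq⟩, Metric.mem_ball_self (hρ _)⟩)
  refine ⟨δ, hδ, fun b hb => ?_⟩
  obtain ⟨q, hq⟩ := hleb b hb
  exact ⟨q, n q, g q, ρ q, hn q, hg q, hd q, fun x h => hx q x (hq h)⟩

/-- The outer normals at a point of a graph are normal to the graph. -/
lemma IsOuterUnitNormal.slope {Ω : Set Plane} (hΩ : IsOpen Ω) {P N : Plane}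
    (hN : IsOuterUnitNormal Ω P N) {b p n : Plane} {δ : ℝ} {g : ℝ → ℝ}
    (hg : Differentiable ℝ g) (hPb : P ∈ Metric.ball b δ)
    (h : ∀ x ∈ Metric.ball b δ, x ∈ frontier Ω →
      inner ℝ n (x - p) = g (inner ℝ (rot n) (x - p))) :
    inner ℝ (rot n) N = -(deriv g (inner ℝ (rot n) (P - p)) * inner ℝ n N) := by
  obtain ⟨hN1, r, hr, G, hG, -, hG0, hG0', hgraph⟩ := hN
  -- The boundary curve in the chart attached to `N`; its velocity at 0 is `rot N`. It also lies on
  -- the graph of `g`, and differentiating that relation at 0 gives the slope.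
  set Z : ℝ → Plane := fun t => framePt P N t (G t) with hZ
  have hZ0 : Z 0 = P := by simp [hZ, framePt, hG0]
  have hZc : Continuous Z := by
    have := hG.continuous
    simp only [hZ, framePt]; fun_prop
  have ev : (fun t => inner ℝ n (Z t - p)) =ᶠ[nhds 0]
      fun t => g (inner ℝ (rot n) (Z t - p)) := by
    have h1 : ∀ᶠ t in nhds (0 : ℝ), Z t ∈ Metric.ball P r :=
      hZc.continuousAt.eventually (Metric.isOpen_ball.mem_nhds (by rw [hZ0]; simpa))
    have h2 : ∀ᶠ t in nhds (0 : ℝ), Z t ∈ Metric.ball b δ :=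
      hZc.continuousAt.eventually (Metric.isOpen_ball.mem_nhds (by rw [hZ0]; exact hPb))
    filter_upwards [h1, h2] with t ht1 ht2
    refine h _ ht2 ((mem_frontier_iff_graph hΩ hN1 hG.continuous hgraph ht1).2 ?_)
    rw [inner_framePt hN1, inner_rot_framePt hN1]
  have hGd : HasDerivAt G 0 0 := by simpa [hG0'] using (hG 0).hasDerivAt
  have lin : ∀ u : Plane, HasDerivAt (fun t => inner ℝ u (Z t - p)) (inner ℝ u (rot N)) 0 := by
    intro u
    have e : ∀ t, inner ℝ u (Z t - p) =
        inner ℝ u (P - p) + (t * inner ℝ u (rot N) + G t * inner ℝ u N) := by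
      intro t
      simp only [hZ, framePt]
      rw [add_sub_right_comm, inner_add_right, inner_add_right, inner_smul_right,
        inner_smul_right]
    simp only [e]
    refine ((((hasDerivAt_id (0 : ℝ)).mul_const (inner ℝ u (rot N))).add
      (hGd.mul_const (inner ℝ u N))).const_add (inner ℝ u (P - p))).congr_deriv ?_
    simp
  have d1 := lin n
  have hgd : HasDerivAt g (deriv g (inner ℝ (rot n) (P - p))) (inner ℝ (rot n) (Z 0 - p)) := by
    rw [hZ0]; exact (hg _).hasDerivAt
  have d2 := hgd.comp (0 : ℝ) (lin (rot n))
  have := d1.unique (d2.congr_of_eventuallyEq ev)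
  rw [inner_rot_rot, inner_rot] at this
  linarith

/-- The foot `P` on `Γ` of the perpendicular through the mid-point of a short chord `[b, c]`. -/
lemma exists_closestIntersection {Ω : Set Plane} (hΩ : IsC11Domain Ω) {ε : ℝ} (hε : 0 < ε) :
    ∃ h > 0, ∀ b ∈ frontier Ω, ∀ c ∈ frontier Ω, b ≠ c → dist b c ≤ h →
      ∃ P n : Plane, IsClosestIntersection (frontier Ω) b c P ∧
        (∀ Q, IsClosestIntersection (frontier Ω) b c Q → Q = P) ∧
        dist P (midpoint ℝ b c) ≤ ε * dist b c ∧ IsOuterUnitNormal Ω P n ∧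
        (∀ n', IsOuterUnitNormal Ω P n' → ∃ k : ℝ, n' = k • n) ∧
        |inner ℝ n (c - b)| ≤ ε * dist b c := by
  -- The final errors are at most `2 * ε' * |Δ|`, whence ε/2; the bound 1/2 keeps the points inside
  -- the chart and makes the uniqueness argument a contraction.
  set ε' := min (ε / 2) (1 / 2) with hε'
  have hε'0 : 0 < ε' := lt_min (by linarith) (by norm_num)
  have hε'1 : ε' ≤ ε / 2 := min_le_left _ _
  have hε'2 : ε' ≤ 1 / 2 := min_le_right _ _
  obtain ⟨δ, hδ, chart⟩ := exists_uniform_chart hΩ hε'0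
  refine ⟨δ / 4, by positivity, fun b hb c hc hbc hdist => ?_⟩
  obtain ⟨p, n, g, ρ, hn, hg, hd, hchart⟩ := chart b hb
  set S : Plane → ℝ := fun x => inner ℝ (rot n) (x - p) with hS
  set Y : Plane → ℝ := fun x => inner ℝ n (x - p) with hY
  have subS : ∀ x y, inner ℝ (rot n) (x - y) = S x - S y := fun x y => by
    simp only [hS, ← inner_sub_right]; congr 1; abel
  have subY : ∀ x y, inner ℝ n (x - y) = Y x - Y y := fun x y => by
    simp only [hY, ← inner_sub_right]; congr 1; abel
  have distle : ∀ x y, dist x y ≤ |S x - S y| + |Y x - Y y| := fun x y => by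
    rw [dist_eq_norm, ← subS, ← subY]; exact frame_norm_le hn _
  have Sle : ∀ x y, |S x - S y| ≤ dist x y := fun x y => by
    rw [dist_eq_norm, ← subS]; exact abs_inner_le (norm_rot hn) _
  have innerSY : ∀ x y z w, inner ℝ (x - y) (z - w) =
      (S x - S y) * (S z - S w) + (Y x - Y y) * (Y z - Y w) := fun x y z w => by
    rw [frame_inner hn, subS, subS, subY, subY]
  have hlip : ∀ s t, |s| < ρ → |t| < ρ → |g t - g s| ≤ ε' * |t - s| := by
    intro s t hs ht
    have := (convex_Ioo (-ρ) ρ).norm_image_sub_le_of_norm_deriv_le (f := g) (C := ε')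
      (fun x _ => hg x) (fun x hx => hd x (abs_lt.2 hx)) (abs_lt.1 hs) (abs_lt.1 ht)
    simpa [Real.norm_eq_abs] using this
  have hbB : b ∈ Metric.ball b δ := Metric.mem_ball_self hδ
  have hcB : c ∈ Metric.ball b δ := by rw [Metric.mem_ball, dist_comm]; linarith
  have Yb : Y b = g (S b) := (hchart b hbB).2.1 hb
  have Yc : Y c = g (S c) := (hchart c hcB).2.1 hc
  have Sb : |S b| < ρ := (hchart b hbB).1
  have Sc : |S c| < ρ := (hchart c hcB).1
  set Δ := S c - S b with hΔ
  set E := Y c - Y b with hE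
  have hEΔ : |E| ≤ ε' * |Δ| := by rw [hE, Yb, Yc]; exact hlip _ _ Sb Sc
  have hΔd : |Δ| ≤ dist b c := by rw [dist_comm]; exact Sle c b
  have hΔ0 : 0 < |Δ| := by
    by_contra hcon
    have h0 : |Δ| = 0 := le_antisymm (not_lt.1 hcon) (abs_nonneg _)
    rw [h0, mul_zero] at hEΔ
    have := distle c b
    rw [← hΔ, ← hE, h0] at this
    exact hbc (dist_le_zero.1 (by linarith)).symm
  set m := midpoint ℝ b c with hm
  have affine_mid : ∀ u : Plane, inner ℝ u (m - p) =
      (inner ℝ u (b - p) + inner ℝ u (c - p)) / 2 := by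
    intro u
    simp only [inner_plane, PiLp.sub_apply, hm, midpoint_apply]; ring
  have Sm : S m = (S b + S c) / 2 := affine_mid _
  have Ym : Y m = (Y b + Y c) / 2 := affine_mid _
  -- the intersection point
  set k : ℝ → ℝ := fun s => (s - S m) * Δ + (g s - Y m) * E with hk
  have hkc : Continuous k := by have := hg.continuous; simp only [hk]; fun_prop
  -- `k s` is the inner product with `c - b` of the vector from the mid-point to the graph point
  -- over `s`. At the ends it equals ∓|c − b|²/2, so it has a zero in between.
  have kb : k (S b) = -((Δ ^ 2 + E ^ 2) / 2) := by
    simp only [hk, Sm, Ym, ← Yb, hΔ, hE]; ring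
  have kc : k (S c) = (Δ ^ 2 + E ^ 2) / 2 := by
    simp only [hk, Sm, Ym, ← Yc, hΔ, hE]; ring
  obtain ⟨s, hs, hks⟩ : ∃ s ∈ Set.uIcc (S b) (S c), k s = 0 := by
    have := intermediate_value_uIcc (f := k) (a := S b) (b := S c) hkc.continuousOn
    have h0 : (0 : ℝ) ∈ Set.uIcc (k (S b)) (k (S c)) := by
      rw [kb, kc, Set.mem_uIcc]; left
      constructor <;> nlinarith [sq_nonneg Δ, sq_nonneg E]
    exact this h0
  have hsρ : |s| < ρ := by
    rw [abs_lt] at Sb Sc ⊢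
    exact (Set.ordConnected_Ioo.uIcc_subset Sb Sc) hs
  have hsb : |s - S b| ≤ |Δ| := Set.abs_sub_left_of_mem_uIcc hs
  have hsc : |s - S c| ≤ |Δ| := by
    rw [abs_sub_comm]; exact Set.abs_sub_right_of_mem_uIcc hs
  set P := framePt p n s (g s) with hP
  have SP : S P = s := inner_rot_framePt hn p s (g s)
  have YP : Y P = g s := inner_framePt hn p s (g s)
  have hPB : P ∈ Metric.ball b δ := by
    rw [Metric.mem_ball]
    have h1 := distle P b
    rw [SP, YP, Yb] at h1
    have h2 := hlip _ _ Sb hsρ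
    have h3 := mul_le_mul hε'2 hsb (abs_nonneg _) (by norm_num)
    linarith
  have hPΓ : P ∈ frontier Ω := (hchart P hPB).2.2 (by
    change Y P = g (S P); rw [SP, YP])
  set y := g s - Y m with hy
  have hyΔ : |y| ≤ ε' * |Δ| := by
    have e : y = ((g s - g (S b)) + (g s - g (S c))) / 2 := by rw [hy, Ym, Yb, Yc]; ring
    have h1 := hlip _ _ Sb hsρ
    have h2 := hlip _ _ Sc hsρ
    rw [e, abs_div, abs_two, div_le_iff₀ two_pos]
    refine (abs_add_le _ _).trans ?_
    have h3 := mul_le_mul_of_nonneg_left hsb hε'0.le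
    have h4 := mul_le_mul_of_nonneg_left hsc hε'0.le
    linarith
  -- The perpendicular is nearly vertical in the chart, so the horizontal offset of `P` is smaller
  -- than the vertical one.
  have hσ : |s - S m| ≤ ε' * |y| := by
    have e : (s - S m) * Δ = -(y * E) := by linarith [hks]
    have e2 : |s - S m| * |Δ| = |y| * |E| := by rw [← abs_mul, e, abs_neg, abs_mul]
    have e3 : |s - S m| * |Δ| ≤ (ε' * |y|) * |Δ| := by
      rw [e2, mul_right_comm, mul_comm (ε' * |Δ|)]
      exact mul_le_mul_of_nonneg_left hEΔ (abs_nonneg y)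
    exact le_of_mul_le_mul_right e3 hΔ0
  have hPm : dist P m ≤ 2 * ε' * |Δ| := by
    have := distle P m
    rw [SP, YP] at this
    have h1 := mul_le_mul_of_nonneg_right hε'2 (abs_nonneg y)
    linarith [abs_nonneg y]
  have hεd : 2 * ε' * |Δ| ≤ ε * dist b c :=
    mul_le_mul (by linarith) hΔd (abs_nonneg _) hε.le
  have hPperp : inner ℝ (P - m) (c - b) = 0 := by
    rw [innerSY, SP, YP]; exact hks
  have hdm : dist b m = dist b c / 2 := by
    rw [hm, dist_left_midpoint]; norm_num; ring
  -- A competitor no farther than `P` is still in the chart. Both points being on the graph and on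
  -- the perpendicular, their abscissae satisfy |S Q − s| ≤ ε'²|S Q − s|, so they coincide.
  have hunique : ∀ Q ∈ frontier Ω, inner ℝ (Q - m) (c - b) = 0 → dist m Q ≤ dist m P → Q = P := by
    intro Q hQ hQp hQd
    have hQB : Q ∈ Metric.ball b δ := by
      rw [Metric.mem_ball, dist_comm]
      have := dist_triangle b m Q
      rw [dist_comm m P] at hQd
      have h1 : 2 * ε' * |Δ| ≤ 1 * |Δ| := mul_le_mul_of_nonneg_right (by linarith) hΔ0.le
      linarith
    have YQ : Y Q = g (S Q) := (hchart Q hQB).2.1 hQ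
    have SQ : |S Q| < ρ := (hchart Q hQB).1
    rw [innerSY, YQ] at hQp
    have e : (S Q - s) * Δ = -((g (S Q) - g s) * E) := by
      have : (s - S m) * Δ + (g s - Y m) * E = 0 := hks
      linear_combination hQp - this
    have e2 : |S Q - s| * |Δ| = |g (S Q) - g s| * |E| := by
      rw [← abs_mul, e, abs_neg, abs_mul]
    have l := hlip _ _ hsρ SQ
    have hz : |S Q - s| = 0 := by
      by_contra hcon
      have hpos : 0 < |S Q - s| := lt_of_le_of_ne (abs_nonneg _) (Ne.symm hcon)
      have h1 : |g (S Q) - g s| * |E| ≤ (ε' * |S Q - s|) * (ε' * |Δ|) :=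
        mul_le_mul l hEΔ (abs_nonneg _) (by positivity)
      have h2 : (ε' * |S Q - s|) * (ε' * |Δ|) = (ε' * ε') * (|S Q - s| * |Δ|) := by ring
      have h3 : 0 < |S Q - s| * |Δ| := by positivity
      have h4 : ε' * ε' ≤ 1 / 2 * (1 / 2) := mul_le_mul hε'2 hε'2 hε'0.le (by norm_num)
      have h5 := mul_le_mul_of_nonneg_right h4 h3.le
      linarith
    have hSQ : S Q = s := by rwa [abs_eq_zero, sub_eq_zero] at hz
    calc Q = framePt p n (S Q) (Y Q) := (framePt_inner hn p Q).symm
      _ = P := by rw [YQ, hSQ]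
  have hclosest : IsClosestIntersection (frontier Ω) b c P := by
    refine ⟨hPΓ, hPperp, fun Q hQ hQp => ?_⟩
    by_contra hcon
    have := hunique Q hQ hQp (not_le.1 hcon).le
    rw [this] at hcon
    exact hcon le_rfl
  obtain ⟨n₀, hn₀⟩ := hΩ.exists_normal P hPΓ
  have slope : ∀ N, IsOuterUnitNormal Ω P N →
      inner ℝ (rot n) N = -(deriv g s * inner ℝ n N) := by
    intro N hN
    have := hN.slope hΩ.isOpen hg hPB (fun x hx hxf => (hchart x hx).2.1 hxf)
    change _ = -(deriv g (S P) * _) at this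
    rwa [SP] at this
  -- Every unit normal at `P` is a multiple of the graph normal `n - deriv g s • rot n`. This yields
  -- both the parallelism of normals and the smallness of their component along the chord.
  have expand : ∀ N, IsOuterUnitNormal Ω P N →
      N = inner ℝ n N • (n - deriv g s • rot n) := by
    intro N hN
    nth_rw 1 [frame_decomp hn N]
    rw [slope N hN]
    module
  refine ⟨P, n₀, hclosest, fun Q hQ => hunique Q hQ.1 hQ.2.1 (hQ.2.2 P hPΓ hPperp),
    hPm.trans hεd, hn₀, ?_, ?_⟩
  · intro n' hn'
    have hne : inner ℝ n n₀ ≠ 0 := by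
      intro h0
      have := expand n₀ hn₀
      rw [h0, zero_smul] at this
      have h1 := hn₀.1
      rw [this, norm_zero] at h1
      exact zero_ne_one h1
    refine ⟨inner ℝ n n' / inner ℝ n n₀, ?_⟩
    have e₀ := congrArg (fun z => (inner ℝ n n' / inner ℝ n n₀) • z) (expand n₀ hn₀)
    simp only [smul_smul, div_mul_cancel₀ _ hne] at e₀
    rw [e₀]
    exact expand n' hn'
  · rw [frame_inner hn, slope n₀ hn₀, subS, subY, ← hΔ, ← hE,
      show -(deriv g s * inner ℝ n n₀) * Δ + inner ℝ n n₀ * E =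
        inner ℝ n n₀ * (E - deriv g s * Δ) by ring, abs_mul]
    have h1 : |inner ℝ n n₀| ≤ 1 := (abs_inner_le hn n₀).trans_eq hn₀.1
    have h2 : |E - deriv g s * Δ| ≤ 2 * ε' * |Δ| := by
      refine (abs_sub _ _).trans ?_
      rw [abs_mul]
      have h3 := mul_le_mul_of_nonneg_right (hd s hsρ) (abs_nonneg Δ)
      linarith
    calc |inner ℝ n n₀| * |E - deriv g s * Δ| ≤ 1 * |E - deriv g s * Δ| :=
          mul_le_mul_of_nonneg_right h1 (abs_nonneg _)
      _ ≤ ε * dist b c := by rw [one_mul]; exact h2.trans hεd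


/-! ### The bubble function attached to a boundary edge -/

lemma val_mul (p q : Poly) (x : Plane) : val (p * q) x = val p x * val q x := by simp [val]
lemma val_sub (p q : Poly) (x : Plane) : val (p - q) x = val p x - val q x := by simp [val]
lemma grad_sub (p q : Poly) (x : Plane) : grad (p - q) x = grad p x - grad q x := by
  ext i; simp [grad, val]

lemma grad_mul (p q : Poly) (x : Plane) :
    grad (p * q) x = val p x • grad q x + val q x • grad p x := by
  ext i; simp [grad, val, Derivation.leibniz]

lemma hess_add (p q : Poly) (i j : Fin 2) (x : Plane) :
    hess (p + q) i j x = hess p i j x + hess q i j x := by simp [hess, val]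

lemma hess_sub (p q : Poly) (i j : Fin 2) (x : Plane) :
    hess (p - q) i j x = hess p i j x - hess q i j x := by simp [hess, val]

lemma hess_smul (t : ℝ) (p : Poly) (i j : Fin 2) (x : Plane) :
    hess (t • p) i j x = t * hess p i j x := by simp [hess, val]

lemma hess_mul (p q : Poly) (i j : Fin 2) (x : Plane) :
    hess (p * q) i j x = val p x * hess q i j x + val q x * hess p i j x
      + grad p x i * grad q x j + grad p x j * grad q x i := by
  simp [hess, grad, val, Derivation.leibniz]; ring

/-- C¹ matching along a line amounts to divisibility of the difference by the square of the equation
of the line. -/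
lemma eq_of_sub_eq_sq_mul {p q d m : Poly} (h : p - q = d ^ 2 * m) {x : Plane}
    (hd : val d x = 0) : val p x = val q x ∧ grad p x = grad q x := by
  constructor
  · rw [← sub_eq_zero, ← val_sub, h, sq, val_mul, val_mul, hd]; ring
  · rw [← sub_eq_zero, ← grad_sub, h, sq, grad_mul, grad_mul, val_mul, hd]; simp

/-- The barycentric coordinate of the vertex `a` in the triangle `a b c`. -/
def bary (a b c : Plane) : Poly :=
  cubic ![(b 0 * c 1 - b 1 * c 0) / tdet a b c, (b 1 - c 1) / tdet a b c,
    (c 0 - b 0) / tdet a b c, 0, 0, 0, 0, 0, 0, 0]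

lemma isAffPoly_bary (a b c : Plane) : IsAffPoly (bary a b c) := ⟨_, _, _, rfl⟩

lemma val_bary (a b c x : Plane) : val (bary a b c) x = tdet x b c / tdet a b c := by
  simp only [bary, val_cubic, Matrix.cons_val]
  simp only [tdet]; ring

lemma val_bary_add {a b c : Plane} (h : tdet a b c ≠ 0) (x : Plane) :
    val (bary a b c) x + val (bary b c a) x + val (bary c a b) x = 1 := by
  simp only [val_bary, tdet_rotate b c a, tdet_rotate a b c]
  field_simp
  simp only [tdet]; ring

lemma grad_bary (a b c x : Plane) : grad (bary a b c) x =
    !₂[(b 1 - c 1) / tdet a b c, (c 0 - b 0) / tdet a b c] := by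
  apply plane_ext
  · simp [bary, grad_cubic_zero]
  · simp [bary, grad_cubic_one]

lemma IsAffPoly.hess_eq {p : Poly} (hp : IsAffPoly p) (i j : Fin 2) (x : Plane) :
    hess p i j x = 0 := by
  obtain ⟨α, β, γ, rfl⟩ := hp
  fin_cases i <;> fin_cases j <;>
  simp [hess_cubic_zero_zero, hess_cubic_zero_one, hess_cubic_one_zero, hess_cubic_one_one]

lemma IsAffPoly.val_sub_val {p : Poly} (hp : IsAffPoly p) (x y z : Plane) :
    val p x - val p y = inner ℝ (grad p z) (x - y) := by
  obtain ⟨α, β, γ, rfl⟩ := hp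
  simp [val_cubic, grad_cubic_zero, grad_cubic_one, inner_plane]; ring

lemma totalDegree_mul_le' {p q : Poly} {m n : ℕ} (hp : p.totalDegree ≤ m)
    (hq : q.totalDegree ≤ n) : (p * q).totalDegree ≤ m + n :=
  (MvPolynomial.totalDegree_mul _ _).trans (add_le_add hp hq)

lemma IsAffPoly.totalDegree_le {p : Poly} (hp : IsAffPoly p) : p.totalDegree ≤ 1 := by
  obtain ⟨α, β, γ, rfl⟩ := hp
  have e : cubic ![α, β, γ, 0, 0, 0, 0, 0, 0, 0] = MvPolynomial.C α +
      MvPolynomial.C β * MvPolynomial.X 0 + MvPolynomial.C γ * MvPolynomial.X 1 := by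
    simp [cubic]
  rw [e]
  have hX : ∀ (r : ℝ) (i : Fin 2), (MvPolynomial.C r * MvPolynomial.X i : Poly).totalDegree ≤ 1 :=
    fun r i => by
      simpa using totalDegree_mul_le' (MvPolynomial.totalDegree_C (σ := Fin 2) r).le
        (MvPolynomial.totalDegree_X (R := ℝ) i).le
  refine (MvPolynomial.totalDegree_add _ _).trans (max_le ?_ (hX γ 1))
  exact (MvPolynomial.totalDegree_add _ _).trans
    (max_le ((MvPolynomial.totalDegree_C (σ := Fin 2) α).le.trans zero_le_one) (hX β 0))

/-- The bubble in the sub-triangle adjacent to the edge, in barycentric coordinates. -/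
def bubbleA (x y z : Poly) : Poly :=
  (6 : ℝ) • (x * y * z) + (2 : ℝ) • (x * x * x) - (3 : ℝ) • (x * x * y) - (3 : ℝ) • (x * x * z)

/-- The bubble in the other sub-triangles, in barycentric coordinates. -/
def bubbleB (y z : Poly) : Poly := (3 : ℝ) • (y * y * z) - y * y * y

/-- Sub-triangles of a Clough–Tocher split meet where two barycentric coordinates are equal; the
coefficients of the bubble are such that the square of their difference factors out. The same holds
in `bubbleB_sub_bubbleB`. -/
lemma bubbleA_sub_bubbleB (x y z : Poly) :
    bubbleA x y z - bubbleB y z = (x - y) ^ 2 * (2 * x + y - 3 * z) := by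
  simp only [bubbleA, bubbleB, MvPolynomial.smul_eq_C_mul, map_ofNat]; ring

lemma bubbleB_sub_bubbleB (y z : Poly) :
    bubbleB y z - bubbleB z y = (y - z) ^ 2 * (z - y) := by
  simp only [bubbleB, MvPolynomial.smul_eq_C_mul, map_ofNat]; ring

lemma bubbleA_swap (x y z : Poly) : bubbleA x z y = bubbleA x y z := by
  simp only [bubbleA, MvPolynomial.smul_eq_C_mul, map_ofNat]; ring

section
variable {x y z : Poly}

lemma totalDegree_mul3 (hx : IsAffPoly x) (hy : IsAffPoly y) (hz : IsAffPoly z) :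
    (x * y * z).totalDegree ≤ 3 :=
  totalDegree_mul_le' (totalDegree_mul_le' hx.totalDegree_le hy.totalDegree_le) hz.totalDegree_le

lemma totalDegree_smul_le' (t : ℝ) {p : Poly} (hp : p.totalDegree ≤ 3) :
    (t • p).totalDegree ≤ 3 := (MvPolynomial.totalDegree_smul_le _ _).trans hp

lemma totalDegree_sub_le' {p q : Poly} (hp : p.totalDegree ≤ 3) (hq : q.totalDegree ≤ 3) :
    (p - q).totalDegree ≤ 3 := (MvPolynomial.totalDegree_sub _ _).trans (max_le hp hq)

lemma totalDegree_bubbleA (hx : IsAffPoly x) (hy : IsAffPoly y) (hz : IsAffPoly z) :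
    (bubbleA x y z).totalDegree ≤ 3 := by
  refine totalDegree_sub_le' (totalDegree_sub_le' ((MvPolynomial.totalDegree_add _ _).trans
    (max_le ?_ ?_)) ?_) ?_ <;> refine totalDegree_smul_le' _ (totalDegree_mul3 ?_ ?_ ?_) <;>
    assumption

lemma totalDegree_bubbleB (hy : IsAffPoly y) (hz : IsAffPoly z) :
    (bubbleB y z).totalDegree ≤ 3 :=
  totalDegree_sub_le' (totalDegree_smul_le' _ (totalDegree_mul3 hy hy hz))
    (totalDegree_mul3 hy hy hy)

lemma val_bubbleA {P : Plane} (h : val x P = 0) : val (bubbleA x y z) P = 0 := by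
  simp [bubbleA, val_sub, val_add, val_mul, val_smul, h]

lemma grad_bubbleA {P : Plane} (h : val x P = 0) :
    grad (bubbleA x y z) P = (6 * (val y P * val z P)) • grad x P := by
  simp only [bubbleA, grad_sub, grad_add, grad_mul, val_mul, grad_smul, h]
  module

lemma val_bubbleB {P : Plane} (h : val y P = 0) : val (bubbleB y z) P = 0 := by
  simp [bubbleB, val_sub, val_mul, val_smul, h]

lemma grad_bubbleB {P : Plane} (h : val y P = 0) : grad (bubbleB y z) P = 0 := by
  simp only [bubbleB, grad_sub, grad_mul, val_mul, grad_smul, h]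
  module

lemma abs_hess_mul3_le (hx : IsAffPoly x) (hy : IsAffPoly y) (hz : IsAffPoly z) {P : Plane}
    {g : ℝ} (vx : |val x P| ≤ 1) (vy : |val y P| ≤ 1) (vz : |val z P| ≤ 1)
    (gx : ‖grad x P‖ ≤ g) (gy : ‖grad y P‖ ≤ g) (gz : ‖grad z P‖ ≤ g) (i j : Fin 2) :
    |hess (x * y * z) i j P| ≤ 6 * g ^ 2 := by
  have hg : 0 ≤ g := (norm_nonneg _).trans gx
  have comp : ∀ (u : Plane), ‖u‖ ≤ g → ∀ k, |u k| ≤ g := fun u hu k =>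
    (PiLp.norm_apply_le u k).trans hu
  have prod : ∀ u v w : ℝ, |u| ≤ 1 → |v| ≤ g → |w| ≤ g → |u * (v * w)| ≤ g ^ 2 := by
    intro u v w hu hv hw
    rw [abs_mul, abs_mul]
    calc |u| * (|v| * |w|) ≤ 1 * (g * g) := by gcongr
      _ = g ^ 2 := by ring
  have e : hess (x * y * z) i j P =
      val z P * (grad x P i * grad y P j) + val z P * (grad x P j * grad y P i)
      + val y P * (grad x P i * grad z P j) + val y P * (grad x P j * grad z P i)
      + val x P * (grad y P i * grad z P j) + val x P * (grad y P j * grad z P i) := by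
    rw [hess_mul, hess_mul, hx.hess_eq, hy.hess_eq, hz.hess_eq, grad_mul]
    simp only [PiLp.add_apply, PiLp.smul_apply, smul_eq_mul]
    ring
  rw [e]
  have a1 := prod _ _ _ vz (comp _ gx i) (comp _ gy j)
  have a2 := prod _ _ _ vz (comp _ gx j) (comp _ gy i)
  have a3 := prod _ _ _ vy (comp _ gx i) (comp _ gz j)
  have a4 := prod _ _ _ vy (comp _ gx j) (comp _ gz i)
  have a5 := prod _ _ _ vx (comp _ gy i) (comp _ gz j)
  have a6 := prod _ _ _ vx (comp _ gy j) (comp _ gz i)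
  rw [abs_le] at *
  constructor <;> linarith

lemma hessSq_le {p : Poly} {P : Plane} {r : ℝ} (h : ∀ i j, |hess p i j P| ≤ r) :
    hessSq p P ≤ 4 * r ^ 2 := by
  have k : ∀ i j, hess p i j P ^ 2 ≤ r ^ 2 := fun i j =>
    sq_le_sq' (abs_le.1 (h i j)).1 (abs_le.1 (h i j)).2
  rw [hessSq_eq]
  linarith [k 0 0, k 0 1, k 1 1]

/-- Here 84 = 6 · (6 + 2 + 3 + 3): six product-rule terms for each cubic monomial, weighted by the
coefficients of the bubble. `bubbleB` needs only 6 · (3 + 1), and the same constant is kept. -/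
lemma hessSq_bubbleA_le (hx : IsAffPoly x) (hy : IsAffPoly y) (hz : IsAffPoly z) {P : Plane}
    {g : ℝ} (vx : |val x P| ≤ 1) (vy : |val y P| ≤ 1) (vz : |val z P| ≤ 1)
    (gx : ‖grad x P‖ ≤ g) (gy : ‖grad y P‖ ≤ g) (gz : ‖grad z P‖ ≤ g) :
    hessSq (bubbleA x y z) P ≤ 4 * (84 * g ^ 2) ^ 2 := by
  refine hessSq_le fun i j => ?_
  have h1 := abs_hess_mul3_le hx hy hz vx vy vz gx gy gz i j
  have h2 := abs_hess_mul3_le hx hx hx vx vx vx gx gx gx i j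
  have h3 := abs_hess_mul3_le hx hx hy vx vx vy gx gx gy i j
  have h4 := abs_hess_mul3_le hx hx hz vx vx vz gx gx gz i j
  simp only [bubbleA, hess_sub, hess_add, hess_smul]
  rw [abs_le] at *
  constructor <;> linarith

lemma hessSq_bubbleB_le (hy : IsAffPoly y) (hz : IsAffPoly z) {P : Plane}
    {g : ℝ} (vy : |val y P| ≤ 1) (vz : |val z P| ≤ 1)
    (gy : ‖grad y P‖ ≤ g) (gz : ‖grad z P‖ ≤ g) :
    hessSq (bubbleB y z) P ≤ 4 * (84 * g ^ 2) ^ 2 := by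
  refine hessSq_le fun i j => ?_
  have h1 := abs_hess_mul3_le hy hy hz vy vy vz gy gy gz i j
  have h2 := abs_hess_mul3_le hy hy hy vy vy vy gy gy gy i j
  simp only [bubbleB, hess_sub, hess_smul]
  have := sq_nonneg g
  rw [abs_le] at *
  constructor <;> linarith

end

lemma bary_of_mem_hull {a b c x : Plane} (h : tdet a b c ≠ 0)
    (hx : x ∈ convexHull ℝ ({a, b, c} : Set Plane)) :
    0 ≤ val (bary a b c) x ∧ 0 ≤ val (bary b c a) x ∧ 0 ≤ val (bary c a b) x := by
  obtain ⟨s, t, hs, ht, hst, rfl⟩ := mem_convexHull_triple.1 hx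
  have e1 : val (bary a b c) (a + s • (b - a) + t • (c - a)) = 1 - s - t := by
    rw [val_bary, div_eq_iff h]; simp [tdet]; ring
  have e2 : val (bary b c a) (a + s • (b - a) + t • (c - a)) = s := by
    rw [val_bary, tdet_rotate a b c, div_eq_iff h]; simp [tdet]; ring
  have e3 : val (bary c a b) (a + s • (b - a) + t • (c - a)) = t := by
    rw [val_bary, tdet_rotate b c a, tdet_rotate a b c, div_eq_iff h]; simp [tdet]; ring
  rw [e1, e2, e3]
  exact ⟨by linarith, hs, ht⟩

/-- In the sub-triangle opposite `a` the coordinate of `a` is the smallest one; hence a point common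
to two sub-triangles has two equal coordinates. -/
lemma bary_of_mem_subtriangle {a b c x : Plane} (h : tdet a b c ≠ 0)
    (hx : x ∈ convexHull ℝ ({centroid3 a b c, b, c} : Set Plane)) :
    0 ≤ val (bary a b c) x ∧ val (bary a b c) x ≤ val (bary b c a) x ∧
      val (bary a b c) x ≤ val (bary c a b) x := by
  obtain ⟨s, t, hs, ht, hst, rfl⟩ := mem_convexHull_triple.1 hx
  set G := centroid3 a b c with hG
  have e1 : val (bary a b c) (G + s • (b - G) + t • (c - G)) = (1 - s - t) / 3 := by
    rw [val_bary, div_eq_iff h]; simp [tdet, hG, centroid3_apply]; ring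
  have e2 : val (bary b c a) (G + s • (b - G) + t • (c - G)) = (1 - s - t) / 3 + s := by
    rw [val_bary, tdet_rotate a b c, div_eq_iff h]; simp [tdet, hG, centroid3_apply]; ring
  have e3 : val (bary c a b) (G + s • (b - G) + t • (c - G)) = (1 - s - t) / 3 + t := by
    rw [val_bary, tdet_rotate b c a, tdet_rotate a b c, div_eq_iff h]
    simp [tdet, hG, centroid3_apply]; ring
  rw [e1, e2, e3]
  refine ⟨?_, ?_, ?_⟩ <;> linarith

lemma bary_eq_zero_of_mem_segment {a b c x : Plane}
    (hx : x ∈ convexHull ℝ ({b, c} : Set Plane)) : val (bary a b c) x = 0 := by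
  rw [convexHull_pair] at hx
  obtain ⟨α, β, -, -, hαβ, rfl⟩ := hx
  obtain rfl : α = 1 - β := by linarith
  rw [val_bary, div_eq_zero_iff]
  left
  simp [tdet]; ring

namespace Triangulation
variable {M : Triangulation}

open Classical in
/-- The `C¹` piecewise cubic supported in the triangle `a b c`, whose only non vanishing degree of
freedom is the normal derivative at the mid-point of `[b, c]`. -/
def bubble (M : Triangulation) (T : Finset Plane) (a b c : Plane) : M.PiecewisePoly := fun K =>
  if K.1.1 = T then
    if K.1.2 = a then bubbleA (bary a b c) (bary b c a) (bary c a b)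
    else if K.1.2 = b then bubbleB (bary b c a) (bary c a b)
    else bubbleB (bary c a b) (bary b c a)
  else 0

variable {T : Finset Plane} {a b c : Plane}

lemma bubble_of_ne {K : M.pieces} (h : K.1.1 ≠ T) : M.bubble T a b c K = 0 := by
  simp [bubble, h]

/-- The three sub-triangles of `T`, with the values of the bubble. -/
lemma IsTriple.bubble_cases (ht : IsTriple T a b c) {K : M.pieces} (h : K.1.1 = T) :
    (IsTriple K.1.1 K.1.2 b c ∧ K.1.2 = a ∧
      M.bubble T a b c K = bubbleA (bary a b c) (bary b c a) (bary c a b)) ∨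
    (IsTriple K.1.1 K.1.2 c a ∧ K.1.2 = b ∧
      M.bubble T a b c K = bubbleB (bary b c a) (bary c a b)) ∨
    (IsTriple K.1.1 K.1.2 a b ∧ K.1.2 = c ∧
      M.bubble T a b c K = bubbleB (bary c a b) (bary b c a)) := by
  have hK := (piece_mem K).2
  rw [h, ht.eq] at hK
  simp only [Finset.mem_insert, Finset.mem_singleton] at hK
  rcases hK with hK | hK | hK
  · left; rw [hK, h]; exact ⟨ht, rfl, by simp [bubble, h, hK]⟩
  · right; left; rw [hK, h]; exact ⟨ht.rotate, rfl, by simp [bubble, h, hK, ht.ab.symm]⟩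
  · right; right; rw [hK, h]
    exact ⟨ht.rotate.rotate, rfl, by simp [bubble, h, hK, ht.ac.symm, ht.bc.symm]⟩

lemma region_subset (K : M.pieces) : region K ⊆ convexHull ℝ (K.1.1 : Set Plane) := by
  obtain ⟨b, c, ht⟩ := exists_isTriple_piece K
  rw [ht.region_eq, ht.coe]
  refine convexHull_min ?_ (convex_convexHull ℝ _)
  rintro x (rfl | rfl | rfl)
  · refine mem_convexHull_triple.2 ⟨1 / 3, 1 / 3, by norm_num, by norm_num, by norm_num, ?_⟩
    rw [centroid3]; module
  · exact subset_convexHull _ _ (by simp)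
  · exact subset_convexHull _ _ (by simp)

lemma IsTriple.bary_of_mem_region {K : M.pieces} (ht : IsTriple K.1.1 K.1.2 b c) {x : Plane}
    (hx : x ∈ region K) : 0 ≤ val (bary K.1.2 b c) x ∧
      val (bary K.1.2 b c) x ≤ val (bary b c K.1.2) x ∧
      val (bary K.1.2 b c) x ≤ val (bary c K.1.2 b) x :=
  bary_of_mem_subtriangle (ht.tdet_ne_zero (piece_mem K).1) (ht.region_eq ▸ hx)

/-- On the two sides other than `[b, c]` the smallest coordinate vanishes. Pieces of type B have a
double zero there; on the piece of type A the gradient 6 λ_b λ_c ∇λ_a vanishes, as λ_b or λ_c is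
zero. -/
lemma IsTriple.bubble_zero (ht : IsTriple T a b c) {K : M.pieces} (hK : K.1.1 = T) {x : Plane}
    (hx : x ∈ region K) (h : val (bary b c a) x = 0 ∨ val (bary c a b) x = 0) :
    val (M.bubble T a b c K) x = 0 ∧ grad (M.bubble T a b c K) x = 0 := by
  rcases ht.bubble_cases hK with ⟨hk, ha, e⟩ | ⟨hk, ha, e⟩ | ⟨hk, ha, e⟩ <;>
  · have hb := hk.bary_of_mem_region hx
    rw [ha] at hb
    rw [e]
    first
    | have h0 : val (bary a b c) x = 0 := by rcases h with h | h <;> linarith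
      refine ⟨val_bubbleA h0, ?_⟩
      rw [grad_bubbleA h0]
      rcases h with h | h <;> simp [h]
    | have h0 : val (bary b c a) x = 0 := by rcases h with h | h <;> linarith
      exact ⟨val_bubbleB h0, grad_bubbleB h0⟩
    | have h0 : val (bary c a b) x = 0 := by rcases h with h | h <;> linarith
      exact ⟨val_bubbleB h0, grad_bubbleB h0⟩

/-- No other triangle contains both `b` and `c`, so by conformity it meets `T` only in points
spanned by vertices missing `b` or `c`. -/
lemma IsTriple.bary_zero_of_mem_hull (ht : IsTriple T a b c) (hB : M.IsBoundaryEdge T a)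
    {T' : Finset Plane} (hT' : T' ∈ M.tri) (hne : T' ≠ T) {x : Plane}
    (hx : x ∈ convexHull ℝ (T : Set Plane)) (hx' : x ∈ convexHull ℝ (T' : Set Plane)) :
    val (bary b c a) x = 0 ∨ val (bary c a b) x = 0 := by
  have hmem : x ∈ convexHull ℝ ((T : Set Plane) ∩ (T' : Set Plane)) :=
    M.conforming T hB.1 T' hT' ▸ ⟨hx, hx'⟩
  have hnot : ¬ (b ∈ T' ∧ c ∈ T') := by
    intro h
    refine hne (hB.2.2 T' hT' ?_)
    rw [ht.diff, Set.pair_subset_iff]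
    exact h
  rw [ht.coe] at hmem
  by_cases hb : b ∈ T'
  · have hc : c ∉ T' := fun hc => hnot ⟨hb, hc⟩
    right
    refine bary_eq_zero_of_mem_segment (convexHull_mono ?_ hmem)
    rintro y ⟨rfl | rfl | rfl, hy⟩
    · simp
    · simp
    · exact absurd hy hc
  · left
    refine bary_eq_zero_of_mem_segment (convexHull_mono ?_ hmem)
    rintro y ⟨rfl | rfl | rfl, hy⟩
    · simp
    · exact absurd hy hb
    · simp

/-- Extension by zero is C¹ across the two other sides of `T`. Across `[b, c]` it would not be, but
`[b, c]` is on Γ_h and there is nothing to match. -/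
lemma IsTriple.bubble_mem (ht : IsTriple T a b c) (hB : M.IsBoundaryEdge T a) :
    M.bubble T a b c ∈ M.clampedC1Cubics := by
  have out : ∀ K K' : M.pieces, K.1.1 = T → K'.1.1 ≠ T → ∀ x ∈ region K, x ∈ region K' →
      val (M.bubble T a b c K) x = 0 ∧ grad (M.bubble T a b c K) x = 0 := by
    intro K K' hK hK' x hx hx'
    exact ht.bubble_zero hK hx (ht.bary_zero_of_mem_hull hB (piece_mem K').1 hK'
      (hK ▸ region_subset K hx) (region_subset K' hx'))
  refine ⟨fun K => ?_, ?_, ?_⟩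
  · by_cases hK : K.1.1 = T
    · rcases ht.bubble_cases hK with ⟨-, -, e⟩ | ⟨-, -, e⟩ | ⟨-, -, e⟩ <;> rw [e]
      · exact totalDegree_bubbleA (isAffPoly_bary _ _ _) (isAffPoly_bary _ _ _)
          (isAffPoly_bary _ _ _)
      · exact totalDegree_bubbleB (isAffPoly_bary _ _ _) (isAffPoly_bary _ _ _)
      · exact totalDegree_bubbleB (isAffPoly_bary _ _ _) (isAffPoly_bary _ _ _)
    · simp [bubble_of_ne hK]
  · rintro K K' x ⟨hx, hx'⟩
    by_cases hK : K.1.1 = T <;> by_cases hK' : K'.1.1 = T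
    · have AB : val (bary a b c) x = val (bary b c a) x →
          val (bubbleA (bary a b c) (bary b c a) (bary c a b)) x =
            val (bubbleB (bary b c a) (bary c a b)) x ∧
          grad (bubbleA (bary a b c) (bary b c a) (bary c a b)) x =
            grad (bubbleB (bary b c a) (bary c a b)) x := fun h =>
        eq_of_sub_eq_sq_mul (bubbleA_sub_bubbleB _ _ _) (by rw [val_sub, h, sub_self])
      have AC : val (bary a b c) x = val (bary c a b) x →
          val (bubbleA (bary a b c) (bary b c a) (bary c a b)) x =
            val (bubbleB (bary c a b) (bary b c a)) x ∧
          grad (bubbleA (bary a b c) (bary b c a) (bary c a b)) x =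
            grad (bubbleB (bary c a b) (bary b c a)) x := fun h => by
        rw [← bubbleA_swap]
        exact eq_of_sub_eq_sq_mul (bubbleA_sub_bubbleB _ _ _) (by rw [val_sub, h, sub_self])
      have BC : val (bary b c a) x = val (bary c a b) x →
          val (bubbleB (bary b c a) (bary c a b)) x =
            val (bubbleB (bary c a b) (bary b c a)) x ∧
          grad (bubbleB (bary b c a) (bary c a b)) x =
            grad (bubbleB (bary c a b) (bary b c a)) x := fun h =>
        eq_of_sub_eq_sq_mul (bubbleB_sub_bubbleB _ _) (by rw [val_sub, h, sub_self])
      rcases ht.bubble_cases hK with ⟨hk, ha, e⟩ | ⟨hk, ha, e⟩ | ⟨hk, ha, e⟩ <;>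
      rcases ht.bubble_cases hK' with ⟨hk', ha', e'⟩ | ⟨hk', ha', e'⟩ | ⟨hk', ha', e'⟩ <;>
      have hb := ha ▸ hk.bary_of_mem_region hx <;>
      have hb' := ha' ▸ hk'.bary_of_mem_region hx' <;>
      rw [e, e']
      · exact ⟨rfl, rfl⟩
      · exact AB (le_antisymm hb.2.1 hb'.2.2)
      · exact AC (le_antisymm hb.2.2 hb'.2.1)
      · exact (AB (le_antisymm hb'.2.1 hb.2.2)).imp Eq.symm Eq.symm
      · exact ⟨rfl, rfl⟩
      · exact BC (le_antisymm hb.2.1 hb'.2.2)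
      · exact (AC (le_antisymm hb'.2.2 hb.2.1)).imp Eq.symm Eq.symm
      · exact (BC (le_antisymm hb'.2.1 hb.2.2)).imp Eq.symm Eq.symm
      · exact ⟨rfl, rfl⟩
    · obtain ⟨h1, h2⟩ := out K K' hK hK' x hx hx'
      rw [h1, h2, bubble_of_ne hK']
      simp [val_zero, grad_zero]
    · obtain ⟨h1, h2⟩ := out K' K hK' hK x hx' hx
      rw [h1, h2, bubble_of_ne hK]
      simp [val_zero, grad_zero]
    · rw [bubble_of_ne hK, bubble_of_ne hK']
      simp
  · rintro K x ⟨hx, T', a', hB', hxT', -⟩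
    by_cases hK : K.1.1 = T
    · refine ht.bubble_zero hK hx ?_
      by_cases hTT : T' = T
      · rw [hTT, ht.eq] at hxT'
        simp only [Finset.mem_insert, Finset.mem_singleton] at hxT'
        rcases hxT' with rfl | rfl | rfl
        · left; exact bary_eq_zero_of_mem_segment (subset_convexHull _ _ (by simp))
        · right; exact bary_eq_zero_of_mem_segment (subset_convexHull _ _ (by simp))
        · left; exact bary_eq_zero_of_mem_segment (subset_convexHull _ _ (by simp))
      · exact ht.bary_zero_of_mem_hull hB hB'.1 hTT (hK ▸ region_subset K hx)
          (subset_convexHull _ _ hxT')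
    · rw [bubble_of_ne hK]
      simp [val_zero, grad_zero]

end Triangulation

/-! ### Local estimates -/

/-- Along the diameter of the disk in the direction of the gradient, the coordinate varies by 2ρ
times the norm of the gradient while staying in [0, 1]. -/
lemma two_mul_norm_grad_bary_le {a b c c₀ : Plane} {ρ : ℝ} (h : tdet a b c ≠ 0) (hρ : 0 < ρ)
    (hball : Metric.closedBall c₀ ρ ⊆ convexHull ℝ ({a, b, c} : Set Plane)) (x : Plane) :
    2 * ρ * ‖grad (bary a b c) x‖ ≤ 1 := by
  set u := grad (bary a b c) x with hu
  by_cases h0 : ‖u‖ = 0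
  · rw [h0]; norm_num
  set e : Plane := (ρ / ‖u‖) • u with he
  have hne : ‖e‖ = ρ := by
    rw [he, norm_smul, Real.norm_eq_abs, abs_div, abs_norm, abs_of_pos hρ, div_mul_cancel₀ _ h0]
  have m1 : c₀ + e ∈ Metric.closedBall c₀ ρ := by simp [hne]
  have m2 : c₀ - e ∈ Metric.closedBall c₀ ρ := by simp [hne]
  have b1 := bary_of_mem_hull h (hball m1)
  have b2 := bary_of_mem_hull h (hball m2)
  have s1 := val_bary_add h (c₀ + e)
  have key := (isAffPoly_bary a b c).val_sub_val (c₀ + e) (c₀ - e) x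
  have e2 : c₀ + e - (c₀ - e) = (2 : ℝ) • e := by module
  rw [e2, ← hu, inner_smul_right, he, inner_smul_right, real_inner_self_eq_norm_sq] at key
  have : ρ / ‖u‖ * ‖u‖ ^ 2 = ρ * ‖u‖ := by field_simp
  rw [this] at key
  linarith [b1.2.1, b1.2.2, b2.1]

lemma one_le_norm_grad_bary {a b c : Plane} (h : tdet a b c ≠ 0) (x : Plane) :
    1 ≤ ‖grad (bary a b c) x‖ * dist a b := by
  have key := (isAffPoly_bary a b c).val_sub_val a b x
  have e1 : val (bary a b c) a = 1 := by rw [val_bary, div_self h]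
  have e2 : val (bary a b c) b = 0 := by rw [val_bary, div_eq_zero_iff]; left; simp [tdet]
  rw [e1, e2, sub_zero] at key
  rw [key, dist_eq_norm]
  exact real_inner_le_norm _ _

lemma IsAff.eq_bary {w : Plane → ℝ} (hw : IsAff w) {a b c : Plane} (h : tdet a b c ≠ 0)
    (x : Plane) : w x = val (bary a b c) x * w a + val (bary b c a) x * w b
      + val (bary c a b) x * w c := by
  obtain ⟨α, β, γ, hw⟩ := hw
  simp only [hw, val_bary, tdet_rotate b c a, tdet_rotate a b c]
  field_simp
  simp only [tdet]; ring

/-- The gradient of a cubic is quadratic, so its increment between two points is exactly the Hessian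
at their mid-point applied to the displacement. -/
lemma inner_grad_sub_sq_le {p : Poly} (hp : p.totalDegree ≤ 3) {x y n : Plane} (hn : ‖n‖ = 1) :
    inner ℝ (grad p x - grad p y) n ^ 2 ≤ hessSq p (midpoint ℝ x y) * ‖x - y‖ ^ 2 := by
  have e0 : (grad p x - grad p y) 0 = hess p 0 0 (midpoint ℝ x y) * (x 0 - y 0)
      + hess p 0 1 (midpoint ℝ x y) * (x 1 - y 1) := by
    obtain ⟨k, rfl⟩ := exists_eq_cubic hp
    simp only [PiLp.sub_apply, grad_cubic_zero, hess_cubic_zero_zero, hess_cubic_zero_one,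
      midpoint_apply]
    ring
  have e1 : (grad p x - grad p y) 1 = hess p 0 1 (midpoint ℝ x y) * (x 0 - y 0)
      + hess p 1 1 (midpoint ℝ x y) * (x 1 - y 1) := by
    obtain ⟨k, rfl⟩ := exists_eq_cubic hp
    simp only [PiLp.sub_apply, grad_cubic_one, hess_cubic_one_one, hess_cubic_zero_one,
      midpoint_apply]
    ring
  have cs := abs_real_inner_le_norm (grad p x - grad p y) n
  rw [hn, mul_one] at cs
  refine (sq_le_sq.2 (cs.trans (le_abs_self _))).trans ?_
  rw [norm_sq_plane, norm_sq_plane, e0, e1, hessSq_eq]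
  simp only [PiLp.sub_apply]
  generalize hess p 0 0 (midpoint ℝ x y) = A
  generalize hess p 0 1 (midpoint ℝ x y) = B
  generalize hess p 1 1 (midpoint ℝ x y) = C
  nlinarith [sq_nonneg (A * (x 1 - y 1) - B * (x 0 - y 0)),
    sq_nonneg (B * (x 1 - y 1) - C * (x 0 - y 0))]

/-- A cubic on a segment with zero Hermite data at both ends is zero, so at the mid-point the
gradient is purely normal. -/
lemma inner_grad_midpoint {p : Poly} (hp : p.totalDegree ≤ 3) {b c : Plane}
    (vb : val p b = 0) (vc : val p c = 0) (gb : grad p b = 0) (gc : grad p c = 0) :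
    inner ℝ (grad p (midpoint ℝ b c)) (c - b) = 0 := by
  have key : inner ℝ (grad p (midpoint ℝ b c)) (c - b) = 3 / 2 * (val p c - val p b)
      - (inner ℝ (grad p b) (c - b) + inner ℝ (grad p c) (c - b)) / 4 := by
    obtain ⟨k, rfl⟩ := exists_eq_cubic hp
    simp only [inner_plane, PiLp.sub_apply, grad_cubic_zero, grad_cubic_one, val_cubic,
      midpoint_apply]
    ring
  rw [key, vb, vc, gb, gc]
  simp

lemma ne_of_tdet {a b c : Plane} (h : tdet a b c ≠ 0) : b ≠ c := by
  rintro rfl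
  exact h (by simp only [tdet]; ring)

lemma normSq_pos {b c : Plane} (h : b ≠ c) : 0 < (c 0 - b 0) ^ 2 + (c 1 - b 1) ^ 2 := by
  have := norm_pos_iff.2 (sub_ne_zero.2 h.symm)
  have h2 : 0 < ‖c - b‖ ^ 2 := by positivity
  rwa [norm_sq_plane] at h2

lemma exists_eq_smul_grad_bary {a b c : Plane} (h : tdet a b c ≠ 0) (x : Plane) {v : Plane}
    (hv : inner ℝ v (c - b) = 0) : ∃ τ : ℝ, v = τ • grad (bary a b c) x := by
  have hL := normSq_pos (ne_of_tdet h)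
  set L := (c 0 - b 0) ^ 2 + (c 1 - b 1) ^ 2 with hLd
  simp only [inner_plane, PiLp.sub_apply] at hv
  refine ⟨tdet a b c * (v 0 * (b 1 - c 1) + v 1 * (c 0 - b 0)) / L, ?_⟩
  apply plane_ext <;>
  simp only [grad_bary, PiLp.smul_apply, smul_eq_mul, Matrix.cons_val_zero, Matrix.cons_val_one] <;>
  field_simp <;> simp only [hLd]
  · linear_combination (c 0 - b 0) * hv
  · linear_combination (c 1 - b 1) * hv

/-- The gradient of λ_a is normal to the edge; Lagrange's identity leaves the fraction 1 − (1/2)² =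
3/4. -/
lemma inner_grad_bary_sq {a b c x n : Plane} (h : tdet a b c ≠ 0) (hn : ‖n‖ = 1)
    (hnbc : |inner ℝ n (c - b)| ≤ 1 / 2 * dist b c) :
    3 / 4 * ‖grad (bary a b c) x‖ ^ 2 ≤ inner ℝ (grad (bary a b c) x) n ^ 2 := by
  have hL := normSq_pos (ne_of_tdet h)
  have hsq : inner ℝ n (c - b) ^ 2 ≤ 1 / 4 * ((c 0 - b 0) ^ 2 + (c 1 - b 1) ^ 2) := by
    have := sq_le_sq' (abs_le.1 hnbc).1 (abs_le.1 hnbc).2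
    rw [mul_pow, dist_comm, dist_eq_norm, norm_sq_plane] at this
    simp only [PiLp.sub_apply] at this
    linarith
  rw [norm_eq_one_iff_plane] at hn
  rw [norm_sq_plane]
  simp only [inner_plane, PiLp.sub_apply, grad_bary, Matrix.cons_val_zero,
    Matrix.cons_val_one] at hsq ⊢
  set e0 := c 0 - b 0
  set e1 := c 1 - b 1 with he1
  have hb : b 1 - c 1 = -e1 := by rw [he1]; ring
  rw [hb]
  set D := tdet a b c
  have l : 3 / 4 * ((-e1 / D) ^ 2 + (e0 / D) ^ 2) = (3 / 4 * (e0 ^ 2 + e1 ^ 2)) / D ^ 2 := by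
    field_simp; ring
  have r : (-e1 / D * n 0 + e0 / D * n 1) ^ 2 = (e0 * n 1 - e1 * n 0) ^ 2 / D ^ 2 := by
    field_simp; ring
  rw [l, r]
  gcongr
  have lag : (e0 * n 1 - e1 * n 0) ^ 2 = (e0 ^ 2 + e1 ^ 2) - (n 0 * e0 + n 1 * e1) ^ 2 := by
    linear_combination (e0 ^ 2 + e1 ^ 2) * hn
  rw [lag]; linarith

/-- The Hessian is affine, so at `Q` it combines the values at the centroid, `b` and `c` with
weights 3λ_a, λ_b − λ_a, λ_c − λ_a. Each weight is at most 3/2 in modulus, and Cauchy–Schwarz gives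
27/4 = 3 · 9/4. Thus a point slightly outside the sub-triangle is controlled. -/
lemma hessSq_le_of_weights {p : Poly} (hp : p.totalDegree ≤ 3) {a b c Q : Plane}
    (h : tdet a b c ≠ 0) (h0 : |val (bary a b c) Q| ≤ 1 / 2)
    (h1 : |val (bary b c a) Q| ≤ 1) (h2 : |val (bary c a b) Q| ≤ 1) :
    hessSq p Q ≤ 27 / 4 * (hessSq p (centroid3 a b c) + hessSq p b + hessSq p c) := by
  have k : ∀ i j, hess p i j Q ^ 2 ≤ 27 / 4 * (hess p i j (centroid3 a b c) ^ 2
      + hess p i j b ^ 2 + hess p i j c ^ 2) := by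
    intro i j
    have haff := isAff_hess hp i j
    have e := haff.eq_bary h Q
    have eG : hess p i j (centroid3 a b c) = (hess p i j a + hess p i j b + hess p i j c) / 3 := by
      obtain ⟨α, β, γ, hw⟩ := haff
      simp only [hw, centroid3_apply]; ring
    generalize hess p i j (centroid3 a b c) = G at *
    generalize hess p i j a = A at *
    generalize hess p i j b = B at *
    generalize hess p i j c = C at *
    generalize hess p i j Q = w at *
    generalize val (bary a b c) Q = x at *
    generalize val (bary b c a) Q = y at *
    generalize val (bary c a b) Q = z at *
    have e' : w = 3 * x * G + (y - x) * B + (z - x) * C := by rw [e, eG]; ring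
    have m0 : (3 * x) ^ 2 ≤ 9 / 4 := by
      rw [abs_le] at h0; nlinarith
    have m1 : (y - x) ^ 2 ≤ 9 / 4 := by
      rw [abs_le] at h0 h1; nlinarith
    have m2 : (z - x) ^ 2 ≤ 9 / 4 := by
      rw [abs_le] at h0 h2; nlinarith
    generalize 3 * x = s at *
    generalize y - x = t at *
    generalize z - x = r at *
    have cs : w ^ 2 ≤ (s ^ 2 + t ^ 2 + r ^ 2) * (G ^ 2 + B ^ 2 + C ^ 2) := by
      rw [e']
      nlinarith [sq_nonneg (s * B - t * G), sq_nonneg (s * C - r * G), sq_nonneg (t * C - r * B)]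
    refine cs.trans (mul_le_mul_of_nonneg_right (by linarith) (by positivity))
  simp only [hessSq_eq]
  linarith [k 0 0, k 0 1, k 1 1]

/-- Estimate of the normal derivative at the mid-point of a boundary edge, when the derivative in
a nearly normal direction vanishes at a nearby point. -/
lemma normalDeriv_sq_le {a b c P n : Plane} {h σ ε τ : ℝ} {p : Poly} (hp : p.totalDegree ≤ 3)
    (hD : tdet a b c ≠ 0) (hh : 0 < h) (hσε : σ * ε ≤ 1) (hε : 0 ≤ ε)
    (ga : ‖grad (bary a b c) 0‖ * h ≤ σ) (gb : ‖grad (bary b c a) 0‖ * h ≤ σ)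
    (gc : ‖grad (bary c a b) 0‖ * h ≤ σ) (ga' : 1 ≤ ‖grad (bary a b c) 0‖ * h)
    (hP : dist P (midpoint ℝ b c) ≤ ε * h) (hn : ‖n‖ = 1)
    (hnbc : |inner ℝ n (c - b)| ≤ 1 / 2 * dist b c)
    (hM : grad p (midpoint ℝ b c) = τ • grad (bary a b c) 0)
    (hPn : inner ℝ (grad p P) n = 0) :
    τ ^ 2 * |tdet a b c| ≤ 648 * (ε ^ 2 * h ^ 4) *
      ∫ x in convexHull ℝ ({centroid3 a b c, b, c} : Set Plane), hessSq p x := by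
  set u := grad (bary a b c) 0 with hu
  set m := midpoint ℝ b c with hm
  -- The point where the exact increment formula between the mid-point and the foot evaluates the
  -- Hessian.
  set Q := midpoint ℝ m P with hQ
  have hQm : ‖Q - m‖ ≤ ε * h / 2 := by
    rw [← dist_eq_norm, hQ, dist_midpoint_left]
    rw [dist_comm] at hP
    norm_num
    linarith
  have near : ∀ x y z : Plane, ‖grad (bary x y z) 0‖ * h ≤ σ →
      |val (bary x y z) Q - val (bary x y z) m| ≤ 1 / 2 := by
    intro x y z hg
    rw [(isAffPoly_bary x y z).val_sub_val Q m 0]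
    refine (abs_real_inner_le_norm _ _).trans ?_
    calc ‖grad (bary x y z) 0‖ * ‖Q - m‖ ≤ ‖grad (bary x y z) 0‖ * (ε * h / 2) := by gcongr
      _ = (‖grad (bary x y z) 0‖ * h) * ε / 2 := by ring
      _ ≤ σ * ε / 2 := by gcongr
      _ ≤ 1 / 2 := by linarith
  have ma : val (bary a b c) m = 0 := by
    rw [val_bary, div_eq_zero_iff]; left
    simp only [tdet, hm, midpoint_apply]; ring
  have mb : val (bary b c a) m = 1 / 2 := by
    rw [val_bary, tdet_rotate a b c, div_eq_iff hD]
    simp only [tdet, hm, midpoint_apply]; ring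
  have mc : val (bary c a b) m = 1 / 2 := by
    rw [val_bary, tdet_rotate b c a, tdet_rotate a b c, div_eq_iff hD]
    simp only [tdet, hm, midpoint_apply]; ring
  have na := near a b c ga
  have nb := near b c a gb
  have nc := near c a b gc
  rw [ma, sub_zero] at na
  rw [mb] at nb
  rw [mc] at nc
  have nb' : |val (bary b c a) Q| ≤ 1 := by
    rw [abs_le] at nb ⊢; constructor <;> linarith
  have nc' : |val (bary c a b) Q| ≤ 1 := by
    rw [abs_le] at nc ⊢; constructor <;> linarith
  have H1 := hessSq_le_of_weights hp hD na nb' nc'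
  have H2 := inner_grad_sub_sq_le hp (x := m) (y := P) hn
  rw [inner_sub_left, hPn, sub_zero, hM, inner_smul_left] at H2
  simp only [conj_trivial] at H2
  have H3 := inner_grad_bary_sq (x := 0) hD hn hnbc
  rw [← hu] at H3
  have H4 : ‖m - P‖ ^ 2 ≤ (ε * h) ^ 2 := by
    rw [← dist_eq_norm, dist_comm]
    gcongr
  have hD' : tdet (centroid3 a b c) b c ≠ 0 := by rw [tdet_centroid3]; positivity
  have H5 := le_integral_hessSq hp hD'
  rw [tdet_centroid3, abs_div, abs_of_pos (by norm_num : (0 : ℝ) < 3)] at H5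
  set I := ∫ x in convexHull ℝ ({centroid3 a b c, b, c} : Set Plane), hessSq p x
  set V := hessSq p (centroid3 a b c) + hessSq p b + hessSq p c
  have hQ0 := hessSq_nonneg p Q
  have A1 : τ ^ 2 * (3 / 4 * ‖u‖ ^ 2) ≤ hessSq p Q * (ε * h) ^ 2 := by
    calc τ ^ 2 * (3 / 4 * ‖u‖ ^ 2) ≤ τ ^ 2 * inner ℝ u n ^ 2 := by gcongr
      _ = (τ * inner ℝ u n) ^ 2 := by ring
      _ ≤ hessSq p Q * ‖m - P‖ ^ 2 := H2
      _ ≤ hessSq p Q * (ε * h) ^ 2 := by gcongr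
  have A2 : 3 / 4 * τ ^ 2 ≤ hessSq p Q * (ε ^ 2 * h ^ 4) := by
    have one : 1 ≤ (‖u‖ * h) ^ 2 := one_le_pow₀ ga'
    calc 3 / 4 * τ ^ 2 = (3 / 4 * τ ^ 2) * 1 := (mul_one _).symm
      _ ≤ (3 / 4 * τ ^ 2) * (‖u‖ * h) ^ 2 := by gcongr
      _ = (τ ^ 2 * (3 / 4 * ‖u‖ ^ 2)) * h ^ 2 := by ring
      _ ≤ (hessSq p Q * (ε * h) ^ 2) * h ^ 2 := by gcongr
      _ = hessSq p Q * (ε ^ 2 * h ^ 4) := by ring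
  -- 486 = 27/4 · 72, where 72 = 3 · 24 comes from the area of the sub-triangle and the mass matrix.
  have A3 : |tdet a b c| * hessSq p Q ≤ 486 * I := by
    calc |tdet a b c| * hessSq p Q ≤ |tdet a b c| * (27 / 4 * V) := by gcongr
      _ = 486 * (|tdet a b c| / 3 / 24 * V) := by ring
      _ ≤ 486 * I := by gcongr
  calc τ ^ 2 * |tdet a b c| = 4 / 3 * (3 / 4 * τ ^ 2) * |tdet a b c| := by ring
    _ ≤ 4 / 3 * (hessSq p Q * (ε ^ 2 * h ^ 4)) * |tdet a b c| := by gcongr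
    _ = 4 / 3 * (ε ^ 2 * h ^ 4) * (|tdet a b c| * hessSq p Q) := by ring
    _ ≤ 4 / 3 * (ε ^ 2 * h ^ 4) * (486 * I) := by gcongr
    _ = 648 * (ε ^ 2 * h ^ 4) * I := by ring

namespace Triangulation
variable {M : Triangulation} {T : Finset Plane} {a b c : Plane}

lemma IsTriple.integral_le {K : M.pieces} (hk : IsTriple K.1.1 K.1.2 b c) {p : Poly}
    (hp : p.totalDegree ≤ 3) {r : ℝ}
    (hr : ∀ x ∈ convexHull ℝ (K.1.1 : Set Plane), hessSq p x ≤ r) :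
    ∫ x in region K, hessSq p x ≤ |tdet K.1.2 b c| / 6 * r := by
  have hD := hk.tdet_ne_zero (piece_mem K).1
  have hD' : tdet (centroid3 K.1.2 b c) b c ≠ 0 := by rw [tdet_centroid3]; positivity
  have m := hk.mem_region
  have := integral_hessSq_le hp hD'
  rw [← hk.region_eq, tdet_centroid3, abs_div, abs_of_pos (by norm_num : (0 : ℝ) < 3)] at this
  refine this.trans ?_
  have h1 := hr _ (region_subset K m.1)
  have h2 := hr _ (region_subset K m.2.1)
  have h3 := hr _ (region_subset K m.2.2)
  calc |tdet K.1.2 b c| / 3 / 6 * _ ≤ |tdet K.1.2 b c| / 3 / 6 * (r + r + r) := by gcongr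
    _ = |tdet K.1.2 b c| / 6 * r := by ring

lemma IsTriple.integral_bubble_le (ht : IsTriple T a b c) (hT : T ∈ M.tri)
    {g : ℝ} (ga : ‖grad (bary a b c) 0‖ ≤ g) (gb : ‖grad (bary b c a) 0‖ ≤ g)
    (gc : ‖grad (bary c a b) 0‖ ≤ g) {K : M.pieces} (hK : K.1.1 = T) :
    ∫ x in region K, hessSq (M.bubble T a b c K) x ≤ |tdet a b c| * 4704 * g ^ 4 := by
  have hD := ht.tdet_ne_zero hT
  have gr : ∀ x y z w : Plane, grad (bary x y z) w = grad (bary x y z) 0 := fun x y z w => by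
    rw [grad_bary, grad_bary]
  have vals : ∀ x ∈ convexHull ℝ (K.1.1 : Set Plane), |val (bary a b c) x| ≤ 1 ∧
      |val (bary b c a) x| ≤ 1 ∧ |val (bary c a b) x| ≤ 1 := by
    intro x hx
    rw [hK, ht.coe] at hx
    obtain ⟨h1, h2, h3⟩ := bary_of_mem_hull hD hx
    have hs := val_bary_add hD x
    rw [abs_of_nonneg h1, abs_of_nonneg h2, abs_of_nonneg h3]
    exact ⟨by linarith, by linarith, by linarith⟩
  -- 4704 = 4 · 84² / 6.
  have e : |tdet a b c| * 4704 * g ^ 4 = |tdet a b c| / 6 * (4 * (84 * g ^ 2) ^ 2) := by ring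
  have A := isAffPoly_bary a b c
  have B := isAffPoly_bary b c a
  have C := isAffPoly_bary c a b
  have g1 : ∀ w, ‖grad (bary a b c) w‖ ≤ g := fun w => by rw [gr]; exact ga
  have g2 : ∀ w, ‖grad (bary b c a) w‖ ≤ g := fun w => by rw [gr]; exact gb
  have g3 : ∀ w, ‖grad (bary c a b) w‖ ≤ g := fun w => by rw [gr]; exact gc
  rw [e]
  rcases ht.bubble_cases hK with ⟨hk, hx, e⟩ | ⟨hk, hx, e⟩ | ⟨hk, hx, e⟩ <;> rw [e]
  · have h1 : ∀ x ∈ convexHull ℝ (K.1.1 : Set Plane), hessSq (bubbleA (bary a b c) (bary b c a)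
        (bary c a b)) x ≤ 4 * (84 * g ^ 2) ^ 2 := fun x hx =>
      hessSq_bubbleA_le A B C (vals x hx).1 (vals x hx).2.1 (vals x hx).2.2 (g1 x) (g2 x) (g3 x)
    have := hk.integral_le (totalDegree_bubbleA A B C) h1
    rwa [hx] at this
  · have h1 : ∀ x ∈ convexHull ℝ (K.1.1 : Set Plane), hessSq (bubbleB (bary b c a)
        (bary c a b)) x ≤ 4 * (84 * g ^ 2) ^ 2 := fun x hx =>
      hessSq_bubbleB_le B C (vals x hx).2.1 (vals x hx).2.2 (g2 x) (g3 x)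
    have := hk.integral_le (totalDegree_bubbleB B C) h1
    rwa [hx, tdet_rotate a b c] at this
  · have h1 : ∀ x ∈ convexHull ℝ (K.1.1 : Set Plane), hessSq (bubbleB (bary c a b)
        (bary b c a)) x ≤ 4 * (84 * g ^ 2) ^ 2 := fun x hx =>
      hessSq_bubbleB_le C B (vals x hx).2.2 (vals x hx).2.1 (g3 x) (g2 x)
    have := hk.integral_le (totalDegree_bubbleB C B) h1
    rwa [hx, tdet_rotate b c a, tdet_rotate a b c] at this

end Triangulation

/-- `P` is the only closest intersection with the boundary of `Ω` of the perpendicular bisector of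
`[b, c]`, it is close to the mid-point, and the normal `n` there is nearly orthogonal to the edge. -/
structure IsFoot (Ω : Set Plane) (ε : ℝ) (b c P n : Plane) : Prop where
  closest : IsClosestIntersection (frontier Ω) b c P
  unique : ∀ Q, IsClosestIntersection (frontier Ω) b c Q → Q = P
  dist_le : dist P (midpoint ℝ b c) ≤ ε * dist b c
  normal : IsOuterUnitNormal Ω P n
  parallel : ∀ n', IsOuterUnitNormal Ω P n' → ∃ k : ℝ, n' = k • n
  inner_le : |inner ℝ n (c - b)| ≤ ε * dist b c

lemma IsClosestIntersection.swap {Γ : Set Plane} {b c P : Plane}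
    (h : IsClosestIntersection Γ b c P) : IsClosestIntersection Γ c b P := by
  obtain ⟨h1, h2, h3⟩ := h
  have e : ∀ Q : Plane, inner ℝ (Q - midpoint ℝ c b) (b - c) =
      -inner ℝ (Q - midpoint ℝ b c) (c - b) := fun Q => by
    rw [midpoint_comm c b, ← inner_neg_right, neg_sub]
  refine ⟨h1, by rw [e, h2, neg_zero], fun Q hQ hQp => ?_⟩
  rw [midpoint_comm c b]
  exact h3 Q hQ (by rw [e] at hQp; linarith)

namespace Triangulation
variable {M : Triangulation} {T : Finset Plane} {a b c : Plane}

/-- With h the diameter, gradients of barycentric coordinates are at most σ/h by the inscribed disk,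
and at least 1/h since λ_a drops from 1 to 0 between `a` and `b`. -/
lemma IsTriple.exists_scale (ht : IsTriple T a b c) (hT : T ∈ M.tri) {σ : ℝ}
    (hM : M.ShapeRegular σ) : ∃ h > 0, h = Metric.diam (convexHull ℝ (T : Set Plane)) ∧
      dist b c ≤ h ∧ ‖grad (bary a b c) 0‖ * h ≤ σ ∧ ‖grad (bary b c a) 0‖ * h ≤ σ ∧
      ‖grad (bary c a b) 0‖ * h ≤ σ ∧ 1 ≤ ‖grad (bary a b c) 0‖ * h := by
  have hD := ht.tdet_ne_zero hT
  obtain ⟨c₀, ρ, hρ, hball, hdiam⟩ := hM T hT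
  set h := Metric.diam (convexHull ℝ (T : Set Plane)) with hh
  have hbdd : Bornology.IsBounded (convexHull ℝ (T : Set Plane)) :=
    (Set.Finite.isCompact_convexHull (𝕜 := ℝ) (Finset.finite_toSet T)).isBounded
  have sub := subset_convexHull ℝ (T : Set Plane)
  have hdist : ∀ x ∈ T, ∀ y ∈ T, dist x y ≤ h := fun x hx y hy =>
    Metric.dist_le_diam_of_mem hbdd (sub hx) (sub hy)
  have hpos : 0 < h := (dist_pos.2 ht.ab).trans_le (hdist a ht.mem.1 b ht.mem.2.1)
  have hσ : 0 < σ := by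
    by_contra hcon
    nlinarith [mul_nonneg (neg_nonneg.2 (not_lt.1 hcon)) hρ.le]
  have key : ∀ x y z, IsTriple T x y z → ‖grad (bary x y z) 0‖ * h ≤ σ := by
    intro x y z hxyz
    have h1 := two_mul_norm_grad_bary_le (hxyz.tdet_ne_zero hT) hρ (hxyz.coe ▸ hball) 0
    calc ‖grad (bary x y z) 0‖ * h ≤ ‖grad (bary x y z) 0‖ * (σ * (2 * ρ)) := by gcongr
      _ = σ * (2 * ρ * ‖grad (bary x y z) 0‖) := by ring
      _ ≤ σ * 1 := by gcongr
      _ = σ := mul_one σ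
  refine ⟨h, hpos, rfl, hdist _ ht.mem.2.1 _ ht.mem.2.2, key _ _ _ ht, key _ _ _ ht.rotate,
    key _ _ _ ht.rotate.rotate, ?_⟩
  refine (one_le_norm_grad_bary hD 0).trans ?_
  gcongr
  exact hdist _ ht.mem.1 _ ht.mem.2.1

lemma diam_le_meshSize (hT : T ∈ M.tri) :
    Metric.diam (convexHull ℝ (T : Set Plane)) ≤ M.meshSize :=
  le_ciSup (f := fun T : M.tri => Metric.diam (convexHull ℝ (T.1 : Set Plane)))
    (Set.finite_range _).bddAbove ⟨T, hT⟩

/-- The correction by a bubble needed to move a zero of the normal derivative from the foot `P` to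
the mid-point of the edge is small. -/
lemma bubble_correction_le {Ω : Set Plane} {σ : ℝ} (hσ : 1 ≤ σ) (hM : M.ShapeRegular σ)
    {K : M.pieces} (hk : IsTriple K.1.1 K.1.2 b c) {P n : Plane}
    (hF : IsFoot Ω (1 / (30000 * σ ^ 2)) b c P n) {p : Poly} (hp : p.totalDegree ≤ 3) {τ : ℝ}
    (hmid : grad p (midpoint ℝ b c) = τ • grad (bary K.1.2 b c) 0)
    (hPn : inner ℝ (grad p P) n = 0) :
    (τ ≠ 0 → 0 < ∫ x in region K, hessSq p x) ∧
    ∀ K' : M.pieces, K'.1.1 = K.1.1 →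
      (2 / 3 * τ) ^ 2 * ∫ x in region K', hessSq (M.bubble K.1.1 K.1.2 b c K') x ≤
        1 / 288 * ∫ x in region K, hessSq p x := by
  obtain ⟨h, hh, -, hbc, ga, gb, gc, ga'⟩ := hk.exists_scale (piece_mem K).1 hM
  have hD := hk.tdet_ne_zero (piece_mem K).1
  set ε := 1 / (30000 * σ ^ 2) with hε
  have hσ2 : 1 ≤ σ ^ 2 := one_le_pow₀ hσ
  have hε0 : 0 < ε := by positivity
  have hε1 : ε * (30000 * σ ^ 2) = 1 := by rw [hε]; field_simp
  have hσε : σ * ε ≤ 1 := by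
    have : σ ≤ 30000 * σ ^ 2 := by nlinarith
    calc σ * ε ≤ (30000 * σ ^ 2) * ε := by gcongr
      _ = 1 := by rw [mul_comm, hε1]
  have hε2 : ε ≤ 1 / 2 := by nlinarith
  have main := normalDeriv_sq_le hp hD hh hσε hε0.le ga gb gc ga'
    (hF.dist_le.trans (by gcongr)) hF.normal.1 (hF.inner_le.trans (by gcongr)) hmid hPn
  rw [← hk.region_eq] at main
  set I := ∫ x in region K, hessSq p x
  have hI : 0 ≤ I := integral_nonneg fun x => hessSq_nonneg p x
  constructor
  · intro hτ
    have : 0 < τ ^ 2 * |tdet K.1.2 b c| := by positivity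
    by_contra hcon
    have h0 : I = 0 := le_antisymm (not_lt.1 hcon) hI
    rw [h0, mul_zero] at main
    linarith
  · intro K' hK'
    have toG : ∀ u : ℝ, u * h ≤ σ → u ≤ σ / h := fun u hu => (le_div_iff₀ hh).2 hu
    have hb := hk.integral_bubble_le (piece_mem K).1 (toG _ ga) (toG _ gb) (toG _ gc) hK'
    -- The bubble energy scales like h⁻⁴ and the squared normal derivative like ε²h⁴, so h cancels;
    -- ε carries σ⁻² to absorb σ⁴, and 30000 is large enough for the numerical factor to be below
    -- 1/288.
    calc (2 / 3 * τ) ^ 2 * _ ≤ (2 / 3 * τ) ^ 2 * (|tdet K.1.2 b c| * 4704 * (σ / h) ^ 4) := by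
          gcongr
      _ = 4 / 9 * 4704 * (σ / h) ^ 4 * (τ ^ 2 * |tdet K.1.2 b c|) := by ring
      _ ≤ 4 / 9 * 4704 * (σ / h) ^ 4 * (648 * (ε ^ 2 * h ^ 4) * I) := by gcongr
      _ = 4 / 9 * 4704 * 648 / 30000 ^ 2 * (ε * (30000 * σ ^ 2)) ^ 2 * I := by
          field_simp
      _ ≤ 1 / 288 * I := by
          rw [hε1]
          gcongr
          norm_num

/-! ### Boundary edges -/

/-- First end of the outer edge of a sub-triangle. -/
def edgeFst (K : M.pieces) : Plane := (exists_isTriple_piece K).choose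
/-- Second end of the outer edge of a sub-triangle. -/
def edgeSnd (K : M.pieces) : Plane := (exists_isTriple_piece K).choose_spec.choose

lemma isTriple_edge (K : M.pieces) : IsTriple K.1.1 K.1.2 (edgeFst K) (edgeSnd K) :=
  (exists_isTriple_piece K).choose_spec.choose_spec

/-- The bubble attached to the outer edge of a sub-triangle. -/
def edgeBubble (K : M.pieces) : M.PiecewisePoly :=
  M.bubble K.1.1 K.1.2 (edgeFst K) (edgeSnd K)

lemma edgeBubble_self (K : M.pieces) : edgeBubble K K =
    bubbleA (bary K.1.2 (edgeFst K) (edgeSnd K)) (bary (edgeFst K) (edgeSnd K) K.1.2)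
      (bary (edgeSnd K) K.1.2 (edgeFst K)) := by
  simp [edgeBubble, bubble]

open Classical in
/-- Combination of bubbles attached to the boundary edges. -/
def bubbleSum (t : M.pieces → ℝ) : M.PiecewisePoly :=
  ∑ K ∈ Finset.univ.filter fun K : M.pieces => M.IsBoundaryEdge K.1.1 K.1.2, t K • edgeBubble K

lemma bubbleSum_mem (t : M.pieces → ℝ) : bubbleSum t ∈ M.clampedC1Cubics := by
  classical
  rw [bubbleSum]
  refine Submodule.sum_mem _ fun K hK => Submodule.smul_mem _ _ ?_
  exact (isTriple_edge K).bubble_mem (Finset.mem_filter.1 hK).2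

/-- A fitted triangle has at most one edge on Γ_h, so the bubbles live in distinct triangles. -/
lemma bubbleSum_apply {Ω : Set Plane} (hfit : M.IsFitted Ω) (t : M.pieces → ℝ) {K K' : M.pieces}
    (hK : M.IsBoundaryEdge K.1.1 K.1.2) (hKK' : K'.1.1 = K.1.1) :
    bubbleSum t K' = t K • edgeBubble K K' := by
  classical
  rw [bubbleSum, Finset.sum_apply, Finset.sum_eq_single K]
  · rfl
  · intro L hL hLK
    have hne : K'.1.1 ≠ L.1.1 := by
      intro h
      have e : L.1.1 = K.1.1 := h.symm.trans hKK'
      have hL' := (Finset.mem_filter.1 hL).2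
      rw [e] at hL'
      exact hLK (Subtype.ext (Sigma.ext e (heq_of_eq (hfit.edge_unique _ _ _ hL' hK))))
    rw [Pi.smul_apply, edgeBubble, bubble_of_ne hne, smul_zero]
  · intro h
    exact (h (by rw [Finset.mem_filter]; exact ⟨Finset.mem_univ _, hK⟩)).elim

lemma bubbleSum_apply_eq_zero (t : M.pieces → ℝ) {K' : M.pieces}
    (h : ∀ K : M.pieces, K.1.1 = K'.1.1 → ¬ M.IsBoundaryEdge K.1.1 K.1.2) :
    bubbleSum t K' = 0 := by
  classical
  rw [bubbleSum, Finset.sum_apply]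
  refine Finset.sum_eq_zero fun L hL => ?_
  have hne : K'.1.1 ≠ L.1.1 := fun e => h L e.symm (Finset.mem_filter.1 hL).2
  rw [Pi.smul_apply, edgeBubble, bubble_of_ne hne, smul_zero]

lemma grad_edgeBubble_midpoint (K : M.pieces) :
    grad (edgeBubble K K) (midpoint ℝ (edgeFst K) (edgeSnd K)) =
      (3 / 2 : ℝ) • grad (bary K.1.2 (edgeFst K) (edgeSnd K)) 0 := by
  have hD := (isTriple_edge K).tdet_ne_zero (piece_mem K).1
  rw [edgeBubble_self]
  set a := K.1.2
  set b := edgeFst K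
  set c := edgeSnd K
  have ma : val (bary a b c) (midpoint ℝ b c) = 0 := by
    rw [val_bary, div_eq_zero_iff]; left
    simp only [tdet, midpoint_apply]; ring
  have mb : val (bary b c a) (midpoint ℝ b c) = 1 / 2 := by
    rw [val_bary, tdet_rotate a b c, div_eq_iff hD]
    simp only [tdet, midpoint_apply]; ring
  have mc : val (bary c a b) (midpoint ℝ b c) = 1 / 2 := by
    rw [val_bary, tdet_rotate b c a, tdet_rotate a b c, div_eq_iff hD]
    simp only [tdet, midpoint_apply]; ring
  rw [grad_bubbleA ma, mb, mc, grad_bary, grad_bary]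
  norm_num

lemma inner_grad_midpoint_edge {v : M.PiecewisePoly} (hv : v ∈ M.clampedC1Cubics) {K : M.pieces}
    (hK : M.IsBoundaryEdge K.1.1 K.1.2) (ht : IsTriple K.1.1 K.1.2 b c) :
    inner ℝ (grad (v K) (midpoint ℝ b c)) (c - b) = 0 := by
  obtain ⟨hdeg, -, hbd⟩ := hv
  have m := ht.mem_region
  have w := mem_boundaryVertices hK ht
  exact inner_grad_midpoint (hdeg K) (hbd K b ⟨m.2.1, w.1⟩).1 (hbd K c ⟨m.2.2, w.2⟩).1
    (hbd K b ⟨m.2.1, w.1⟩).2 (hbd K c ⟨m.2.2, w.2⟩).2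

/-- The tangential derivative at the mid-point is automatically zero, so the whole gradient is an
admissible direction ν. -/
lemma mem_testSpace_iff {v : M.PiecewisePoly} : v ∈ M.testSpace ↔ v ∈ M.clampedC1Cubics ∧
    ∀ K : M.pieces, M.IsBoundaryEdge K.1.1 K.1.2 →
      grad (v K) (midpoint ℝ (edgeFst K) (edgeSnd K)) = 0 := by
  constructor
  · rintro ⟨hv, h⟩
    refine ⟨hv, fun K hK => ?_⟩
    have ht := isTriple_edge K
    have e := inner_grad_midpoint_edge hv hK ht
    have := h K hK _ _ ht.diff _ e
    exact inner_self_eq_zero.1 this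
  · rintro ⟨hv, h⟩
    refine ⟨hv, fun K hK b c hbc ν _ => ?_⟩
    have ht := isTriple_of_diff (M.card_eq _ (piece_mem K).1) (piece_mem K).2 hbc
    have e : midpoint ℝ b c = midpoint ℝ (edgeFst K) (edgeSnd K) := by
      rcases (isTriple_edge K).eq_of ht with ⟨rfl, rfl⟩ | ⟨rfl, rfl⟩
      · rfl
      · exact midpoint_comm _ _
    rw [e, h K hK, inner_zero_left]

/-- Uniqueness of the foot and parallelism of the normals reduce the condition on all admissible
pairs to a single linear equation per edge. -/
lemma mem_trialSpace_iff {Ω : Set Plane} {ε : ℝ} {P n : M.pieces → Plane}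
    (hF : ∀ K : M.pieces, M.IsBoundaryEdge K.1.1 K.1.2 →
      IsFoot Ω ε (edgeFst K) (edgeSnd K) (P K) (n K)) {v : M.PiecewisePoly} :
    v ∈ M.trialSpace Ω ↔ v ∈ M.clampedC1Cubics ∧
      ∀ K : M.pieces, M.IsBoundaryEdge K.1.1 K.1.2 → inner ℝ (grad (v K) (P K)) (n K) = 0 := by
  constructor
  · rintro ⟨hv, h⟩
    exact ⟨hv, fun K hK => h K hK _ _ (isTriple_edge K).diff _ _ (hF K hK).closest
      (hF K hK).normal⟩
  · rintro ⟨hv, h⟩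
    refine ⟨hv, fun K hK b c hbc Q n' hQ hn' => ?_⟩
    have ht := isTriple_of_diff (M.card_eq _ (piece_mem K).1) (piece_mem K).2 hbc
    have hQ' : IsClosestIntersection (frontier Ω) (edgeFst K) (edgeSnd K) Q := by
      rcases (isTriple_edge K).eq_of ht with ⟨rfl, rfl⟩ | ⟨rfl, rfl⟩
      · exact hQ
      · exact hQ.swap
    obtain rfl := (hF K hK).unique Q hQ'
    obtain ⟨k, rfl⟩ := (hF K hK).parallel n' hn'
    rw [inner_smul_right, h K hK, mul_zero]

end Triangulation

/-! ### Energy estimates, comparison of trial and test spaces -/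

lemma hessSq_add_le (p q : Poly) (x : Plane) :
    hessSq (p + q) x ≤ 2 * hessSq p x + 2 * hessSq q x := by
  simp only [hessSq_eq, hess_add]
  nlinarith [sq_nonneg (hess p 0 0 x - hess q 0 0 x), sq_nonneg (hess p 0 1 x - hess q 0 1 x),
    sq_nonneg (hess p 1 1 x - hess q 1 1 x)]

lemma lap_add (p q : Poly) (x : Plane) : lap (p + q) x = lap p x + lap q x := by
  simp only [lap_eq, hess_add]; ring

lemma lap_smul (t : ℝ) (p : Poly) (x : Plane) : lap (t • p) x = t * lap p x := by
  simp only [lap_eq, hess_smul]; ring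

lemma hessSq_smul (t : ℝ) (p : Poly) (x : Plane) : hessSq (t • p) x = t ^ 2 * hessSq p x := by
  simp only [hessSq_eq, hess_smul]; ring

/-- With s = Δp and t = Δq, (s + t)s ≥ 3/4 s² − t² because (s/2 + t)² ≥ 0, and t² ≤ 2|H(q)|². -/
lemma lap_mul_lap_ge (p q : Poly) (x : Plane) :
    3 / 4 * (lap p x * lap p x) - 2 * hessSq q x ≤ lap (p + q) x * lap p x := by
  rw [lap_add]
  simp only [lap_eq, hessSq_eq]
  generalize hess p 0 0 x + hess p 1 1 x = s
  nlinarith [sq_nonneg (s / 2 + (hess q 0 0 x + hess q 1 1 x)),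
    sq_nonneg (hess q 0 0 x - hess q 1 1 x), sq_nonneg (hess q 0 1 x)]

lemma third_le_div_sqrt {A B r : ℝ} (hA : 0 < A) (hB : 0 < B) (h : A ≤ 4 * B)
    (hr : 2 / 3 * B ≤ r) : 1 / 3 ≤ r / (√A * √B) := by
  have h1 : √A ≤ 2 * √B := by
    rw [Real.sqrt_le_left (by positivity), mul_pow, Real.sq_sqrt hB.le]
    linarith
  have h2 : √A * √B ≤ 2 * B := by
    calc √A * √B ≤ 2 * √B * √B := by gcongr
      _ = 2 * B := by rw [mul_assoc, Real.mul_self_sqrt hB.le]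
  rw [le_div_iff₀ (mul_pos (Real.sqrt_pos.2 hA) (Real.sqrt_pos.2 hB))]
  linarith

namespace Triangulation
variable {M : Triangulation}

/-- The squared broken `H²` seminorm. -/
def energy (v : M.PiecewisePoly) : ℝ := ∑ K, ∫ x in region K, hessSq (v K) x

lemma energy_nonneg (v : M.PiecewisePoly) : 0 ≤ energy v :=
  Finset.sum_nonneg fun K _ => integral_region_nonneg v K

lemma integrableOn_region {f : Plane → ℝ} (hf : Continuous f) (K : M.pieces) :
    IntegrableOn f (region K) := hf.continuousOn.integrableOn_compact (isCompact_region K)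

lemma integrableOn_lap (p q : Poly) (K : M.pieces) :
    IntegrableOn (fun x => lap p x * lap q x) (region K) :=
  integrableOn_region ((continuous_lap p).mul (continuous_lap q)) K

lemma energy_add_le (u v : M.PiecewisePoly) : energy (u + v) ≤ 2 * energy u + 2 * energy v := by
  simp only [energy, Finset.mul_sum, ← Finset.sum_add_distrib]
  refine Finset.sum_le_sum fun K _ => ?_
  have iu := (integrableOn_region (continuous_hessSq (u K)) K).const_mul 2
  have iv := (integrableOn_region (continuous_hessSq (v K)) K).const_mul 2
  rw [← integral_const_mul, ← integral_const_mul, ← integral_add iu iv]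
  exact integral_mono (integrableOn_region (continuous_hessSq _) K) (iu.add iv)
    fun x => hessSq_add_le _ _ x

lemma bilin_ge (u v : M.PiecewisePoly) :
    3 / 4 * bilin u u - 2 * energy v ≤ bilin (u + v) u := by
  simp only [energy, bilin, Finset.mul_sum, ← Finset.sum_sub_distrib]
  refine Finset.sum_le_sum fun K _ => ?_
  have iu := (integrableOn_lap (u K) (u K) K).const_mul (3 / 4)
  have iv := (integrableOn_region (continuous_hessSq (v K)) K).const_mul 2
  rw [← integral_const_mul, ← integral_const_mul, ← integral_sub iu iv]
  exact integral_mono (iu.sub iv) (integrableOn_lap _ _ K) fun x => lap_mul_lap_ge _ _ x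

lemma bilin_add_left (u v w : M.PiecewisePoly) : bilin (u + v) w = bilin u w + bilin v w := by
  simp only [bilin, ← Finset.sum_add_distrib]
  refine Finset.sum_congr rfl fun K _ => ?_
  rw [← integral_add (integrableOn_lap _ _ K) (integrableOn_lap _ _ K)]
  simp only [Pi.add_apply, lap_add, add_mul]

lemma bilin_smul_left (t : ℝ) (u w : M.PiecewisePoly) : bilin (t • u) w = t * bilin u w := by
  simp only [bilin, Finset.mul_sum]
  refine Finset.sum_congr rfl fun K _ => ?_
  rw [← integral_const_mul]
  simp only [Pi.smul_apply, lap_smul, mul_assoc]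

lemma bilin_comm (u w : M.PiecewisePoly) : bilin u w = bilin w u := by
  simp only [bilin, mul_comm]

/-- The form `bilin` as a bilinear map. -/
def bilinMap (M : Triangulation) : M.PiecewisePoly →ₗ[ℝ] M.PiecewisePoly →ₗ[ℝ] ℝ :=
  LinearMap.mk₂ ℝ bilin bilin_add_left bilin_smul_left
    (fun u v w => by rw [bilin_comm, bilin_add_left, bilin_comm v, bilin_comm w])
    (fun t u w => by rw [bilin_comm, bilin_smul_left, bilin_comm w]; rfl)

lemma integrableOn_load {Ω : Set Plane} (hΩ : IsC11Domain Ω) {f : Plane → ℝ}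
    (hf : MemLp f 2 (volume.restrict Ω)) (p : Poly) (K : M.pieces) :
    IntegrableOn (fun x => Ω.indicator f x * val p x) (region K) := by
  have : IsFiniteMeasure (volume.restrict Ω) :=
    ⟨by rw [Measure.restrict_apply_univ]; exact hΩ.isBounded.measure_lt_top⟩
  have h1 : IntegrableOn f Ω := hf.integrable (by norm_num)
  have h2 : Integrable (Ω.indicator f) := h1.integrable_indicator hΩ.isOpen.measurableSet
  exact h2.integrableOn.mul_continuousOn (continuous_val p).continuousOn (isCompact_region K)

/-- The linear form `load`. -/
def loadMap (M : Triangulation) {Ω : Set Plane} (hΩ : IsC11Domain Ω) {f : Plane → ℝ}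
    (hf : MemLp f 2 (volume.restrict Ω)) : M.PiecewisePoly →ₗ[ℝ] ℝ where
  toFun := load Ω f
  map_add' u v := by
    simp only [load, ← Finset.sum_add_distrib]
    refine Finset.sum_congr rfl fun K _ => ?_
    rw [← integral_add (integrableOn_load hΩ hf _ K) (integrableOn_load hΩ hf _ K)]
    simp only [Pi.add_apply, val_add, mul_add]
  map_smul' t u := by
    simp only [load, Finset.mul_sum, smul_eq_mul, RingHom.id_apply]
    refine Finset.sum_congr rfl fun K _ => ?_
    rw [← integral_const_mul]
    simp only [Pi.smul_apply, val_smul, mul_left_comm]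

instance finiteDimensional_clampedC1Cubics (M : Triangulation) :
    FiniteDimensional ℝ M.clampedC1Cubics := by
  let f : M.clampedC1Cubics →ₗ[ℝ] (M.pieces → MvPolynomial.restrictTotalDegree (Fin 2) ℝ 3) :=
    LinearMap.pi fun K => LinearMap.codRestrict _
      ((LinearMap.proj K).comp M.clampedC1Cubics.subtype)
      fun v => (MvPolynomial.mem_restrictTotalDegree _ _ _).2 (v.2.1 K)
  refine FiniteDimensional.of_injective f fun u v h => Subtype.ext (funext fun K => ?_)
  exact congrArg Subtype.val (congrFun h K)

lemma testSpace_le : M.testSpace ≤ M.clampedC1Cubics := fun _ h => h.1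

lemma trialSpace_le (Ω : Set Plane) : M.trialSpace Ω ≤ M.clampedC1Cubics := fun _ h => h.1

instance finiteDimensional_testSpace (M : Triangulation) : FiniteDimensional ℝ M.testSpace :=
  Submodule.finiteDimensional_of_le testSpace_le

instance finiteDimensional_trialSpace (M : Triangulation) (Ω : Set Plane) :
    FiniteDimensional ℝ (M.trialSpace Ω) :=
  Submodule.finiteDimensional_of_le (trialSpace_le Ω)

lemma energy_pos {v : M.PiecewisePoly} (hv : v ∈ M.clampedC1Cubics) (h : v ≠ 0) :
    0 < energy v :=
  lt_of_le_of_ne (energy_nonneg v) fun h0 => h (eq_zero_of_integral_hessSq hv h0.symm)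

section Mesh
variable {Ω : Set Plane} {σ : ℝ} {P n : M.pieces → Plane}

/-- Each trial function is close to a test function. -/
lemma exists_test_near (hfit : M.IsFitted Ω) (hσ : 1 ≤ σ) (hM : M.ShapeRegular σ)
    (hF : ∀ K : M.pieces, M.IsBoundaryEdge K.1.1 K.1.2 →
      IsFoot Ω (1 / (30000 * σ ^ 2)) (edgeFst K) (edgeSnd K) (P K) (n K))
    {ψ : M.PiecewisePoly} (hψ : ψ ∈ M.trialSpace Ω) :
    ∃ φ ∈ M.testSpace, ∃ β, ψ = φ + β ∧ energy β ≤ 1 / 96 * energy ψ := by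
  classical
  obtain ⟨hX, hP⟩ := (mem_trialSpace_iff hF).1 hψ
  have hτ : ∀ K : M.pieces, ∃ τ : ℝ, M.IsBoundaryEdge K.1.1 K.1.2 →
      grad (ψ K) (midpoint ℝ (edgeFst K) (edgeSnd K)) =
        τ • grad (bary K.1.2 (edgeFst K) (edgeSnd K)) 0 := by
    intro K
    by_cases hK : M.IsBoundaryEdge K.1.1 K.1.2
    · obtain ⟨τ, h⟩ := exists_eq_smul_grad_bary ((isTriple_edge K).tdet_ne_zero (piece_mem K).1) 0
        (inner_grad_midpoint_edge hX hK (isTriple_edge K))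
      exact ⟨τ, fun _ => h⟩
    · exact ⟨0, fun h => absurd h hK⟩
  choose τ hτ using hτ
  -- The bubble has gradient 3/2 ∇λ_a at the mid-point, whence the factor 2/3.
  set β := bubbleSum (M := M) fun K => 2 / 3 * τ K with hβ
  refine ⟨ψ - β, mem_testSpace_iff.2 ⟨sub_mem hX (bubbleSum_mem _), fun K hK => ?_⟩, β,
    (sub_add_cancel ψ β).symm, ?_⟩
  · rw [Pi.sub_apply, grad_sub, hτ K hK, hβ, bubbleSum_apply hfit _ hK rfl, grad_smul,
      grad_edgeBubble_midpoint, smul_smul, show 2 / 3 * τ K * (3 / 2) = τ K by ring, sub_self]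
  · rw [energy, energy, Finset.mul_sum]
    refine sum_pieces_le fun T hT a b c ht => ?_
    by_cases hB : ∃ K : M.pieces, K.1.1 = T ∧ M.IsBoundaryEdge K.1.1 K.1.2
    · obtain ⟨K, hKT, hK⟩ := hB
      -- Each of the three sub-triangles of `T` costs 1/288 of the energy of ψ on the one adjacent
      -- to the edge, hence 1/96 in total.
      have est := (bubble_correction_le hσ hM (isTriple_edge K) (hF K hK) (hX.1 K) (hτ K hK)
        (hP K hK)).2
      have bd : ∀ K' : M.pieces, K'.1.1 = T → ∫ x in region K', hessSq (β K') x ≤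
          1 / 288 * ∫ x in region K, hessSq (ψ K) x := by
        intro K' hK'
        refine le_trans (le_of_eq ?_) (est K' (hK'.trans hKT.symm))
        rw [← integral_const_mul, hβ, bubbleSum_apply hfit _ hK (hK'.trans hKT.symm)]
        simp only [hessSq_smul]
        rfl
      have bA := bd (piece hT ht.mem.1) rfl
      have bB := bd (piece hT ht.mem.2.1) rfl
      have bC := bd (piece hT ht.mem.2.2) rfl
      have nA := integral_region_nonneg ψ (piece hT ht.mem.1)
      have nB := integral_region_nonneg ψ (piece hT ht.mem.2.1)
      have nC := integral_region_nonneg ψ (piece hT ht.mem.2.2)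
      have hmem : K = piece hT ht.mem.1 ∨ K = piece hT ht.mem.2.1 ∨ K = piece hT ht.mem.2.2 := by
        have hm := (piece_mem K).2
        rw [hKT, ht.eq] at hm
        simp only [Finset.mem_insert, Finset.mem_singleton] at hm
        rcases hm with h | h | h
        · exact Or.inl (Subtype.ext (Sigma.ext hKT (heq_of_eq h)))
        · exact Or.inr (Or.inl (Subtype.ext (Sigma.ext hKT (heq_of_eq h))))
        · exact Or.inr (Or.inr (Subtype.ext (Sigma.ext hKT (heq_of_eq h))))
      rcases hmem with rfl | rfl | rfl <;> linarith
    · have z : ∀ K' : M.pieces, K'.1.1 = T → ∫ x in region K', hessSq (β K') x = 0 := by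
        intro K' hK'
        have : β K' = 0 := bubbleSum_apply_eq_zero _ fun K hK hKB =>
          hB ⟨K, hK.trans hK', hKB⟩
        rw [this]
        simp [hessSq_eq, isAffPoly_zero.hess_eq]
      rw [z (piece hT ht.mem.1) rfl, z (piece hT ht.mem.2.1) rfl, z (piece hT ht.mem.2.2) rfl]
      have nA := integral_region_nonneg ψ (piece hT ht.mem.1)
      have nB := integral_region_nonneg ψ (piece hT ht.mem.2.1)
      have nC := integral_region_nonneg ψ (piece hT ht.mem.2.2)
      linarith

/-- From ψ = φ + β with |β|² ≤ |ψ|²/96: |ψ|² ≤ 4|φ|², hence 2|β|² ≤ |φ|²/12, and 3/4 − 1/12 = 2/3.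
-/
lemma exists_test_bilin_ge (hfit : M.IsFitted Ω) (hσ : 1 ≤ σ) (hM : M.ShapeRegular σ)
    (hF : ∀ K : M.pieces, M.IsBoundaryEdge K.1.1 K.1.2 →
      IsFoot Ω (1 / (30000 * σ ^ 2)) (edgeFst K) (edgeSnd K) (P K) (n K))
    {ψ : M.PiecewisePoly} (hψ : ψ ∈ M.trialSpace Ω) (h0 : ψ ≠ 0) :
    ∃ φ ∈ M.testSpace, φ ≠ 0 ∧ 0 < bilin ψ φ ∧
      1 / 3 ≤ bilin ψ φ / (seminormH2 ψ * seminormH2 φ) := by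
  obtain ⟨φ, hφ, β, rfl, hβ⟩ := exists_test_near hfit hσ hM hF hψ
  have hpos := energy_pos hψ.1 h0
  have h1 := energy_add_le φ β
  have h2 := bilin_ge φ β
  have h3 : bilin φ φ = energy φ := bilin_self hφ.1
  rw [h3] at h2
  have h4 : energy (φ + β) ≤ 4 * energy φ := by linarith
  have hφpos : 0 < energy φ := by linarith
  have h5 : 2 / 3 * energy φ ≤ bilin (φ + β) φ := by linarith
  refine ⟨φ, hφ, ?_, by linarith, ?_⟩
  · rintro rfl
    have : energy (0 : M.PiecewisePoly) = 0 := by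
      simp [energy, hessSq_eq, isAffPoly_zero.hess_eq]
    linarith
  · exact third_le_div_sqrt hpos hφpos h4 h5

/-- The normal derivative of an edge bubble does not vanish at the foot. -/
lemma inner_grad_edgeBubble_ne_zero (hσ : 1 ≤ σ) (hM : M.ShapeRegular σ) {K : M.pieces}
    (hF : IsFoot Ω (1 / (30000 * σ ^ 2)) (edgeFst K) (edgeSnd K) (P K) (n K)) :
    inner ℝ (grad (edgeBubble K K) (P K)) (n K) ≠ 0 := by
  intro h0
  have hdeg : (edgeBubble K K).totalDegree ≤ 3 := by
    rw [edgeBubble_self]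
    exact totalDegree_bubbleA (isAffPoly_bary _ _ _) (isAffPoly_bary _ _ _) (isAffPoly_bary _ _ _)
  -- Applied to the bubble itself, where τ = 3/2 and the correction is the bubble, the estimate
  -- would bound a positive energy by 1/288 of itself.
  obtain ⟨h1, h2⟩ := bubble_correction_le hσ hM (isTriple_edge K) hF hdeg
    (grad_edgeBubble_midpoint K) h0
  have h3 := h1 (by norm_num)
  have h4 := h2 K rfl
  change (2 / 3 * (3 / 2)) ^ 2 * ∫ x in region K, hessSq (edgeBubble K K) x ≤ _ at h4
  linarith

/-- Coefficients of the bubbles correcting the normal derivatives at the feet. -/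
def footCoeff (P n : M.pieces → Plane) (v : M.PiecewisePoly) (K : M.pieces) : ℝ :=
  inner ℝ (grad (v K) (P K)) (n K) / inner ℝ (grad (edgeBubble K K) (P K)) (n K)

lemma bubbleSum_add (s t : M.pieces → ℝ) : bubbleSum (s + t) = bubbleSum s + bubbleSum t := by
  simp only [bubbleSum, Pi.add_apply, add_smul, Finset.sum_add_distrib]

lemma bubbleSum_smul (r : ℝ) (s : M.pieces → ℝ) : bubbleSum (r • s) = r • bubbleSum s := by
  simp only [bubbleSum, Pi.smul_apply, smul_assoc, Finset.smul_sum]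

/-- The linear map correcting a test function by boundary bubbles into a trial function. -/
def testToTrial (M : Triangulation) (P n : M.pieces → Plane) :
    M.testSpace →ₗ[ℝ] M.PiecewisePoly where
  toFun φ := φ.1 - bubbleSum (footCoeff P n φ.1)
  map_add' u v := by
    have : footCoeff P n (u.1 + v.1) = footCoeff P n u.1 + footCoeff P n v.1 := by
      ext K
      simp only [footCoeff, Pi.add_apply, grad_add, inner_add_left, add_div]
    rw [Submodule.coe_add, this, bubbleSum_add]
    abel
  map_smul' r v := by
    have : footCoeff P n (r • v.1) = r • footCoeff P n v.1 := by
      ext K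
      simp only [footCoeff, Pi.smul_apply, grad_smul, real_inner_smul_left, mul_div_assoc,
        smul_eq_mul]
    rw [Submodule.coe_smul, this, bubbleSum_smul, RingHom.id_apply, smul_sub]

lemma testToTrial_apply (P n : M.pieces → Plane) (φ : M.testSpace) :
    testToTrial M P n φ = φ.1 - bubbleSum (footCoeff P n φ.1) := rfl

/-- Subtracting bubbles that cancel the normal derivative at the feet maps test functions into the
trial space. A function in the kernel is a sum of bubbles with zero gradient at the mid-points, so
all its coefficients vanish. -/
lemma finrank_testSpace_le (hfit : M.IsFitted Ω) (hσ : 1 ≤ σ) (hM : M.ShapeRegular σ)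
    (hF : ∀ K : M.pieces, M.IsBoundaryEdge K.1.1 K.1.2 →
      IsFoot Ω (1 / (30000 * σ ^ 2)) (edgeFst K) (edgeSnd K) (P K) (n K)) :
    Module.finrank ℝ M.testSpace ≤ Module.finrank ℝ (M.trialSpace Ω) := by
  have hmem : ∀ φ, testToTrial M P n φ ∈ M.trialSpace Ω := by
    intro φ
    rw [testToTrial_apply]
    refine (mem_trialSpace_iff hF).2 ⟨sub_mem φ.2.1 (bubbleSum_mem _), fun K hK => ?_⟩
    rw [Pi.sub_apply, grad_sub, bubbleSum_apply hfit _ hK rfl, grad_smul, inner_sub_left, footCoeff,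
      real_inner_smul_left, div_mul_cancel₀ _ (inner_grad_edgeBubble_ne_zero hσ hM (hF K hK)),
      sub_self]
  refine LinearMap.finrank_le_finrank_of_injective
    (f := (testToTrial M P n).codRestrict (M.trialSpace Ω) hmem) ?_
  rw [← LinearMap.ker_eq_bot, LinearMap.ker_codRestrict, LinearMap.ker_eq_bot']
  intro φ hφ
  rw [testToTrial_apply, sub_eq_zero] at hφ
  set t := footCoeff P n φ.1
  have t0 : ∀ K : M.pieces, M.IsBoundaryEdge K.1.1 K.1.2 → t K = 0 := by
    intro K hK
    have h1 := (mem_testSpace_iff.1 φ.2).2 K hK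
    rw [hφ, bubbleSum_apply hfit _ hK rfl, grad_smul, grad_edgeBubble_midpoint, smul_smul] at h1
    have hu : grad (bary K.1.2 (edgeFst K) (edgeSnd K)) 0 ≠ 0 := by
      intro h0
      have := one_le_norm_grad_bary ((isTriple_edge K).tdet_ne_zero (piece_mem K).1) 0
      rw [h0, norm_zero, zero_mul] at this
      linarith
    have := (smul_eq_zero.1 h1).resolve_right hu
    linarith
  apply Subtype.ext
  rw [hφ]
  refine Finset.sum_eq_zero fun K hK => ?_
  rw [t0 K (by simpa using hK), zero_smul]

end Mesh

end Triangulation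

/-- One witness suffices: in `EReal` the supremum needs no prior boundedness of the quotients. -/
lemma ereal_le_iSup_div {M : Triangulation} {ψ φ : M.PiecewisePoly} (hφ : φ ∈ M.testSpace)
    (h0 : φ ≠ 0)
    (h : 1 / 3 ≤ Triangulation.bilin ψ φ /
      (Triangulation.seminormH2 ψ * Triangulation.seminormH2 φ)) :
    ((1 / 3 : ℝ) : EReal) ≤ ⨆ φ : {φ : M.PiecewisePoly // φ ∈ M.testSpace ∧ φ ≠ 0},
      ((Triangulation.bilin ψ φ.1 /
        (Triangulation.seminormH2 ψ * Triangulation.seminormH2 φ.1) : ℝ) : EReal) :=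
  (EReal.coe_le_coe_iff.2 h).trans
    (le_iSup (fun φ : {φ : M.PiecewisePoly // φ ∈ M.testSpace ∧ φ ≠ 0} =>
      ((Triangulation.bilin ψ φ.1 /
        (Triangulation.seminormH2 ψ * Triangulation.seminormH2 φ.1) : ℝ) : EReal)) ⟨φ, hφ, h0⟩)

end CloughTocher
end

/-! ### The theorem -/

open CloughTocher CloughTocher.Triangulation in
theorem mainTheorem9 (Ω : Set CloughTocher.Plane) (hΩ : CloughTocher.IsC11Domain Ω) (σ : ℝ) :
    ∃ h₀ : ℝ, 0 < h₀ ∧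
      ∀ M : CloughTocher.Triangulation, M.IsFitted Ω → M.ShapeRegular σ → M.meshSize ≤ h₀ →
        (∀ f : CloughTocher.Plane → ℝ,
          MeasureTheory.MemLp f 2 (MeasureTheory.volume.restrict Ω) →
          ∃! ψ : M.PiecewisePoly, ψ ∈ M.trialSpace Ω ∧
            ∀ φ ∈ M.testSpace,
              CloughTocher.Triangulation.bilin ψ φ = CloughTocher.Triangulation.load Ω f φ) ∧
        (∀ ψ ∈ M.trialSpace Ω, ψ ≠ 0 →
          ((1 / 3 : ℝ) : EReal) ≤ ⨆ φ : {φ : M.PiecewisePoly // φ ∈ M.testSpace ∧ φ ≠ 0},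
            ((CloughTocher.Triangulation.bilin ψ φ.1 /
              (CloughTocher.Triangulation.seminormH2 ψ *
                CloughTocher.Triangulation.seminormH2 φ.1) : ℝ) : EReal)) := by
  -- Shape regularity is monotone in σ, and the constants require σ ≥ 1.
  set s := max σ 1 with hs
  have hs1 : 1 ≤ s := le_max_right _ _
  obtain ⟨h₀, hh₀, foot⟩ := exists_closestIntersection hΩ
    (ε := 1 / (30000 * s ^ 2)) (by positivity)
  refine ⟨h₀, hh₀, fun M hfit hreg hsize => ?_⟩
  have hreg' : M.ShapeRegular s := by
    intro T hT
    obtain ⟨c, ρ, hρ, hball, hdiam⟩ := hreg T hT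
    refine ⟨c, ρ, hρ, hball, hdiam.trans ?_⟩
    gcongr
    exact le_max_left _ _
  have hF : ∀ K : M.pieces, ∃ P n : Plane, M.IsBoundaryEdge K.1.1 K.1.2 →
      IsFoot Ω (1 / (30000 * s ^ 2)) (edgeFst K) (edgeSnd K) P n := by
    intro K
    by_cases hK : M.IsBoundaryEdge K.1.1 K.1.2
    · have ht := isTriple_edge K
      have hv := mem_boundaryVertices hK ht
      obtain ⟨h, -, hh, hbc, -⟩ := ht.exists_scale (piece_mem K).1 hreg'
      obtain ⟨P, n, h1, h2, h3, h4, h5, h6⟩ := foot _ (hfit.vertex_mem hv.1) _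
        (hfit.vertex_mem hv.2) ht.bc
        ((hbc.trans (hh ▸ diam_le_meshSize (piece_mem K).1)).trans hsize)
      exact ⟨P, n, fun _ => ⟨h1, h2, h3, h4, h5, h6⟩⟩
    · exact ⟨0, 0, fun h => absurd h hK⟩
  choose P n hF using hF
  refine ⟨fun f hf => ?_, fun ψ hψ h0 => ?_⟩
  · let B : M.trialSpace Ω →ₗ[ℝ] Module.Dual ℝ M.testSpace :=
      (LinearMap.lcomp ℝ ℝ M.testSpace.subtype).comp
        ((bilinMap M).comp (M.trialSpace Ω).subtype)
    have hB : ∀ ψ φ, B ψ φ = bilin ψ.1 φ.1 := fun _ _ => rfl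
    have hinj : Function.Injective B := by
      rw [← LinearMap.ker_eq_bot, LinearMap.ker_eq_bot']
      intro ψ hψ
      by_contra hne
      obtain ⟨φ, hφ, -, hpos, -⟩ := exists_test_bilin_ge hfit hs1 hreg' hF ψ.2
        (fun h => hne (Subtype.ext h))
      have := hB ψ ⟨φ, hφ⟩
      rw [hψ] at this
      exact hpos.ne this
    -- One inequality comes from the inf-sup bound, the other from the embedding of the test space;
    -- equality turns injectivity into surjectivity.
    have hdim : Module.finrank ℝ (M.trialSpace Ω) =
        Module.finrank ℝ (Module.Dual ℝ M.testSpace) :=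
      le_antisymm (LinearMap.finrank_le_finrank_of_injective hinj)
        (Subspace.dual_finrank_eq.trans_le (finrank_testSpace_le hfit hs1 hreg' hF))
    have hsurj : Function.Surjective B :=
      (LinearMap.injective_iff_surjective_of_finrank_eq_finrank hdim).1 hinj
    obtain ⟨ψ, hψ⟩ := hsurj ((loadMap M hΩ hf).comp M.testSpace.subtype)
    refine ⟨ψ.1, ⟨ψ.2, fun φ hφ => LinearMap.congr_fun hψ ⟨φ, hφ⟩⟩, ?_⟩
    rintro ψ' ⟨hψ', h'⟩
    have : (⟨ψ', hψ'⟩ : M.trialSpace Ω) = ψ := by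
      refine hinj (LinearMap.ext fun φ => ?_)
      rw [hψ]
      exact h' φ.1 φ.2
    exact congrArg Subtype.val this
  · obtain ⟨φ, hφ, hne, -, hge⟩ := exists_test_bilin_ge hfit hs1 hreg' hF hψ h0
    exact ereal_le_iSup_div hφ hne hge
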